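/- Let $Z$ be a Hausdorff, paracompact $C^\infty$ manifold modelled on a finite-dimensional real vector space, and let $\mathcal W=\{W_\lambda\}_{\lambda\in\mathcal I}$ be a good open cover of $Z$ (all nonempty finite intersections $W_{\lambda_0\dots\lambda_p}$ are contractible). Let $\check C^p=\check C^p(\mathcal W,\underline{\mathbb Z})$ be the group of all families $\phi_{\lambda_0\dots\lambda_p}$ of locally constant functions $W_{\lambda_0\dots\lambda_p}\to\mathbb Z$, with the usual differential $\check\partial$ and cup product $(\phi\cup A)_{\lambda_0\dots\lambda_{p+q}}=\phi_{\lambda_0\dots\lambda_p}A_{\lambda_p\dots\lambda_{p+q}}$. Fix a cocycle $F=(F_1,\dots,F_n)\in\check Z^2(\mathcal W,\underline{\mathbb Z}^n)$. Cochain groups of negative degree are $0$. **The Čech row.** For $i<j$ put $C(F)_{ij}=(F_i)_{\lambda_0\lambda_1\lambda_2}(F_j)_{\lambda_0\lambda_2\lambda_3}-(F_i)_{\lambda_1\lambda_2\lambda_3}(F_j)_{\lambda_0\lambda_1\lambda_3}$ (a 3-cochain). Let $C_F^k$ be the group of triples $(\phi^{k0},\phi^{(k-1)1},\phi^{(k-2)2})$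 with $\phi^{k0}\in\check C^k$, $\phi^{(k-1)1}=(\phi^{(k-1)1}_l)_{1\le l\le n}$ in $(\check C^{k-1})^n$, and $\phi^{(k-2)2}=(\phi^{(k-2)2}_{ij})_{i<j}$ in $(\check C^{k-2})^{\binom n2}$, and put $$D_F(\phi^{k0},\phi^{(k-1)1},\phi^{(k-2)2})=\big(\check\partial\phi^{k0}+(-1)^{k+1}(\phi^{(k-1)1}\cup_1F+\phi^{(k-2)2}\cup_2C(F)),\ \check\partial\phi^{(k-1)1}+(-1)^k\phi^{(k-2)2}\cup_1F,\ \check\partial\phi^{(k-2)2}\big),$$ where $\phi^{(k-1)1}\cup_1F=\sum_l\phi^{(k-1)1}_l\cup F_l$, $\phi^{(k-2)2}\cup_2C(F)=\sum_{i<j}\phi^{(k-2)2}_{ij}\cup C(F)_{ij}$ and $(\phi^{(k-2)2}\cup_1F)_l=\sum_{i<l}\phi^{(k-2)2}_{il}\cup F_i-\sum_{j>l}\phi^{(k-2)2}_{lj}\cup F_j$. Let $\mathbb H_F^k(\mathcal W,\underline{\mathbb Z})$ be the degree $k$ cohomology of $(C_F^\bullet,D_F)$, and $\overline{\mathbb H}{}_F^{k-1}(\mathcal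 W,\underline{\mathbb Z})$ the degree $k$ cohomology of the complex of pairs $(\phi^{(k-1)1},\phi^{(k-2)2})$ obtained by removing the first entry. The integer Čech Gysin sequence is $$0\to\check H^0\to\mathbb H^0_F\to\cdots\to\check H^k(\mathcal W,\underline{\mathbb Z})\xrightarrow{\pi^*}\mathbb H_F^k(\mathcal W,\underline{\mathbb Z})\xrightarrow{\pi_*}\overline{\mathbb H}{}_F^{k-1}(\mathcal W,\underline{\mathbb Z})\xrightarrow{\cup F}\check H^{k+1}(\mathcal W,\underline{\mathbb Z})\to\cdots,$$ with $\pi^*[\phi]=[\phi,0,0]$, $\pi_*$ forgetting the first entry, and $\cup F:[\phi^{(k-1)1},\phi^{(k-2)2}]\mapsto[(-1)^k(\phi^{(k-1)1}\cup_1F+\phi^{(k-2)2}\cup_2C(F))]$. **The de Rham row.** Given closed forms $F_2=((F_2)_1,\dots,(F_2)_n)\in\Omega^2(Z)^n$, replace $\check C^p$ by $\Omega^p(Z)$, $\check\partial$ by $d$, $\cup F_l$ by $\wedge(F_2)_l$ and $C(F)$ by $0$ in the definitions above. The cohomology of the resulting complex of triples $(H_{k0},H_{(k-1)1},H_{(k-2)2})$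 is $H^{k,(0,2)}_{F_2}(Z,\mathfrak t^*)$ and that of the complex of pairs $(H_{(k-1)1},H_{(k-2)2})$ is $H^{k,(1,2)}_{F_2}(Z,\mathfrak t^*)$; the dimensionally reduced Gysin sequence of Bouwknegt–Hannabuss–Mathai is $$0\to H^0_{dR}\to H^{0,(0,2)}_{F_2}\to\cdots\to H^k_{dR}(Z)\xrightarrow{\pi^*}H^{k,(0,2)}_{F_2}(Z,\mathfrak t^*)\xrightarrow{\pi_*}H^{k,(1,2)}_{F_2}(Z,\mathfrak t^*)\xrightarrow{\wedge F_2}H^{k+1}_{dR}(Z)\to\cdots,$$ with $\pi^*[H]=[H,0,0]$, $\pi_*$ forgetting the first entry, and $\wedge F_2:[H_{(k-1)1},H_{(k-2)2}]\mapsto[(-1)^k\sum_l(H_{(k-1)1})_l\wedge(F_2)_l]$. **The vertical maps.** There is a smooth partition of unity $\{\rho_\lambda\}$ with locally finite supports and $\operatorname{supp}\rho_\lambda\subset W_\lambda$. For every such $\{\rho_\lambda\}$ the collating formula $$(F_2)_l|_{W_{\lambda_0}}=\sum_{\lambda_1,\lambda_2}(F_l)_{\lambda_0\lambda_1\lambda_2}\,d\rho_{\lambda_1}\wedge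 d\rho_{\lambda_2}$$ defines closed global forms $F_2\in\Omega^2(Z)^n$. With this $F_2$, the following formulas (on each $W_{\lambda_0}$) send cocycles to well-defined global smooth cocycles and induce well-defined homomorphisms on cohomology, for all $k\ge0$: 1. $\check H^k(\mathcal W,\underline{\mathbb Z})\to H^k_{dR}(Z)$, $\;[\phi]\mapsto\big[\sum_{\lambda_1\dots\lambda_k}\phi_{\lambda_0\dots\lambda_k}d\rho_{\lambda_1}\cdots d\rho_{\lambda_k}\big]$; 2. $\mathbb H^k_F(\mathcal W,\underline{\mathbb Z})\to H^{k,(0,2)}_{F_2}(Z,\mathfrak t^*)$, $\;[\phi^{k0},\phi^{(k-1)1},\phi^{(k-2)2}]\mapsto[H_{k0},H_{(k-1)1},H_{(k-2)2}]$; 3. $\overline{\mathbb H}{}^{k-1}_F(\mathcal W,\underline{\mathbb Z})\to H^{k,(1,2)}_{F_2}(Z,\mathfrak t^*)$, $\;[\phi^{(k-1)1},\phi^{(k-2)2}]\mapsto[H_{(k-1)1},H_{(k-2)2}]$; where $$(H_{(k-2)2})_{ij}=\sum_{\lambda_1\dots\lambda_{k-2}}(\phi^{(k-2)2}_{ij})_{\lambda_0\dots\lambda_{k-2}}d\rho_{\lambda_1}\cdots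 d\rho_{\lambda_{k-2}},$$ $$(H_{(k-1)1})_l=\sum_{\lambda_1\dots\lambda_{k-1}}(\phi^{(k-1)1}_l)_{\lambda_0\dots\lambda_{k-1}}d\rho_{\lambda_1}\cdots d\rho_{\lambda_{k-1}}+\sum_{\lambda_1\dots\lambda_k}(\check\partial\phi^{(k-1)1}_l)_{\lambda_0\dots\lambda_k}\rho_{\lambda_1}d\rho_{\lambda_2}\cdots d\rho_{\lambda_k},$$ $$H_{k0}=\sum_{\lambda_1\dots\lambda_k}\phi^{k0}_{\lambda_0\dots\lambda_k}d\rho_{\lambda_1}\cdots d\rho_{\lambda_k}+\sum_{\lambda_1\dots\lambda_{k+1}}(\check\partial\phi^{k0})_{\lambda_0\dots\lambda_{k+1}}\rho_{\lambda_1}d\rho_{\lambda_2}\cdots d\rho_{\lambda_{k+1}}+(-1)^{k+1}D(\phi^{(k-2)2},C(F)),$$ and the correction term is $0$ for $k<2$ and, for $k\ge2$, $$D(\phi,C(F))=(-1)^k\sum_{i<j}\sum_{\lambda_1\dots\lambda_{k+2}}(\phi_{ij})_{\lambda_1\dots\lambda_{k-1}}\,E^{ij}_{\lambda_{k-1}\lambda_k\lambda_{k+1}\lambda_{k+2}}\,\rho_{\lambda_1}\rho_{\lambda_k}\,d\rho_{\lambda_2}\cdots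 d\rho_{\lambda_{k-1}}d\rho_{\lambda_{k+1}}d\rho_{\lambda_{k+2}},$$ $$E^{ij}_{0123}=(F_i)_{012}(F_j)_{023}+(F_i)_{120}(F_j)_{123}+(F_i)_{213}(F_j)_{310}.$$ **Conclusion.** Both rows are exact, and these maps form a commutative ladder from the integer Čech Gysin sequence to the dimensionally reduced de Rham Gysin sequence: for every $k\ge0$ the three squares $$\begin{array}{ccccccc}\check H^k(\mathcal W,\underline{\mathbb Z})&\xrightarrow{\pi^*}&\mathbb H^k_F(\mathcal W,\underline{\mathbb Z})&\xrightarrow{\pi_*}&\overline{\mathbb H}{}^{k-1}_F(\mathcal W,\underline{\mathbb Z})&\xrightarrow{\cup F}&\check H^{k+1}(\mathcal W,\underline{\mathbb Z})\\ \downarrow&&\downarrow&&\downarrow&&\downarrow\\ H^k_{dR}(Z)&\xrightarrow{\pi^*}&H^{k,(0,2)}_{F_2}(Z,\mathfrak t^*)&\xrightarrow{\pi_*}&H^{k,(1,2)}_{F_2}(Z,\mathfrak t^*)&\xrightarrow{\wedge F_2}&H^{k+1}_{dR}(Z)\end{array}$$ commute. -/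

import Mathlib

open scoped Manifold ContDiff
noncomputable section
namespace GysinLadder
section Forms
variable {E : Type*} [NormedAddCommGroup E] [NormedSpace ℝ E]

theorem alternatingMap_continuous [FiniteDimensional ℝ E] {p : ℕ} (f : E [⋀^Fin p]→ₗ[ℝ] ℝ) :
    Continuous f := by
  let b := Module.finBasis ℝ E
  have h : ∀ v : Fin p → E, f v = ∑ r : Fin p → Fin (Module.finrank ℝ E),
      (∏ a, b.repr (v a) (r a)) * f fun a => b (r a) := by
    intro v
    conv_lhs => rw [show v = fun a => ∑ i, b.repr (v a) i • b i from
      funext fun a => (b.sum_repr (v a)).symm]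
    have := f.toMultilinearMap.map_sum (fun (a : Fin p) i => b.repr (v a) i • b i)
    refine this.trans (Finset.sum_congr rfl fun r _ => ?_)
    exact f.toMultilinearMap.map_smul_univ (fun a => b.repr (v a) (r a)) (fun a => b (r a))
  have hc : ∀ i, Continuous fun x : E => b.repr x i := fun i =>
    (b.coord i).continuous_of_finiteDimensional
  have : (f : (Fin p → E) → ℝ) = fun v => ∑ r : Fin p → Fin (Module.finrank ℝ E),
      (∏ a, b.repr (v a) (r a)) * f fun a => b (r a) := funext h
  rw [this]
  refine continuous_finsetSum _ fun r _ => ?_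
  refine Continuous.mul (continuous_finsetProd _ fun a _ => ?_) continuous_const
  exact (hc (r a)).comp (continuous_apply a)

instance [FiniteDimensional ℝ E] (p : ℕ) : FiniteDimensional ℝ (E [⋀^Fin p]→L[ℝ] ℝ) := by
  let L : (E [⋀^Fin p]→L[ℝ] ℝ) →ₗ[ℝ] MultilinearMap ℝ (fun _ : Fin p => E) ℝ :=
    { toFun := fun f => f.toMultilinearMap, map_add' := fun _ _ => rfl, map_smul' := fun _ _ => rfl }
  refine FiniteDimensional.of_injective L fun f g h => ?_
  ext v
  exact congrArg (fun m : MultilinearMap ℝ (fun _ : Fin p => E) ℝ => m v) h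

/-- The wedge product of two alternating forms, as the signed sum over `(p, q)`-shuffles. -/
def wedge [FiniteDimensional ℝ E] {p q : ℕ} (α : E [⋀^Fin p]→L[ℝ] ℝ) (β : E [⋀^Fin q]→L[ℝ] ℝ) :
    E [⋀^Fin (p + q)]→L[ℝ] ℝ :=
  let f : E [⋀^Fin (p + q)]→ₗ[ℝ] ℝ := ((LinearMap.mul' ℝ ℝ).compAlternatingMap
    (α.toAlternatingMap.domCoprod β.toAlternatingMap)).domDomCongr finSumFinEquiv
  { f with cont := alternatingMap_continuous f }

theorem wedge_apply [FiniteDimensional ℝ E] {p q : ℕ} (α : E [⋀^Fin p]→L[ℝ] ℝ)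
    (β : E [⋀^Fin q]→L[ℝ] ℝ) (v : Fin (p + q) → E) :
    wedge α β v = LinearMap.mul' ℝ ℝ (AlternatingMap.domCoprod' (α.toAlternatingMap ⊗ₜ[ℝ]
      β.toAlternatingMap) fun i => v (finSumFinEquiv i)) := rfl

def wedgeLin [FiniteDimensional ℝ E] (p q : ℕ) :
    (E [⋀^Fin p]→L[ℝ] ℝ) →ₗ[ℝ] (E [⋀^Fin q]→L[ℝ] ℝ) →ₗ[ℝ] E [⋀^Fin (p + q)]→L[ℝ] ℝ :=
  LinearMap.mk₂ ℝ wedge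
    (fun a a' b => by
      ext v
      simp only [wedge_apply, ContinuousAlternatingMap.add_apply]
      rw [← map_add, ← AlternatingMap.add_apply, ← map_add, ← TensorProduct.add_tmul]; rfl)
    (fun c a b => by
      ext v
      simp only [wedge_apply, ContinuousAlternatingMap.smul_apply]
      rw [← map_smul, ← AlternatingMap.smul_apply, ← map_smul, TensorProduct.smul_tmul']; rfl)
    (fun a b b' => by
      ext v
      simp only [wedge_apply, ContinuousAlternatingMap.add_apply]
      rw [← map_add, ← AlternatingMap.add_apply, ← map_add, ← TensorProduct.tmul_add]; rfl)
    (fun c a b => by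
      ext v
      simp only [wedge_apply, ContinuousAlternatingMap.smul_apply]
      rw [← map_smul, ← AlternatingMap.smul_apply, ← map_smul, ← TensorProduct.tmul_smul]; rfl)

theorem wedge_comp [FiniteDimensional ℝ E] {p q : ℕ} (α : E [⋀^Fin p]→L[ℝ] ℝ)
    (β : E [⋀^Fin q]→L[ℝ] ℝ) (A : E →L[ℝ] E) :
    (wedge α β).compContinuousLinearMap A =
      wedge (α.compContinuousLinearMap A) (β.compContinuousLinearMap A) := by
  ext v
  simp only [wedge_apply, ContinuousAlternatingMap.compContinuousLinearMap_apply,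
    AlternatingMap.domCoprod'_apply, AlternatingMap.domCoprod_apply, sum_apply]
  congr 1
  refine Finset.sum_congr rfl fun σ _ => ?_
  induction σ using Quotient.inductionOn' with | _ σ
  rfl

/-- The wedge product `θ 0 ∧ ⋯ ∧ θ (p - 1)` of `p` covectors:
`(θ 0 ∧ ⋯ ∧ θ (p - 1)) (v 0, …, v (p - 1)) = det (θ a (v b))`. -/
def detForm {p : ℕ} (θ : Fin p → (E →L[ℝ] ℝ)) : E [⋀^Fin p]→L[ℝ] ℝ :=
  { (Matrix.detRowAlternating (n := Fin p) (R := ℝ)).compLinearMap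
      (LinearMap.pi fun a => (θ a).toLinearMap) with
    cont := by
      have : Continuous fun v : Fin p → E => Matrix.det (Matrix.of fun b a => θ a (v b)) := by
        apply Continuous.matrix_det; fun_prop
      exact this }

theorem detForm_apply {p : ℕ} (θ : Fin p → (E →L[ℝ] ℝ)) (v : Fin p → E) :
    detForm θ v = Matrix.det (Matrix.of fun b a => θ a (v b)) := rfl

variable {Z : Type*} [TopologicalSpace Z] [ChartedSpace E Z]

variable (E Z) in
/-- Families `z ↦ η z` of alternating `k`-forms on the tangent spaces of `Z`, with no smoothness. -/
abbrev RawForm (k : ℕ) : Type _ := (z : Z) → TangentSpace 𝓘(ℝ, E) z [⋀^Fin k]→L[ℝ] ℝ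

/-- The pullback of `η` under the inverse of the chart `e` (meaningful on `e.target`). -/
def chartRep {k : ℕ} (e : OpenPartialHomeomorph Z E) (η : RawForm E Z k) (x : E) :
    E [⋀^Fin k]→L[ℝ] ℝ :=
  (η (e.symm x)).compContinuousLinearMap (mfderiv 𝓘(ℝ, E) 𝓘(ℝ, E) e.symm x)

variable (E Z) in
/-- `Ω^k(Z)`: the smooth differential `k`-forms on `Z`, i.e. the families of alternating forms all of
whose coordinate representations are `C^∞`. -/
def Form (k : ℕ) : Submodule ℝ (RawForm E Z k) where
  carrier := {η | ∀ e ∈ atlas E Z, ContDiffOn ℝ ∞ (chartRep e η) e.target}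
  add_mem' := by
    intro a b ha hb e he
    exact (ha e he).add (hb e he)
  zero_mem' := by
    intro e he
    exact contDiffOn_const (c := (0 : E [⋀^Fin k]→L[ℝ] ℝ))
  smul_mem' := by
    intro c a ha e he
    exact (ha e he).const_smul c

/-- The exterior derivative, computed at `z` in the preferred chart at `z`. It does not depend on
the chart, see `chartRep_rawExtDeriv`. -/
def rawExtDeriv {k : ℕ} (η : RawForm E Z k) : RawForm E Z (k + 1) := fun z =>
  (extDeriv (chartRep (chartAt E z) η) (chartAt E z z)).compContinuousLinearMap
    (mfderiv 𝓘(ℝ, E) 𝓘(ℝ, E) (chartAt E z) z)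

section
variable [IsManifold 𝓘(ℝ, E) ∞ Z]

theorem mdiff_chart {e : OpenPartialHomeomorph Z E} (he : e ∈ atlas E Z) {z : Z} (hz : z ∈ e.source) :
    MDifferentiableAt 𝓘(ℝ, E) 𝓘(ℝ, E) e z :=
  haveI : IsManifold 𝓘(ℝ, E) 1 Z := IsManifold.of_le (n := ∞) (by simp)
  (mdifferentiable_of_mem_atlas (I := 𝓘(ℝ, E)) he).mdifferentiableAt hz

theorem mdiff_chart_symm {e : OpenPartialHomeomorph Z E} (he : e ∈ atlas E Z) {x : E}
    (hx : x ∈ e.target) : MDifferentiableAt 𝓘(ℝ, E) 𝓘(ℝ, E) e.symm x :=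
  haveI : IsManifold 𝓘(ℝ, E) 1 Z := IsManifold.of_le (n := ∞) (by simp)
  (mdifferentiable_of_mem_atlas (I := 𝓘(ℝ, E)) he).mdifferentiableAt_symm hx

theorem transition_contDiffAt {e e' : OpenPartialHomeomorph Z E} (he : e ∈ atlas E Z)
    (he' : e' ∈ atlas E Z) {x : E} (hx : x ∈ e'.target) (hx' : e'.symm x ∈ e.source) :
    ContDiffAt ℝ ∞ (e ∘ e'.symm) x := by
  rw [← contMDiffAt_iff_contDiffAt]
  exact (contMDiffAt_of_mem_maximalAtlas (I := 𝓘(ℝ, E)) (n := ∞)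
    (IsManifold.subset_maximalAtlas he) hx').comp x
    (contMDiffAt_symm_of_mem_maximalAtlas (I := 𝓘(ℝ, E)) (n := ∞)
      (IsManifold.subset_maximalAtlas he') hx)

theorem chartRep_change {k : ℕ} (η : RawForm E Z k) {e e' : OpenPartialHomeomorph Z E}
    (he : e ∈ atlas E Z) (he' : e' ∈ atlas E Z) {x : E} (hx : x ∈ e'.target)
    (hx' : e'.symm x ∈ e.source) :
    chartRep e' η x = (chartRep e η ((e ∘ e'.symm) x)).compContinuousLinearMap
      (fderiv ℝ (e ∘ e'.symm) x) := by
  have h1 : e.symm ((e ∘ e'.symm) x) = e'.symm x := e.left_inv hx'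
  have hev : e.symm ∘ (e ∘ e'.symm) =ᶠ[nhds x] e'.symm := by
    have : e'.symm ⁻¹' e.source ∈ nhds x :=
      (e'.continuousAt_symm hx).preimage_mem_nhds (e.open_source.mem_nhds hx')
    filter_upwards [this] with y hy
    exact e.left_inv hy
  have h2 : mfderiv 𝓘(ℝ, E) 𝓘(ℝ, E) e'.symm x =
      (mfderiv 𝓘(ℝ, E) 𝓘(ℝ, E) e.symm ((e ∘ e'.symm) x)).comp
        (mfderiv 𝓘(ℝ, E) 𝓘(ℝ, E) (e ∘ e'.symm) x) := by
    have := mfderiv_comp (I := 𝓘(ℝ, E)) (I' := 𝓘(ℝ, E)) (I'' := 𝓘(ℝ, E)) x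
      (mdiff_chart_symm he (e.map_source hx'))
      ((mdiff_chart he hx').comp x (mdiff_chart_symm he' hx))
    rw [← hev.mfderiv_eq]
    exact this
  rw [mfderiv_eq_fderiv] at h2
  have h3 : ∀ z z' : Z, z = z' → (η z : E [⋀^Fin k]→L[ℝ] ℝ) = η z' := by
    rintro z _ rfl; rfl
  ext v
  have h4 := h3 _ _ h1
  have h5 : ∀ w : E, mfderiv 𝓘(ℝ, E) 𝓘(ℝ, E) e'.symm x w =
      mfderiv 𝓘(ℝ, E) 𝓘(ℝ, E) e.symm ((e ∘ e'.symm) x) (fderiv ℝ (e ∘ e'.symm) x w) :=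
    fun w => congrArg (fun L : E →L[ℝ] E => L w) h2
  change (η (e'.symm x) : E [⋀^Fin k]→L[ℝ] ℝ) (fun a => mfderiv 𝓘(ℝ, E) 𝓘(ℝ, E) e'.symm x (v a)) =
    (η (e.symm ((e ∘ e'.symm) x)) : E [⋀^Fin k]→L[ℝ] ℝ) (fun a =>
      mfderiv 𝓘(ℝ, E) 𝓘(ℝ, E) e.symm ((e ∘ e'.symm) x) (fderiv ℝ (e ∘ e'.symm) x (v a)))
  rw [h4]
  exact congrArg _ (funext fun a => h5 (v a))

theorem chartRep_rawExtDeriv {k : ℕ} {η : RawForm E Z k} (hη : η ∈ Form E Z k)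
    {e : OpenPartialHomeomorph Z E} (he : e ∈ atlas E Z) {x : E} (hx : x ∈ e.target) :
    chartRep e (rawExtDeriv η) x = extDeriv (chartRep e η) x := by
  set z := e.symm x with hz
  set c := chartAt E z with hc
  have hcat : c ∈ atlas E Z := chart_mem_atlas E z
  have hzc : z ∈ c.source := mem_chart_source E z
  have hev : chartRep e η =ᶠ[nhds x] fun y => (chartRep c η ((c ∘ e.symm) y)).compContinuousLinearMap
      (fderiv ℝ (c ∘ e.symm) y) := by
    have : e.symm ⁻¹' c.source ∈ nhds x :=
      (e.continuousAt_symm hx).preimage_mem_nhds (c.open_source.mem_nhds hzc)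
    filter_upwards [this, e.open_target.mem_nhds hx] with y hy hy'
    exact chartRep_change η hcat he hy' hy
  have hd : DifferentiableAt ℝ (chartRep c η) ((c ∘ e.symm) x) :=
    ((hη c hcat).contDiffAt (c.open_target.mem_nhds (c.map_source hzc))).differentiableAt (by simp)
  rw [hev.extDeriv_eq, extDeriv_pullback hd (transition_contDiffAt hcat he hx hzc)
    (by rw [minSmoothness_of_isRCLikeNormedField]; exact WithTop.coe_le_coe.2 (le_top : (2 : ℕ∞) ≤ ⊤))]
  have h2 : (mfderiv 𝓘(ℝ, E) 𝓘(ℝ, E) c z).comp (mfderiv 𝓘(ℝ, E) 𝓘(ℝ, E) e.symm x) =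
      mfderiv 𝓘(ℝ, E) 𝓘(ℝ, E) (c ∘ e.symm) x :=
    (mfderiv_comp (I := 𝓘(ℝ, E)) (I' := 𝓘(ℝ, E)) (I'' := 𝓘(ℝ, E)) x
      (mdiff_chart hcat hzc) (mdiff_chart_symm he hx)).symm
  rw [mfderiv_eq_fderiv] at h2
  rw [← h2]
  rfl

theorem rawExtDeriv_mem {k : ℕ} {η : RawForm E Z k} (hη : η ∈ Form E Z k) :
    rawExtDeriv η ∈ Form E Z (k + 1) := by
  intro e he
  have : ContDiffOn ℝ ∞ (extDeriv (chartRep e η)) e.target := by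
    have h := (hη e he).fderiv_of_isOpen e.open_target (m := ∞) (by simp)
    exact (ContinuousAlternatingMap.alternatizeUncurryFinCLM ℝ E ℝ).contDiff.comp_contDiffOn h
  exact this.congr fun x hx => chartRep_rawExtDeriv hη he hx

variable (E Z) in
/-- The exterior derivative `d : Ω^k(Z) → Ω^(k+1)(Z)`. -/
def dForm (k : ℕ) : Form E Z k →+ Form E Z (k + 1) :=
  AddMonoidHom.mk' (fun η => ⟨rawExtDeriv η.1, rawExtDeriv_mem η.2⟩) fun a b => by
    apply Subtype.ext
    funext z
    have hd : ∀ η : Form E Z k,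
        DifferentiableAt ℝ (chartRep (chartAt E z) η.1) (chartAt E z z) := fun η =>
      ((η.2 _ (chart_mem_atlas E z)).contDiffAt ((chartAt E z).open_target.mem_nhds
        (mem_chart_target E z))).differentiableAt (by simp)
    have h := extDeriv_add (hd a) (hd b)
    have h' : chartRep (chartAt E z) (a + b).1 =
      chartRep (chartAt E z) a.1 + chartRep (chartAt E z) b.1 := rfl
    change (extDeriv (chartRep (chartAt E z) (a + b).1) (chartAt E z z)).compContinuousLinearMap
      (mfderiv 𝓘(ℝ, E) 𝓘(ℝ, E) (chartAt E z) z) = _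
    rw [h', h]
    rfl
end

theorem contDiffOn_bilin {A B C : Type*} [NormedAddCommGroup A] [NormedSpace ℝ A]
    [FiniteDimensional ℝ A] [NormedAddCommGroup B] [NormedSpace ℝ B] [FiniteDimensional ℝ B]
    [NormedAddCommGroup C] [NormedSpace ℝ C] (f : A →ₗ[ℝ] B →ₗ[ℝ] C) {g : E → A} {h : E → B}
    {s : Set E} (hg : ContDiffOn ℝ ∞ g s) (hh : ContDiffOn ℝ ∞ h s) :
    ContDiffOn ℝ ∞ (fun x => f (g x) (h x)) s :=
  let L : A →L[ℝ] B →L[ℝ] C := f.toContinuousBilinearMap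
  ContDiffOn.clm_apply (L.contDiff.comp_contDiffOn hg) hh

theorem wedge_mem [FiniteDimensional ℝ E] {p q : ℕ} (α : Form E Z p) (β : Form E Z q) :
    (fun z => wedge (E := E) (α.1 z) (β.1 z) : RawForm E Z (p + q)) ∈ Form E Z (p + q) := by
  intro e he
  have h := contDiffOn_bilin (wedgeLin (E := E) p q) (α.2 e he) (β.2 e he)
  exact h.congr fun x _ => wedge_comp (E := E) (α.1 (e.symm x)) (β.1 (e.symm x))
    (mfderiv 𝓘(ℝ, E) 𝓘(ℝ, E) e.symm x)

/-- Right multiplication `α ↦ α ∧ β` by a fixed form `β`. -/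
def wedgeRight [FiniteDimensional ℝ E] {q : ℕ} (β : Form E Z q) (p : ℕ) :
    Form E Z p →+ Form E Z (p + q) :=
  AddMonoidHom.mk' (fun α => ⟨fun z => wedge (E := E) (α.1 z) (β.1 z), wedge_mem α β⟩) fun a b => by
    apply Subtype.ext
    funext z
    exact ((wedgeLin (E := E) p q).map_add₂ (a.1 z) (b.1 z) (β.1 z))

end Forms

section Cochains

variable {Z : Type*} [TopologicalSpace Z] {ι : Type*}

/-- `W_{σ 0 … σ p}`, the intersection of the members of the family `W` indexed by `σ`. -/
def inter (W : ι → Set Z) {p : ℕ} (σ : Fin (p + 1) → ι) : Set Z := ⋂ a, W (σ a)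

/-- A good open cover: an open cover all of whose nonempty finite intersections are contractible. -/
structure IsGoodCover (W : ι → Set Z) : Prop where
  isOpen : ∀ i, IsOpen (W i)
  cover : ⋃ i, W i = Set.univ
  contractible : ∀ (p : ℕ) (σ : Fin (p + 1) → ι), (inter W σ).Nonempty →
    ContractibleSpace (inter W σ)

/-- Čech `p`-cochains `Č^p(W, ℤ)` with values in the constant sheaf `ℤ`: a family of locally constant
integer valued functions `φ_{λ₀ … λ_p}` on the intersections `W_{λ₀ … λ_p}`. -/
abbrev Cech (W : ι → Set Z) (p : ℕ) : Type _ :=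
  (σ : Fin (p + 1) → ι) → LocallyConstant (inter W σ) ℤ

variable {W : ι → Set Z}

/-- The cochain `σ ↦ φ_{σ ∘ τ}`, restricted to `W_σ`. -/
def face {p m : ℕ} (φ : Cech W p) (τ : Fin (p + 1) → Fin (m + 1)) : Cech W m := fun σ =>
  (φ (σ ∘ τ)).comap
    ⟨Set.inclusion (fun _ hz => Set.mem_iInter.2 fun a => Set.mem_iInter.1 hz (τ a)),
      continuous_inclusion _⟩

theorem face_add {p m : ℕ} (φ ψ : Cech W p) (τ : Fin (p + 1) → Fin (m + 1)) :
    face (φ + ψ) τ = face φ τ + face ψ τ := rfl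

variable (W) in
/-- The Čech differential
`(∂φ)_{λ₀ … λ_{p+1}} = ∑ j, (-1)^j φ_{λ₀ … omit λ_j … λ_{p+1}}`. -/
def cechD (p : ℕ) : Cech W p →+ Cech W (p + 1) :=
  AddMonoidHom.mk' (fun φ => ∑ j : Fin (p + 2), (-1 : ℤ) ^ (j : ℕ) • face φ j.succAbove) fun φ ψ => by
    simp only [face_add, smul_add, Finset.sum_add_distrib]

/-- Right cup product `φ ↦ φ ∪ A`, with
`(φ ∪ A)_{λ₀ … λ_{p+q}} = φ_{λ₀ … λ_p} A_{λ_p … λ_{p+q}}`. -/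
def cupRight {q : ℕ} (A : Cech W q) (p : ℕ) : Cech W p →+ Cech W (p + q) :=
  AddMonoidHom.mk' (fun φ =>
    face φ (fun a => ⟨a, by omega⟩) * face A (fun b => ⟨p + b, by omega⟩)) fun φ ψ => by
    rw [face_add, add_mul]

/-- The value `φ_σ(z)`, extended by zero off `W_σ`. -/
def val {p : ℕ} (φ : Cech W p) (σ : Fin (p + 1) → ι) (z : Z) : ℤ :=
  open Classical in if h : z ∈ inter W σ then φ σ ⟨z, h⟩ else 0

/-- The cochain `C(A, B)` with `A ∪ B - B ∪ A = ∂ C(A, B)` for 2-cocycles `A`, `B`: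
`C_{λ₀λ₁λ₂λ₃} = A_{λ₀λ₁λ₂} B_{λ₀λ₂λ₃} - A_{λ₁λ₂λ₃} B_{λ₀λ₁λ₃}`. -/
def commCochain (A B : Cech W 2) : Cech W 3 :=
  face A ![0, 1, 2] * face B ![0, 2, 3] - face A ![1, 2, 3] * face B ![0, 1, 3]

/-- The cochain
`E_{λ₀λ₁λ₂λ₃} = A_{λ₀λ₁λ₂} B_{λ₀λ₂λ₃} + A_{λ₁λ₂λ₀} B_{λ₁λ₂λ₃} + A_{λ₂λ₁λ₃} B_{λ₃λ₁λ₀}`, from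
which the correction term of the middle vertical map is built. -/
def corrCochain (A B : Cech W 2) : Cech W 3 :=
  face A ![0, 1, 2] * face B ![0, 2, 3] + face A ![1, 2, 0] * face B ![1, 2, 3] +
    face A ![2, 1, 3] * face B ![3, 1, 0]

end Cochains

section Complexes

universe u

/-- The graded group `X` shifted by one: in degree `k` it is `X^(k-1)`, which is `0` for `k = 0`. -/
def Shift (X : ℕ → Type u) : ℕ → Type u
  | 0 => PUnit
  | k + 1 => X k

instance (X : ℕ → Type u) [∀ k, AddCommGroup (X k)] : ∀ k, AddCommGroup (Shift X k)
  | 0 => inferInstanceAs (AddCommGroup PUnit)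
  | k + 1 => inferInstanceAs (AddCommGroup (X k))

variable {X : ℕ → Type*} [∀ k, AddCommGroup (X k)] {Y : ℕ → Type*} [∀ k, AddCommGroup (Y k)]

/-- The map `X^(k-1) → Y^k` induced by `f : X^k → Y^(k+1)`. -/
def shiftD (f : ∀ k, X k →+ Y (k + 1)) : ∀ k, Shift X k →+ Shift Y (k + 1)
  | 0 => 0
  | k + 1 => f k

/-- The map `X^(k-1) → Y^(k+1)` induced by `f : X^k → Y^(k+2)`. -/
def shift₁₀ (f : ∀ k, X k →+ Y (k + 2)) : ∀ k, Shift X k →+ Y (k + 1)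
  | 0 => 0
  | k + 1 => f k

/-- The map `X^(k-2) → Y^k` induced by `f : X^k → Y^(k+2)`. -/
def shift₂₁ (f : ∀ k, X k →+ Y (k + 2)) : ∀ k, Shift (Shift X) k →+ Shift Y (k + 1)
  | 0 => 0
  | 1 => 0
  | k + 2 => f k

/-- The map `X^(k-2) → Y^(k+1)` induced by `f : X^k → Y^(k+3)`. -/
def shift₂₀ (f : ∀ k, X k →+ Y (k + 3)) : ∀ k, Shift (Shift X) k →+ Y (k + 1)
  | 0 => 0
  | 1 => 0
  | k + 2 => f k

/-- The relation between `X^(k-1)` and `Y^(k-1)` induced by relations between `X^k` and `Y^k`. -/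
def ShiftRel {X Y : ℕ → Type*} (R : ∀ k, X k → Y k → Prop) : ∀ k, Shift X k → Shift Y k → Prop
  | 0 => fun _ _ => True
  | k + 1 => R k

/-- The differential arriving in degree `k`; it is `0 → X^0` for `k = 0`. -/
def incoming (D : ∀ k, X k →+ X (k + 1)) : ∀ k, Shift X k →+ X k
  | 0 => 0
  | k + 1 => D k

/-- The cohomology in degree `k` of the cochain complex `X` with differential `D`: cocycles modulo
coboundaries. -/
def Cohomology (D : ∀ k, X k →+ X (k + 1)) (k : ℕ) : Type _ :=
  (D k).ker ⧸ (incoming D k).range.addSubgroupOf (D k).ker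

instance (D : ∀ k, X k →+ X (k + 1)) (k : ℕ) : AddCommGroup (Cohomology D k) :=
  inferInstanceAs (AddCommGroup ((D k).ker ⧸ (incoming D k).range.addSubgroupOf (D k).ker))

/-- The cohomology class of a cocycle. -/
def cls (D : ∀ k, X k →+ X (k + 1)) {k : ℕ} (x : X k) (hx : D k x = 0) : Cohomology D k :=
  QuotientAddGroup.mk (⟨x, hx⟩ : (D k).ker)

/-- The homomorphism `g` of cohomology groups is given on representatives by `R`: every cocycle `x`
is related by `R` to a cocycle `y` with `g [x] = [y]`. -/
def GivenBy (D : ∀ k, X k →+ X (k + 1)) (D' : ∀ k, Y k →+ Y (k + 1)) {k m : ℕ}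
    (R : X k → Y m → Prop) (g : Cohomology D k →+ Cohomology D' m) : Prop :=
  ∀ (x : X k) (hx : D k x = 0), ∃ (y : Y m) (hy : D' m y = 0), R x y ∧ g (cls D x hx) = cls D' y hy

/-- The index set of the strictly upper triangular `n × n` matrices, and of the basis
`X_i^* ∧ X_j^*`, `i < j`, of `⋀² 𝔱^*`. -/
abbrev Pairs (n : ℕ) : Type := {ij : Fin n × Fin n // ij.1 < ij.2}

section contractions

variable {n : ℕ} {A B : Type*} [AddCommGroup A] [AddCommGroup B]

/-- `b ↦ ∑ l, b_l · F_l`, where `m l` is multiplication by `F_l`. -/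
def contract₁ (m : Fin n → A →+ B) : (Fin n → A) →+ B :=
  AddMonoidHom.mk' (fun b => ∑ l, m l (b l)) fun b b' => by
    simp [Finset.sum_add_distrib]

/-- `(c · F)_l = ∑ i < j, c_{ij} · (F_i (e_l)_j - (e_l)_i F_j)`, where `m i` is multiplication by
`F_i`. -/
def contract₂ (m : Fin n → A →+ B) : (Pairs n → A) →+ (Fin n → B) :=
  AddMonoidHom.mk' (fun c l => ∑ ij : Pairs n,
    ((if ij.1.2 = l then m ij.1.1 (c ij) else 0) - (if ij.1.1 = l then m ij.1.2 (c ij) else 0)))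
    fun c c' => by
      funext l
      simp only [Pi.add_apply, ← Finset.sum_add_distrib]
      refine Finset.sum_congr rfl fun ij _ => ?_
      split_ifs <;> simp <;> abel

/-- `c ↦ ∑ i < j, c_{ij} · C_{ij}`, where `u ij` is multiplication by `C_{ij}`. -/
def contractPairs (u : Pairs n → A →+ B) : (Pairs n → A) →+ B :=
  AddMonoidHom.mk' (fun c => ∑ ij, u ij (c ij)) fun c c' => by
    simp [Finset.sum_add_distrib]

end contractions

/-- The group of triples `(x^{k0}, x^{(k-1)1}, x^{(k-2)2})`, where `x^{k0} ∈ A^k`,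
`x^{(k-1)1} ∈ (A^(k-1))^n` and `x^{(k-2)2}` is a family in `A^(k-2)` indexed by `i < j`. For `k < 2`
the entries of negative degree are absent. -/
abbrev Tot (A : ℕ → Type u) (n k : ℕ) : Type u :=
  A k × Shift (fun p => Fin n → A p) k × Shift (Shift fun p => Pairs n → A p) k

/-- The group of pairs `(x^{(k-1)1}, x^{(k-2)2})`, the triples without their first entry. -/
abbrev Bar (A : ℕ → Type u) (n k : ℕ) : Type u :=
  Shift (fun p => Fin n → A p) k × Shift (Shift fun p => Pairs n → A p) k

variable {A : ℕ → Type u} [∀ k, AddCommGroup (A k)] {n : ℕ}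

/-- `x^{(k-1)1} · F + x^{(k-2)2} · C` in `A^(k+1)`. -/
def twist (m : ∀ k, Fin n → A k →+ A (k + 2)) (u : ∀ k, Pairs n → A k →+ A (k + 3)) (k : ℕ) :
    Bar A n k →+ A (k + 1) :=
  (shift₁₀ (fun p => contract₁ (m p)) k).coprod (shift₂₀ (fun p => contractPairs (u p)) k)

/-- The differential `(x^{(k-1)1}, x^{(k-2)2}) ↦
(d x^{(k-1)1} + (-1)^k x^{(k-2)2} · F, d x^{(k-2)2})`. -/
def barD (d : ∀ k, A k →+ A (k + 1)) (m : ∀ k, Fin n → A k →+ A (k + 2)) (k : ℕ) :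
    Bar A n k →+ Bar A n (k + 1) :=
  AddMonoidHom.mk' (fun x =>
    (shiftD (fun p => (d p).compLeft (Fin n)) k x.1 +
        (-1 : ℤ) ^ k • shift₂₁ (fun p => contract₂ (m p)) k x.2,
      shiftD (shiftD fun p => (d p).compLeft (Pairs n)) k x.2)) fun x y => by
    simp only [Prod.fst_add, Prod.snd_add, map_add, smul_add, Prod.mk_add_mk]
    congr 1
    abel

/-- The differential `(x^{k0}, x^{(k-1)1}, x^{(k-2)2}) ↦
(d x^{k0} + (-1)^(k+1) (x^{(k-1)1} · F + x^{(k-2)2} · C),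
d x^{(k-1)1} + (-1)^k x^{(k-2)2} · F, d x^{(k-2)2})`. -/
def totD (d : ∀ k, A k →+ A (k + 1)) (m : ∀ k, Fin n → A k →+ A (k + 2))
    (u : ∀ k, Pairs n → A k →+ A (k + 3)) (k : ℕ) : Tot A n k →+ Tot A n (k + 1) :=
  AddMonoidHom.mk' (fun x => (d k x.1 + (-1 : ℤ) ^ (k + 1) • twist m u k x.2, barD d m k x.2))
    fun x y => by
    simp only [Prod.fst_add, Prod.snd_add, map_add, smul_add, Prod.mk_add_mk]
    congr 1
    abel

end Complexes

section Sequences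

variable {Z : Type*} [TopologicalSpace Z] {ι : Type*} {W : ι → Set Z} {n : ℕ}

/-- Multiplication `· ∪ F_l` on Čech cochains. -/
def cupF (F : Fin n → Cech W 2) (k : ℕ) (l : Fin n) : Cech W k →+ Cech W (k + 2) :=
  cupRight (F l) k

/-- Multiplication `· ∪ C(F)_{ij}` on Čech cochains. -/
def cupC (F : Fin n → Cech W 2) (k : ℕ) (ij : Pairs n) : Cech W k →+ Cech W (k + 3) :=
  cupRight (commCochain (F ij.1.1) (F ij.1.2)) k

/-- The differential `D_F` of the complex `C_F^k(W, ℤ)`, with cohomology `ℍ^k_F(W, ℤ)`. -/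
def DF (F : Fin n → Cech W 2) (k : ℕ) : Tot (Cech W) n k →+ Tot (Cech W) n (k + 1) :=
  totD (A := Cech W) (cechD W) (cupF F) (cupC F) k

/-- The differential of the complex obtained from `C_F^k(W, ℤ)` by removing the first entry. With the
indexing used here its cohomology in degree `k` is the group `ℍ̄^(k-1)_F(W, ℤ)`. -/
def DFbar (F : Fin n → Cech W 2) (k : ℕ) : Bar (Cech W) n k →+ Bar (Cech W) n (k + 1) :=
  barD (A := Cech W) (cechD W) (cupF F) k

/-- The map `∪ F`: `(φ^{(k-1)1}, φ^{(k-2)2}) ↦ (-1)^k (φ^{(k-1)1} ∪₁ F + φ^{(k-2)2} ∪₂ C(F))`. -/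
def gysinCup (F : Fin n → Cech W 2) (k : ℕ) : Bar (Cech W) n k →+ Cech W (k + 1) :=
  (-1 : ℤ) ^ k • twist (A := Cech W) (cupF F) (cupC F) k

variable {E : Type*} [NormedAddCommGroup E] [NormedSpace ℝ E] [FiniteDimensional ℝ E]
  [ChartedSpace E Z]

/-- The graded group `Ω^k(Z)`. -/
abbrev Om (E : Type*) [NormedAddCommGroup E] [NormedSpace ℝ E] (Z : Type*) [TopologicalSpace Z]
    [ChartedSpace E Z] (k : ℕ) : Type _ := Form E Z k

instance (k : ℕ) : AddCommGroup (Om E Z k) := inferInstanceAs (AddCommGroup (Form E Z k))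

/-- Multiplication `· ∧ (F₂)_l` on differential forms. -/
def wedgeF (F₂ : Fin n → Om E Z 2) (k : ℕ) (l : Fin n) : Om E Z k →+ Om E Z (k + 2) :=
  wedgeRight (F₂ l) k

/-- The map `∧ F₂`: `(H_{(k-1)1}, H_{(k-2)2}) ↦ (-1)^k H_{(k-1)1} ∧ F₂`. -/
def gysinWedge (F₂ : Fin n → Om E Z 2) (k : ℕ) : Bar (Om E Z) n k →+ Om E Z (k + 1) :=
  (-1 : ℤ) ^ k • twist (A := Om E Z) (wedgeF F₂) 0 k

variable [IsManifold 𝓘(ℝ, E) ∞ Z]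

/-- The differential `D_{F₂}` of the complex `C_{F₂}^{k,(0,2)}(Z, 𝔱^*)`, with cohomology
`H^{k,(0,2)}_{F₂}(Z, 𝔱^*)`. -/
def DF₂ (F₂ : Fin n → Om E Z 2) (k : ℕ) : Tot (Om E Z) n k →+ Tot (Om E Z) n (k + 1) :=
  totD (A := Om E Z) (dForm E Z) (wedgeF F₂) 0 k

/-- The differential `D_{F₂}` of the complex `C_{F₂}^{k,(1,2)}(Z, 𝔱^*)`, with cohomology
`H^{k,(1,2)}_{F₂}(Z, 𝔱^*)`. -/
def DF₂bar (F₂ : Fin n → Om E Z 2) (k : ℕ) : Bar (Om E Z) n k →+ Bar (Om E Z) n (k + 1) :=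
  barD (A := Om E Z) (dForm E Z) (wedgeF F₂) k

variable (W) in
/-- Čech cohomology `Ȟ^k(W, ℤ)`. -/
abbrev HCech (k : ℕ) : Type _ := Cohomology (X := Cech W) (cechD W) k

/-- The group `ℍ^k_F(W, ℤ)`. -/
abbrev HF (F : Fin n → Cech W 2) (k : ℕ) : Type _ :=
  Cohomology (X := Tot (Cech W) n) (DF F) k

/-- The group `ℍ̄^(k-1)_F(W, ℤ)`. -/
abbrev HFbar (F : Fin n → Cech W 2) (k : ℕ) : Type _ :=
  Cohomology (X := Bar (Cech W) n) (DFbar F) k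

/-- De Rham cohomology `H^k_dR(Z)`. -/
abbrev HdR (E : Type*) [NormedAddCommGroup E] [NormedSpace ℝ E] (Z : Type*) [TopologicalSpace Z]
    [ChartedSpace E Z] [IsManifold 𝓘(ℝ, E) ∞ Z] (k : ℕ) : Type _ :=
  Cohomology (X := Om E Z) (dForm E Z) k

/-- The group `H^{k,(0,2)}_{F₂}(Z, 𝔱^*)`. -/
abbrev H02 (F₂ : Fin n → Om E Z 2) (k : ℕ) : Type _ :=
  Cohomology (X := Tot (Om E Z) n) (DF₂ F₂) k

/-- The group `H^{k,(1,2)}_{F₂}(Z, 𝔱^*)`. -/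
abbrev H12 (F₂ : Fin n → Om E Z 2) (k : ℕ) : Type _ :=
  Cohomology (X := Bar (Om E Z) n) (DF₂bar F₂) k

end Sequences

section Collating

variable {E : Type*} [NormedAddCommGroup E] [NormedSpace ℝ E]
  {Z : Type*} [TopologicalSpace Z] [ChartedSpace E Z] {ι : Type*} {W : ι → Set Z} {n : ℕ}

/-- The wedge product `dρ_{ν 0} ∧ ⋯ ∧ dρ_{ν (p - 1)}` at `z`. -/
def dRho (ρ : SmoothPartitionOfUnity ι 𝓘(ℝ, E) Z) {p : ℕ} (ν : Fin p → ι) (z : Z) :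
    TangentSpace 𝓘(ℝ, E) z [⋀^Fin p]→L[ℝ] ℝ :=
  detForm (E := E) fun a => mfderiv 𝓘(ℝ, E) 𝓘(ℝ, ℝ) (ρ (ν a)) z

/-- The Čech–de Rham collating formula for cocycles,
`∑_{λ₁ … λ_p} φ_{λ₀ … λ_p} dρ_{λ₁} ⋯ dρ_{λ_p}` on `W_{λ₀}`. -/
def collateCocycle (ρ : SmoothPartitionOfUnity ι 𝓘(ℝ, E) Z) {p : ℕ} (φ : Cech W p) (i₀ : ι)
    (z : Z) : TangentSpace 𝓘(ℝ, E) z [⋀^Fin p]→L[ℝ] ℝ :=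
  ∑ᶠ ν : Fin p → ι, (val φ (Fin.cons i₀ ν) z : ℝ) • dRho ρ ν z

/-- The collating formula for arbitrary cochains,
`∑_{λ₁ … λ_p} φ_{λ₀ … λ_p} dρ_{λ₁} ⋯ dρ_{λ_p} +
∑_{λ₁ … λ_{p+1}} (∂φ)_{λ₀ … λ_{p+1}} ρ_{λ₁} dρ_{λ₂} ⋯ dρ_{λ_{p+1}}` on `W_{λ₀}`. -/
def collate (ρ : SmoothPartitionOfUnity ι 𝓘(ℝ, E) Z) {p : ℕ} (φ : Cech W p) (i₀ : ι)
    (z : Z) : TangentSpace 𝓘(ℝ, E) z [⋀^Fin p]→L[ℝ] ℝ :=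
  collateCocycle ρ φ i₀ z +
    ∑ᶠ ν : Fin (p + 1) → ι, ((val (cechD W p φ) (Fin.cons i₀ ν) z : ℝ) * ρ (ν 0) z) •
      dRho ρ (Fin.tail ν) z

/-- The correction term: with `k = p + 2`,
`D(φ, F) = (-1)^k ∑_{i < j} ∑_{λ₁ … λ_{k+2}} φ_{λ₁ … λ_{k-1}, ij} E(F_i, F_j)_{λ_{k-1} … λ_{k+2}}
ρ_{λ₁} ρ_{λ_k} dρ_{λ₂} ⋯ dρ_{λ_{k-1}} dρ_{λ_{k+1}} dρ_{λ_{k+2}}`, where `E` is `corrCochain`.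
The tuple `(λ₁, …, λ_{k+2})` is `ν`, so that `λ₁ = ν 0` and `λ_k = ν (p + 1)`. -/
def corr (ρ : SmoothPartitionOfUnity ι 𝓘(ℝ, E) Z) (F : Fin n → Cech W 2) (p : ℕ)
    (φ : Pairs n → Cech W p) (z : Z) : TangentSpace 𝓘(ℝ, E) z [⋀^Fin (p + 2)]→L[ℝ] ℝ :=
  (-1 : ℤ) ^ p • ∑ᶠ ν : Fin (p + 4) → ι,
    ((∑ ij : Pairs n, val (cupRight (corrCochain (F ij.1.1) (F ij.1.2)) p (φ ij)) ν z : ℤ) *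
        ρ (ν 0) z * ρ (ν ⟨p + 1, by omega⟩) z) •
      dRho ρ (fun a : Fin (p + 2) =>
        if (a : ℕ) < p then ν ⟨a + 1, by omega⟩ else ν ⟨a + 2, by omega⟩) z

/-- The correction term for the third entry of a triple of degree `k`; it is `0` for `k < 2`. -/
def corrTot (ρ : SmoothPartitionOfUnity ι 𝓘(ℝ, E) Z) (F : Fin n → Cech W 2) :
    ∀ k, Shift (Shift fun p => Pairs n → Cech W p) k → RawForm E Z k
  | 0 => fun _ => 0
  | 1 => fun _ => 0
  | p + 2 => fun φ => corr ρ F p φ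

/-- `H` is the global form given on every `W_{λ₀}` by the collating formula for cocycles. -/
def IsCollatedCocycle (ρ : SmoothPartitionOfUnity ι 𝓘(ℝ, E) Z) {p : ℕ} (φ : Cech W p)
    (H : Om E Z p) : Prop :=
  ∀ i₀, ∀ z ∈ W i₀, H.1 z = collateCocycle ρ φ i₀ z

/-- `(H_{(k-1)1}, H_{(k-2)2})` is given by the collating formulas from `(φ^{(k-1)1}, φ^{(k-2)2})`. -/
def IsCollatedBar (ρ : SmoothPartitionOfUnity ι 𝓘(ℝ, E) Z) (k : ℕ) (φ : Bar (Cech W) n k)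
    (H : Bar (Om E Z) n k) : Prop :=
  ShiftRel (X := fun p => Fin n → Cech W p) (Y := fun p => Fin n → Om E Z p)
      (fun _ a b => ∀ l i₀, ∀ z ∈ W i₀, (b l).1 z = collate ρ (a l) i₀ z) k φ.1 H.1 ∧
    ShiftRel (ShiftRel (X := fun p => Pairs n → Cech W p) (Y := fun p => Pairs n → Om E Z p)
      fun _ a b => ∀ ij, IsCollatedCocycle ρ (a ij) (b ij)) k φ.2 H.2

/-- `(H_{k0}, H_{(k-1)1}, H_{(k-2)2})` is given by the collating formulas from
`(φ^{k0}, φ^{(k-1)1}, φ^{(k-2)2})`; the formula for `H_{k0}` contains the correction term. -/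
def IsCollatedTot (ρ : SmoothPartitionOfUnity ι 𝓘(ℝ, E) Z) (F : Fin n → Cech W 2) (k : ℕ)
    (φ : Tot (Cech W) n k) (H : Tot (Om E Z) n k) : Prop :=
  (∀ i₀, ∀ z ∈ W i₀, H.1.1 z =
    collate ρ φ.1 i₀ z + (-1 : ℤ) ^ (k + 1) • corrTot ρ F k φ.2.2 z) ∧
    IsCollatedBar ρ k φ.2 H.2

end Collating

end GysinLadder

end

/-!
Both rows are long exact sequences of mapping cones, and the vertical maps form a map of cones.

**Rows.** Let `d` be the differential of a graded group, and `twist` a map `(b, c) ↦ b · F + c · C`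
from the complex of pairs to it. If `d ∘ twist = twist ∘ barD`, then the complex of triples is the
cone of `± twist`, and its long exact sequence (`exact_coneIncl_coneProj`,
`exact_coneProj_connecting`, `exact_connecting_coneIncl`) is the Gysin sequence. That `twist` is a
cochain map comes down to `d (C_{ij}) = F_i F_j - F_j F_i` (`d_twist`): on cochains this is the
coboundary of the commutator cochain (`cechD_twist`), and on forms `C = 0` and 2-forms commute
(`dForm_twist`).

**Collation.** Near a point only finitely many functions `ρ_i` are nonzero, `∑ ρ_i = 1` and
`∑ dρ_i = 0`. Hence in a sum of `(∂φ)_ν ρ_{ν 0} dρ_{ν 1} ⋯ dρ_{ν p}` only the face omitting the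
first vertex survives (`sum_delta_collate`). Consequently the collating formula equals the manifestly
global form `K φ = ∑ φ_ν ρ_{ν 0} dρ_{ν 1} ⋯ dρ_{ν p}` (`collation_eq_collate`), `d K = K ∂`
(`dForm_collation`), and `K (φ ∪ A) = K φ ∧ K A` for a cocycle `A` (`collation_cupRight`). With
`F₂ = K F`, collation is therefore compatible with the differentials and with multiplication by `F`.

**Correction term.** Collation need not send `φ ∪ C(F)` to zero, but
`K (φ ∪ C(F)) = d D(φ) + D(∂φ)` for the correction term `D` (`dForm_correction`). The derivative of
`D(φ)` is a sum over simplices with four free vertices `x, a, b, c`. After wedging with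
`dρ_a dρ_b dρ_c` the cochains `C(F_i, F_j)` and `E^{ij}` agree, because a summand which does not
depend on one of `a, b, c` sums to zero and all others cancel in pairs (`tripleSum_commCoeff`); and
`E^{ij}` contributes nothing when its second vertex is held fixed and the other three are collated
(`tripleSum_corrCoeff`). So `K` commutes with the twisting maps up to the homotopy `D`
(`collation_twist`), which yields the cochain map of cones (`coneMap_totD`) and the commutativity of
the third square (`connecting_comm`). The first two squares commute on representatives.
-/

noncomputable section

namespace GysinLadder

/-! ### Partitions of unity on paracompact manifolds -/

section PartitionOfUnity

open Set Function Topology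

variable {E : Type*} [NormedAddCommGroup E] [NormedSpace ℝ E] [FiniteDimensional ℝ E]
  {Z : Type*} [TopologicalSpace Z] [T2Space Z] [ChartedSpace E Z] [IsManifold 𝓘(ℝ, E) ∞ Z]

variable (E) in
/-- Smooth Urysohn lemma for a closed set and a compact set; no global countability is needed. -/
theorem exists_smooth_zero_one_of_isCompact {s t : Set Z} (hs : IsClosed s) (ht : IsCompact t)
    (hd : Disjoint s t) : ∃ f : C(Z, ℝ), ContMDiff 𝓘(ℝ, E) 𝓘(ℝ) ∞ f ∧ EqOn f 0 s ∧ EqOn f 1 t ∧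
      ∀ x, f x ∈ Icc (0 : ℝ) 1 := by
  have hb : ∀ x ∈ t, ∃ f : SmoothBumpFunction 𝓘(ℝ, E) x, support f ⊆ sᶜ := by
    intro x hx
    have hxs : sᶜ ∈ 𝓝 x := hs.isOpen_compl.mem_nhds (disjoint_right.1 hd hx)
    obtain ⟨f, -, hf⟩ := (SmoothBumpFunction.nhds_basis_support (I := 𝓘(ℝ, E)) hxs).mem_iff.1 hxs
    exact ⟨f, hf⟩
  choose! b hbs using hb
  obtain ⟨u, hut, hu⟩ := ht.elim_nhds_subcover (fun x => {y | b x y = 1})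
    fun x _ => (b x).eventuallyEq_one
  have hsm : ContMDiff 𝓘(ℝ, E) 𝓘(ℝ) ∞ fun y => 1 - ∏ x ∈ u, (1 - b x y) :=
    contMDiff_const.sub (contMDiff_finsetProd fun x _ => contMDiff_const.sub (b x).contMDiff)
  refine ⟨⟨_, hsm.continuous⟩, hsm, fun y hy => ?_, fun y hy => ?_, fun y => ?_⟩
  · have : ∀ x ∈ u, (1 - b x y : ℝ) = 1 := fun x hx => by
      have : y ∉ support (b x) := fun h => hbs x (hut x hx) h hy
      simp [notMem_support.1 this]
    simp [Finset.prod_congr rfl this]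
  · obtain ⟨x, hx, hxy⟩ := mem_iUnion₂.1 (hu hy)
    have hxy : b x y = 1 := hxy
    have : ∏ x ∈ u, (1 - b x y : ℝ) = 0 := Finset.prod_eq_zero hx (by rw [hxy, sub_self])
    simp [this]
  · have h0 : 0 ≤ ∏ x ∈ u, (1 - b x y : ℝ) :=
      Finset.prod_nonneg fun x _ => sub_nonneg.2 (b x).le_one
    have h1 : ∏ x ∈ u, (1 - b x y : ℝ) ≤ 1 :=
      Finset.prod_le_one (fun x _ => sub_nonneg.2 (b x).le_one)
        fun x _ => sub_le_self _ (b x).nonneg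
    simp only [ContinuousMap.coe_mk, mem_Icc]
    constructor <;> linarith

variable [ParacompactSpace Z]

variable (E) in
/-- On a paracompact manifold every cover by relatively compact open sets has a subordinate smooth
partition of unity. -/
theorem exists_isSubordinate_of_isCompact_closure {κ : Type*} (N : κ → Set Z)
    (ho : ∀ i, IsOpen (N i)) (hc : ∀ i, IsCompact (closure (N i))) (hN : ⋃ i, N i = univ) :
    ∃ f : SmoothPartitionOfUnity κ 𝓘(ℝ, E) Z, f.IsSubordinate N := by
  obtain ⟨U, hUo, hU, hUf, hUN⟩ := precise_refinement N ho hN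
  obtain ⟨V, hV, hVo, hVU⟩ := exists_iUnion_eq_closure_subset hUo (fun x => hUf.point_finite x) hU
  have hVU' : ∀ i, V i ⊆ U i := fun i => subset_closure.trans (hVU i)
  obtain ⟨V', hV', hVo', hVV⟩ := exists_iUnion_eq_closure_subset hVo
    (fun x => (hUf.subset hVU').point_finite x) hV
  choose f hfp hf0 hf1 hf01 using fun i =>
    exists_smooth_zero_one_of_isCompact E (isClosed_compl_iff.2 (hVo i))
      ((hc i).of_isClosed_subset isClosed_closure
        (closure_mono (((subset_closure.trans (hVV i)).trans (hVU' i)).trans (hUN i))))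
      (disjoint_right.2 fun x hx => Classical.not_not.2 (hVV i hx))
  have hsupp : ∀ i, support (f i) ⊆ V i := fun i => support_subset_iff'.2 (hf0 i)
  let g : BumpCovering κ Z univ := ⟨f, hUf.subset fun i => (hsupp i).trans (hVU' i),
    fun i x => (hf01 i x).1, fun i x => (hf01 i x).2, fun x _ => by
      obtain ⟨i, hi⟩ := mem_iUnion.1 (hV'.symm ▸ mem_univ x : x ∈ ⋃ i, V' i)
      exact ⟨i, ((hf1 i).mono subset_closure).eventuallyEq_of_mem ((hVo' i).mem_nhds hi)⟩⟩
  have hg : g.IsSubordinate N := fun i => ((closure_mono (hsupp i)).trans (hVU i)).trans (hUN i)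
  exact ⟨g.toSmoothPartitionOfUnity hfp, hg.toSmoothPartitionOfUnity hfp⟩

variable (E) in
/-- Smooth Urysohn lemma on a paracompact manifold. -/
theorem exists_smooth_zero_one_of_isClosed {s t : Set Z} (hs : IsClosed s) (ht : IsClosed t)
    (hd : Disjoint s t) : ∃ f : C(Z, ℝ), ContMDiff 𝓘(ℝ, E) 𝓘(ℝ) ∞ f ∧ EqOn f 0 s ∧ EqOn f 1 t ∧
      ∀ x, f x ∈ Icc (0 : ℝ) 1 := by
  have : LocallyCompactSpace Z := ChartedSpace.locallyCompactSpace E Z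
  -- every point has a relatively compact neighbourhood missing one of the two sets
  have hN : ∀ x : Z, ∃ N : Set Z, IsOpen N ∧ x ∈ N ∧ IsCompact (closure N) ∧
      (Disjoint N s ∨ Disjoint N t) := by
    intro x
    obtain ⟨K, hK, hxK⟩ := exists_compact_mem_nhds x
    have hcl : ∀ M : Set Z, M ⊆ interior K → IsCompact (closure M) := fun M hM =>
      hK.of_isClosed_subset isClosed_closure
        (closure_minimal (hM.trans interior_subset) hK.isClosed)
    by_cases hx : x ∈ s
    · exact ⟨interior K ∩ tᶜ, isOpen_interior.inter ht.isOpen_compl,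
        ⟨mem_interior_iff_mem_nhds.2 hxK, disjoint_left.1 hd hx⟩, hcl _ inter_subset_left,
        Or.inr (disjoint_compl_left.mono_left inter_subset_right)⟩
    · exact ⟨interior K ∩ sᶜ, isOpen_interior.inter hs.isOpen_compl,
        ⟨mem_interior_iff_mem_nhds.2 hxK, hx⟩, hcl _ inter_subset_left,
        Or.inl (disjoint_compl_left.mono_left inter_subset_right)⟩
  choose N hNo hxN hNc hNd using hN
  obtain ⟨g, hg⟩ := exists_isSubordinate_of_isCompact_closure E N hNo hNc
    (eq_univ_of_forall fun x => mem_iUnion.2 ⟨x, hxN x⟩)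
  have hgN : ∀ i x, x ∉ N i → g i x = 0 := fun i x hx =>
    notMem_support.1 fun h => hx (hg i (subset_tsupport _ h))
  classical
  -- the sum of the functions supported off `s`
  have hsm : ContMDiff 𝓘(ℝ, E) 𝓘(ℝ) ∞ fun x => ∑ᶠ i, if Disjoint (N i) s then g i x else 0 := by
    refine contMDiff_finsum (fun i => ?_) (g.locallyFinite.subset fun i x hx => ?_)
    · by_cases h : Disjoint (N i) s
      · simpa [h] using (g i).contMDiff
      · simpa [h] using contMDiff_const
    · by_contra h
      simp [notMem_support.1 h] at hx
  refine ⟨⟨_, hsm.continuous⟩, hsm, fun x hx => ?_, fun x hx => ?_, fun x => ⟨?_, ?_⟩⟩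
  · refine finsum_eq_zero_of_forall_eq_zero fun i => ?_
    split_ifs with h
    · exact hgN i x fun h' => disjoint_left.1 h h' hx
    · rfl
  · refine Eq.trans (finsum_congr fun i => ?_) (g.sum_eq_one (mem_univ x))
    split_ifs with h
    · rfl
    · exact (hgN i x fun h' => disjoint_left.1 ((hNd i).resolve_left h) h' hx).symm
  · exact finsum_nonneg fun i => by split_ifs; exacts [g.nonneg i x, le_rfl]
  · refine le_trans (finsum_le_finsum' ?_ ?_ fun i => ?_) (g.sum_le_one x)
    · refine (g.locallyFinite.point_finite x).subset fun i hi => ?_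
      by_contra h
      have h : g i x = 0 := notMem_support.1 h
      simp [h] at hi
    · exact g.locallyFinite.point_finite x
    · dsimp only
      split_ifs; exacts [le_rfl, g.nonneg i x]

variable (E) in
/-- Smooth partitions of unity exist on paracompact Hausdorff manifolds, `σ`-compact or not. -/
theorem exists_smoothPartitionOfUnity {ι : Type*} (U : ι → Set Z) (ho : ∀ i, IsOpen (U i))
    (hU : ⋃ i, U i = univ) :
    ∃ f : SmoothPartitionOfUnity ι 𝓘(ℝ, E) Z, f.IsSubordinate U := by
  have : LocallyCompactSpace Z := ChartedSpace.locallyCompactSpace E Z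
  obtain ⟨f, hf, hfU⟩ := BumpCovering.exists_isSubordinate_of_prop
    (ContMDiff 𝓘(ℝ, E) 𝓘(ℝ) ∞) (fun s t hs ht hd => exists_smooth_zero_one_of_isClosed E hs ht hd)
    isClosed_univ U ho hU.ge
  exact ⟨f.toSmoothPartitionOfUnity hf, hfU.toSmoothPartitionOfUnity hf⟩

end PartitionOfUnity

/-! ### The long exact sequence of a mapping cone -/

section Cohomology

variable {X Y V : ℕ → Type*} [∀ k, AddCommGroup (X k)] [∀ k, AddCommGroup (Y k)]
  [∀ k, AddCommGroup (V k)]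

theorem cls_surjective (D : ∀ k, X k →+ X (k + 1)) {k : ℕ} (c : Cohomology D k) :
    ∃ (x : X k) (hx : D k x = 0), cls D x hx = c := by
  obtain ⟨⟨x, hx⟩, rfl⟩ := QuotientAddGroup.mk_surjective c
  exact ⟨x, hx, rfl⟩

theorem cls_eq_zero_iff {D : ∀ k, X k →+ X (k + 1)} {k : ℕ} {x : X k} {hx : D k x = 0} :
    cls D x hx = 0 ↔ ∃ y, incoming D k y = x := by
  refine (QuotientAddGroup.eq_zero_iff _).trans ?_
  rw [AddSubgroup.mem_addSubgroupOf]
  rfl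

theorem cls_eq_iff {D : ∀ k, X k →+ X (k + 1)} {k : ℕ} {x x' : X k} {hx : D k x = 0}
    {hx' : D k x' = 0} : cls D x hx = cls D x' hx' ↔ ∃ y, incoming D k y = x - x' := by
  have h : D k (x - x') = 0 := by rw [map_sub, hx, hx', sub_zero]
  rw [← sub_eq_zero, ← cls_eq_zero_iff (hx := h)]
  rfl

/-- The map of cohomology groups induced by a homomorphism, not necessarily of degree `0`, which
preserves cocycles and coboundaries. -/
def cohMap (D : ∀ k, X k →+ X (k + 1)) (D' : ∀ k, Y k →+ Y (k + 1)) {k m : ℕ} (f : X k →+ Y m)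
    (hf : ∀ x, D k x = 0 → D' m (f x) = 0)
    (hf' : ∀ y, ∃ y', incoming D' m y' = f (incoming D k y)) :
    Cohomology D k →+ Cohomology D' m :=
  QuotientAddGroup.map _ _
    ((f.comp (D k).ker.subtype).codRestrict (D' m).ker fun x => hf x.1 x.2) <| by
      rintro ⟨x, hx⟩ hx'
      rw [AddSubgroup.mem_addSubgroupOf] at hx'
      obtain ⟨y, rfl⟩ : ∃ y, incoming D k y = x := hx'
      exact hf' y

theorem givenBy_cohMap {D : ∀ k, X k →+ X (k + 1)} {D' : ∀ k, Y k →+ Y (k + 1)} {k m : ℕ}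
    {f : X k →+ Y m} {hf hf'} {R : X k → Y m → Prop} (hR : ∀ x, D k x = 0 → R x (f x)) :
    GivenBy D D' R (cohMap D D' f hf hf') :=
  fun x hx => ⟨f x, hf x hx, hR x hx, rfl⟩

/-- The map induced by a cochain map. -/
def cohMapOfCochain (D : ∀ k, X k →+ X (k + 1)) (D' : ∀ k, Y k →+ Y (k + 1)) (f : ∀ k, X k →+ Y k)
    (hf : ∀ k x, f (k + 1) (D k x) = D' k (f k x)) (k : ℕ) :
    Cohomology D k →+ Cohomology D' k :=
  cohMap D D' (f k) (fun x hx => by rw [← hf, hx, map_zero]) fun y => by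
    cases k with
    | zero => exact ⟨0, by simp [incoming]⟩
    | succ k => exact ⟨f k y, (hf k y).symm⟩

theorem givenBy_cohMapOfCochain {D : ∀ k, X k →+ X (k + 1)} {D' : ∀ k, Y k →+ Y (k + 1)}
    {f : ∀ k, X k →+ Y k} {hf} {k : ℕ} {R : X k → Y k → Prop}
    (hR : ∀ x, D k x = 0 → R x (f k x)) : GivenBy D D' R (cohMapOfCochain D D' f hf k) :=
  givenBy_cohMap hR

end Cohomology

section Cone

universe u v
variable {A : ℕ → Type u} [∀ k, AddCommGroup (A k)] {n : ℕ}
  (d : ∀ k, A k →+ A (k + 1)) (m : ∀ k, Fin n → A k →+ A (k + 2))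
  (u : ∀ k, Pairs n → A k →+ A (k + 3))

/-- The signed map `(-1)^k • twist` on cohomology, the connecting homomorphism of the cone. -/
def connecting (ht : ∀ k b, d (k + 1) (twist m u k b) = twist m u (k + 1) (barD d m k b)) (k : ℕ) :
    Cohomology (X := Bar A n) (barD d m) k →+ Cohomology d (k + 1) :=
  cohMap (X := Bar A n) (barD d m) d ((-1 : ℤ) ^ k • twist m u k)
    (fun b hb => by simp [ht, hb]) <| by
      cases k with
      | zero =>
        intro y
        refine ⟨0, ?_⟩
        change d 0 0 = (-1 : ℤ) ^ 0 • twist m u 0 0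
        simp
      | succ k =>
        intro (y : Bar A n k)
        refine ⟨(-1 : ℤ) ^ (k + 1) • twist m u k y, ?_⟩
        change d (k + 1) ((-1 : ℤ) ^ (k + 1) • twist m u k y) =
          (-1 : ℤ) ^ (k + 1) • twist m u (k + 1) (barD d m k y)
        rw [map_zsmul, ht]

/-- The map on cohomology induced by the inclusion of the first entry. -/
def coneIncl (k : ℕ) : Cohomology d k →+ Cohomology (X := Tot A n) (totD d m u) k :=
  cohMapOfCochain (Y := Tot A n) d (totD d m u) (fun k => AddMonoidHom.inl (A k) (Bar A n k))
    (fun k x => by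
      change (d k x, (0 : Bar A n (k + 1))) =
        (d k x + (-1 : ℤ) ^ (k + 1) • twist m u k 0, barD d m k 0)
      rw [map_zero, map_zero, smul_zero, add_zero]) k

/-- The map on cohomology induced by forgetting the first entry. -/
def coneProj (k : ℕ) :
    Cohomology (X := Tot A n) (totD d m u) k →+ Cohomology (X := Bar A n) (barD d m) k :=
  cohMapOfCochain (X := Tot A n) (Y := Bar A n) (totD d m u) (barD d m)
    (fun k => AddMonoidHom.snd (A k) (Bar A n k)) (fun _ _ => rfl) k

theorem givenBy_connecting
    (ht : ∀ k b, d (k + 1) (twist m u k b) = twist m u (k + 1) (barD d m k b)) (k : ℕ) :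
    GivenBy (X := Bar A n) (barD d m) d (fun b y => y = ((-1 : ℤ) ^ k • twist m u k) b)
      (connecting d m u ht k) :=
  givenBy_cohMap (X := Bar A n) fun _ _ => rfl

theorem givenBy_coneIncl (k : ℕ) :
    GivenBy (Y := Tot A n) d (totD d m u) (fun x y => y = (x, 0)) (coneIncl d m u k) :=
  givenBy_cohMapOfCochain (Y := Tot A n) fun _ _ => rfl

theorem givenBy_coneProj (k : ℕ) :
    GivenBy (X := Tot A n) (Y := Bar A n) (totD d m u) (barD d m) (fun x y => y = x.2)
      (coneProj d m u k) :=
  givenBy_cohMapOfCochain (X := Tot A n) (Y := Bar A n) fun _ _ => rfl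

theorem totD_apply (k : ℕ) (x : A k) (b : Bar A n k) :
    totD d m u k (x, b) = (d k x + (-1 : ℤ) ^ (k + 1) • twist m u k b, barD d m k b) := rfl

theorem totD_eq_zero {k : ℕ} {x : A k} {b : Bar A n k} :
    totD d m u k (x, b) = 0 ↔ d k x = (-1 : ℤ) ^ k • twist m u k b ∧ barD d m k b = 0 := by
  rw [totD_apply, Prod.mk_eq_zero, pow_succ, mul_neg_one, neg_smul, ← sub_eq_add_neg, sub_eq_zero]

theorem coneIncl_zero_injective : Function.Injective (coneIncl d m u 0) := by
  rw [injective_iff_map_eq_zero]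
  intro c hc
  obtain ⟨x, hx, rfl⟩ := cls_surjective d c
  obtain ⟨y, hy⟩ := cls_eq_zero_iff.1 hc
  have h : (0 : Tot A n 0) = (x, 0) := hy
  obtain rfl : x = 0 := (Prod.ext_iff.1 h).1.symm
  exact cls_eq_zero_iff.2 ⟨0, rfl⟩

theorem exact_coneIncl_coneProj
    (ht : ∀ k b, d (k + 1) (twist m u k b) = twist m u (k + 1) (barD d m k b)) (k : ℕ) :
    Function.Exact (coneIncl d m u k) (coneProj d m u k) := by
  intro c
  constructor
  · intro hc
    obtain ⟨⟨x, b⟩, hx, rfl⟩ := cls_surjective (X := Tot A n) _ c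
    obtain ⟨h1, h2⟩ := (totD_eq_zero d m u).1 hx
    obtain ⟨y, hy⟩ := cls_eq_zero_iff.1 hc
    replace hy : incoming (X := Bar A n) (barD d m) k y = b := hy
    cases k with
    | zero =>
      obtain rfl : 0 = b := hy
      exact ⟨cls d x (by rw [h1, map_zero, smul_zero]), rfl⟩
    | succ k =>
      obtain ⟨y, rfl⟩ : ∃ y : Bar A n k, barD d m k y = b := ⟨y, hy⟩
      have hb : twist m u (k + 1) (barD d m k y) = d (k + 1) (twist m u k y) := (ht k y).symm
      refine ⟨cls d (x - (-1 : ℤ) ^ (k + 1) • twist m u k y) ?_, ?_⟩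
      · rw [map_sub, h1, map_zsmul, hb, sub_self]
      · refine (cls_eq_iff (X := Tot A n)).2 ⟨-((0, y) : Tot A n k), ?_⟩
        change totD d m u k (-((0, y) : Tot A n k)) =
          ((x - (-1 : ℤ) ^ (k + 1) • twist m u k y, 0) : Tot A n (k + 1)) - (x, barD d m k y)
        rw [map_neg, totD_apply, map_zero, Prod.mk_sub_mk, Prod.neg_mk, zero_add, zero_sub,
          sub_sub_cancel_left]
  · rintro ⟨c, rfl⟩
    obtain ⟨x, hx, rfl⟩ := cls_surjective d c
    exact cls_eq_zero_iff.2 ⟨0, map_zero _⟩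

theorem exact_coneProj_connecting
    (ht : ∀ k b, d (k + 1) (twist m u k b) = twist m u (k + 1) (barD d m k b)) (k : ℕ) :
    Function.Exact (coneProj d m u k) (connecting d m u ht k) := by
  intro c
  constructor
  · intro hc
    obtain ⟨b, hb, rfl⟩ := cls_surjective (X := Bar A n) _ c
    obtain ⟨x, hx⟩ := cls_eq_zero_iff.1 hc
    exact ⟨cls (X := Tot A n) (totD d m u) (x, b) ((totD_eq_zero d m u).2 ⟨hx, hb⟩), rfl⟩
  · rintro ⟨c, rfl⟩
    obtain ⟨⟨x, b⟩, hx, rfl⟩ := cls_surjective (X := Tot A n) _ c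
    exact cls_eq_zero_iff.2 ⟨x, ((totD_eq_zero d m u).1 hx).1⟩

theorem exact_connecting_coneIncl
    (ht : ∀ k b, d (k + 1) (twist m u k b) = twist m u (k + 1) (barD d m k b)) (k : ℕ) :
    Function.Exact (connecting d m u ht k) (coneIncl d m u (k + 1)) := by
  intro c
  constructor
  · intro hc
    obtain ⟨x, hx, rfl⟩ := cls_surjective d c
    obtain ⟨⟨y, b⟩, hy⟩ := cls_eq_zero_iff.1 hc
    have hy : (d k y + (-1 : ℤ) ^ (k + 1) • twist m u k b, barD d m k b) =
      ((x, 0) : Tot A n (k + 1)) := hy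
    obtain ⟨h1, h2⟩ := Prod.ext_iff.1 hy
    dsimp only at h1 h2
    refine ⟨cls (X := Bar A n) (barD d m) (-b) (by rw [map_neg, h2, neg_zero]), ?_⟩
    refine cls_eq_iff.2 ⟨-y, ?_⟩
    change d k (-y) = (-1 : ℤ) ^ k • twist m u k (-b) - x
    rw [← h1, map_neg, map_neg, pow_succ, mul_neg_one, neg_smul, smul_neg]
    abel
  · rintro ⟨c, rfl⟩
    obtain ⟨b, hb, rfl⟩ := cls_surjective (X := Bar A n) _ c
    refine cls_eq_zero_iff.2 ⟨((0, -b) : Tot A n k), ?_⟩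
    change totD d m u k (0, -b) = ((-1 : ℤ) ^ k • twist m u k b, (0 : Bar A n (k + 1)))
    rw [totD_apply, map_neg, map_neg, hb, map_zero, pow_succ, mul_neg_one, neg_smul, smul_neg,
      neg_neg, zero_add, neg_zero]

end Cone

section Ladder

universe u v
variable {A : ℕ → Type u} [∀ k, AddCommGroup (A k)] {n : ℕ}
  {d : ∀ k, A k →+ A (k + 1)} {m : ∀ k, Fin n → A k →+ A (k + 2)}
  {u : ∀ k, Pairs n → A k →+ A (k + 3)}
  {A' : ℕ → Type v} [∀ k, AddCommGroup (A' k)]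
  {d' : ∀ k, A' k →+ A' (k + 1)} {m' : ∀ k, Fin n → A' k →+ A' (k + 2)}
  {u' : ∀ k, Pairs n → A' k →+ A' (k + 3)}
  (f : ∀ k, A k →+ A' k) (g : ∀ k, Bar A n k →+ Bar A' n k) (h : ∀ k, Bar A n k →+ A' k)

/-- The map of cones `(x, b) ↦ (f x + (-1)^(k+1) h b, g b)` defined by cochain maps `f`, `g` which
commute with the twisting maps up to the homotopy `h`. -/
def coneMap (k : ℕ) : Tot A n k →+ Tot A' n k :=
  AddMonoidHom.mk' (fun x => (f k x.1 + (-1 : ℤ) ^ (k + 1) • h k x.2, g k x.2)) fun x y => by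
    simp only [Prod.fst_add, Prod.snd_add, map_add, smul_add, Prod.mk_add_mk]
    congr 1
    abel

variable {f g h}

theorem coneMap_totD (hf : ∀ k x, f (k + 1) (d k x) = d' k (f k x))
    (hg : ∀ k b, g (k + 1) (barD d m k b) = barD d' m' k (g k b))
    (hh : ∀ k b, f (k + 1) (twist m u k b) =
      twist m' u' k (g k b) + d' k (h k b) + h (k + 1) (barD d m k b)) (k : ℕ) (x : Tot A n k) :
    coneMap f g h (k + 1) (totD d m u k x) = totD d' m' u' k (coneMap f g h k x) := by
  obtain ⟨x, b⟩ := x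
  change (f (k + 1) (d k x + (-1 : ℤ) ^ (k + 1) • twist m u k b) +
      (-1 : ℤ) ^ (k + 1 + 1) • h (k + 1) (barD d m k b), g (k + 1) (barD d m k b)) =
    (d' k (f k x + (-1 : ℤ) ^ (k + 1) • h k b) + (-1 : ℤ) ^ (k + 1) • twist m' u' k (g k b),
      barD d' m' k (g k b))
  rw [hg]
  congr 1
  rw [map_add, map_add, map_zsmul, map_zsmul, hf, hh, pow_succ _ (k + 1), mul_neg_one, neg_smul]
  simp only [smul_add]
  abel

theorem connecting_comm (ht : ∀ k b, d (k + 1) (twist m u k b) = twist m u (k + 1) (barD d m k b))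
    (ht' : ∀ k b, d' (k + 1) (twist m' u' k b) = twist m' u' (k + 1) (barD d' m' k b))
    (hf : ∀ k x, f (k + 1) (d k x) = d' k (f k x))
    (hg : ∀ k b, g (k + 1) (barD d m k b) = barD d' m' k (g k b))
    (hh : ∀ k b, f (k + 1) (twist m u k b) =
      twist m' u' k (g k b) + d' k (h k b) + h (k + 1) (barD d m k b)) (k : ℕ)
    (c : Cohomology (X := Bar A n) (barD d m) k) :
    connecting d' m' u' ht' k
        (cohMapOfCochain (X := Bar A n) (Y := Bar A' n) (barD d m) (barD d' m') g hg k c) =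
      cohMapOfCochain d d' f hf (k + 1) (connecting d m u ht k c) := by
  obtain ⟨b, hb, rfl⟩ := cls_surjective (X := Bar A n) _ c
  refine cls_eq_iff.2 ⟨-((-1 : ℤ) ^ k • h k b), ?_⟩
  change d' k _ = (-1 : ℤ) ^ k • twist m' u' k (g k b) - f (k + 1) ((-1 : ℤ) ^ k • twist m u k b)
  rw [map_zsmul, hh, hb, map_zero, add_zero, smul_add, sub_add_cancel_left, map_neg, map_zsmul]

end Ladder

/-! ### The twisting map is a cochain map -/

section TwistChain

universe u
variable {A : ℕ → Type u} [∀ k, AddCommGroup (A k)] {n : ℕ}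
  {d : ∀ k, A k →+ A (k + 1)} {m : ∀ k, Fin n → A k →+ A (k + 2)}
  {u : ∀ k, Pairs n → A k →+ A (k + 3)}

theorem contract₁_contract₂ {A B C : Type*} [AddCommGroup A] [AddCommGroup B] [AddCommGroup C]
    (m : Fin n → A →+ B) (m' : Fin n → B →+ C) (c : Pairs n → A) :
    contract₁ m' (contract₂ m c) =
      ∑ ij : Pairs n, (m' ij.1.2 (m ij.1.1 (c ij)) - m' ij.1.1 (m ij.1.2 (c ij))) := by
  change ∑ l, m' l (∑ ij : Pairs n, _) = _
  simp only [map_sum, map_sub]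
  rw [Finset.sum_comm]
  refine Finset.sum_congr rfl fun ij _ => ?_
  rw [Finset.sum_sub_distrib]
  congr 1 <;> simp [apply_ite]

/-- If multiplication by `F` commutes with the differential, and multiplication by `C` bounds the
commutators of these multiplications, then the twisting map `b ↦ b · F + b · C` commutes with the
differentials. -/
theorem d_twist (hm : ∀ k l x, d (k + 2) (m k l x) = m (k + 1) l (d k x))
    (hu : ∀ k ij x, d (k + 3) (u k ij x) = u (k + 1) ij (d k x) +
      (-1 : ℤ) ^ k • (m (k + 2) ij.1.2 (m k ij.1.1 x) - m (k + 2) ij.1.1 (m k ij.1.2 x)))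
    (k : ℕ) (b : Bar A n k) :
    d (k + 1) (twist m u k b) = twist m u (k + 1) (barD d m k b) := by
  have h1 : ∀ k (x : Fin n → A k), d (k + 2) (contract₁ (m k) x) =
      contract₁ (m (k + 1)) ((d k).compLeft (Fin n) x) := by
    intro k x
    change d (k + 2) (∑ l, m k l (x l)) = ∑ l, m (k + 1) l (d k (x l))
    simp only [map_sum, hm]
  match k, b with
  | 0, b =>
    change d 1 (0 + 0) = contract₁ (m 0) (0 + (-1 : ℤ) ^ 0 • 0) + 0
    simp
  | 1, b =>
    suffices ∀ b₁ : Fin n → A 0, d 2 (contract₁ (m 0) b₁ + 0) =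
        contract₁ (m 1) ((d 0).compLeft (Fin n) b₁ + (-1 : ℤ) ^ 1 • 0) + contractPairs (u 0) 0 from
      this b.1
    intro b₁
    rw [add_zero, h1, smul_zero, add_zero, map_zero, add_zero]
  | k + 2, b =>
    suffices ∀ (b₁ : Fin n → A (k + 1)) (b₂ : Pairs n → A k),
        d (k + 3) (contract₁ (m (k + 1)) b₁ + contractPairs (u k) b₂) =
          contract₁ (m (k + 2)) ((d (k + 1)).compLeft (Fin n) b₁ +
            (-1 : ℤ) ^ (k + 2) • contract₂ (m k) b₂) +
          contractPairs (u (k + 1)) ((d k).compLeft (Pairs n) b₂) from this b.1 b.2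
    intro b₁ b₂
    rw [map_add, h1, map_add, map_zsmul, contract₁_contract₂]
    refine Eq.trans ?_ (add_assoc _ _ _).symm
    congr 1
    change d (k + 3) (∑ ij, u k ij (b₂ ij)) = _ + ∑ ij, u (k + 1) ij (d k (b₂ ij))
    simp only [map_sum, hu, Finset.sum_add_distrib, Finset.smul_sum, pow_add]
    refine (add_comm _ _).trans ?_
    simp

end TwistChain

/-! ### Values of Čech cochains -/

section CechValues

variable {Z : Type*} [TopologicalSpace Z] {ι : Type*} {W : ι → Set Z}

omit [TopologicalSpace Z] in
theorem mem_inter {p : ℕ} {σ : Fin (p + 1) → ι} {z : Z} : z ∈ inter W σ ↔ ∀ a, z ∈ W (σ a) :=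
  Set.mem_iInter

theorem val_of_mem {p : ℕ} (φ : Cech W p) {σ : Fin (p + 1) → ι} {z : Z} (h : ∀ a, z ∈ W (σ a)) :
    val φ σ z = φ σ ⟨z, mem_inter.2 h⟩ :=
  dif_pos (mem_inter.2 h)

theorem val_face {p m : ℕ} (φ : Cech W p) (t : Fin (p + 1) → Fin (m + 1)) {σ : Fin (m + 1) → ι}
    {z : Z} (h : ∀ a, z ∈ W (σ a)) : val (face φ t) σ z = val φ (fun a => σ (t a)) z := by
  rw [val_of_mem _ h, val_of_mem φ (fun a => h (t a))]
  rfl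

theorem val_mul {p : ℕ} (φ ψ : Cech W p) {σ : Fin (p + 1) → ι} {z : Z} (h : ∀ a, z ∈ W (σ a)) :
    val (φ * ψ) σ z = val φ σ z * val ψ σ z := by
  rw [val_of_mem _ h, val_of_mem _ h, val_of_mem _ h]
  rfl

theorem val_add {p : ℕ} (φ ψ : Cech W p) (σ : Fin (p + 1) → ι) (z : Z) :
    val (φ + ψ) σ z = val φ σ z + val ψ σ z := by
  unfold val
  split_ifs
  · rfl
  · simp

variable (W) in
/-- Evaluation of cochains at a fixed simplex and a fixed point, as a homomorphism. -/
def valHom {p : ℕ} (σ : Fin (p + 1) → ι) (z : Z) : Cech W p →+ ℤ :=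
  AddMonoidHom.mk' (fun φ => val φ σ z) fun φ ψ => val_add φ ψ σ z

theorem valHom_apply {p : ℕ} (σ : Fin (p + 1) → ι) (z : Z) (φ : Cech W p) :
    valHom W σ z φ = val φ σ z := rfl

theorem cech_ext {p : ℕ} {φ ψ : Cech W p}
    (h : ∀ (σ : Fin (p + 1) → ι) (z : Z), (∀ a, z ∈ W (σ a)) → val φ σ z = val ψ σ z) : φ = ψ := by
  funext σ
  ext ⟨z, hz⟩
  have := h σ z (mem_inter.1 hz)
  rwa [val_of_mem _ (mem_inter.1 hz), val_of_mem _ (mem_inter.1 hz)] at this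

theorem val_cechD {p : ℕ} (φ : Cech W p) {σ : Fin (p + 2) → ι} {z : Z} (h : ∀ a, z ∈ W (σ a)) :
    val (cechD W p φ) σ z =
      ∑ j : Fin (p + 2), (-1) ^ (j : ℕ) * val φ (fun a => σ (j.succAbove a)) z := by
  change valHom W σ z (∑ j : Fin (p + 2), (-1 : ℤ) ^ (j : ℕ) • face φ j.succAbove) = _
  simp only [map_sum, map_zsmul, valHom_apply, val_face φ _ h, smul_eq_mul]

theorem val_cupRight {p q : ℕ} (A : Cech W q) (φ : Cech W p) {σ : Fin (p + q + 1) → ι} {z : Z}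
    (h : ∀ a, z ∈ W (σ a)) : val (cupRight A p φ) σ z =
      val φ (fun a => σ ⟨a, by omega⟩) z * val A (fun b => σ ⟨p + b, by omega⟩) z := by
  change val (face φ _ * face A _) σ z = _
  rw [val_mul _ _ h, val_face _ _ h, val_face _ _ h]

/-- The `j`-th face map, on vertices numbered by natural numbers. -/
def skip (j a : ℕ) : ℕ := if a < j then a else a + 1

theorem coe_succAbove {n : ℕ} (j : Fin (n + 1)) (a : Fin n) :
    ((j.succAbove a : Fin (n + 1)) : ℕ) = skip j a := by
  unfold skip
  by_cases h : (a : ℕ) < j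
  · rw [if_pos h, Fin.succAbove_of_castSucc_lt _ _ (by simpa [Fin.lt_def] using h)]
    rfl
  · rw [if_neg h, Fin.succAbove_of_le_castSucc _ _ (by simpa [Fin.le_def] using h)]
    rfl

theorem cech_ext_seq {p : ℕ} {φ ψ : Cech W p}
    (h : ∀ (s : ℕ → ι) (z : Z), (∀ a, z ∈ W (s a)) →
      val φ (fun a : Fin (p + 1) => s a) z = val ψ (fun a : Fin (p + 1) => s a) z) : φ = ψ := by
  refine cech_ext fun σ z hz => ?_
  have := h (fun a => σ ⟨min a p, by omega⟩) z fun a => hz _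
  have hσ : (fun a : Fin (p + 1) => σ ⟨min (a : ℕ) p, by omega⟩) = σ := by
    funext a
    congr 1
    apply Fin.ext
    simp only
    omega
  rwa [hσ] at this

theorem val_cechD_seq {p : ℕ} (φ : Cech W p) {s : ℕ → ι} {z : Z} (h : ∀ a, z ∈ W (s a)) :
    val (cechD W p φ) (fun a : Fin (p + 2) => s a) z =
      ∑ j ∈ Finset.range (p + 2),
        (-1) ^ j * val φ (fun a : Fin (p + 1) => s (skip j a)) z := by
  rw [val_cechD φ (fun a => h _), Finset.sum_range]
  simp only [coe_succAbove]

theorem val_cupRight_seq {p q : ℕ} (A : Cech W q) (φ : Cech W p) {s : ℕ → ι} {z : Z}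
    (h : ∀ a, z ∈ W (s a)) : val (cupRight A p φ) (fun a : Fin (p + q + 1) => s a) z =
      val φ (fun a : Fin (p + 1) => s a) z * val A (fun b : Fin (q + 1) => s (p + b)) z := by
  rw [val_cupRight A φ (fun a => h _)]

/-- The Leibniz rule for the cup product, at a sequence of vertices. -/
theorem val_cechD_cupRight {p q : ℕ} (A : Cech W q) (φ : Cech W p) {s : ℕ → ι} {z : Z}
    (h : ∀ a, z ∈ W (s a)) :
    val (cechD W (p + q) (cupRight A p φ)) (fun a : Fin (p + q + 2) => s a) z =
      val (cechD W p φ) (fun a : Fin (p + 2) => s a) z *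
          val A (fun b : Fin (q + 1) => s (p + 1 + b)) z +
        (-1) ^ p * (val φ (fun a : Fin (p + 1) => s a) z *
          val (cechD W q A) (fun b : Fin (q + 2) => s (p + b)) z) := by
  rw [val_cechD_seq _ h, val_cechD_seq _ h, val_cechD_seq A fun b => h (p + b),
    show p + q + 2 = (p + 1) + (q + 1) by ring, Finset.sum_range_add,
    Finset.sum_range_succ _ (p + 1), Finset.sum_range_succ' _ (q + 1)]
  have h1 : ∀ j ∈ Finset.range (p + 1),
      (-1 : ℤ) ^ j * val (cupRight A p φ) (fun a : Fin (p + q + 1) => s (skip j a)) z =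
      (-1) ^ j * val φ (fun a : Fin (p + 1) => s (skip j a)) z *
        val A (fun b : Fin (q + 1) => s (p + 1 + b)) z := by
    intro j hj
    rw [val_cupRight_seq A φ fun a => h (skip j a), mul_assoc]
    congr 4
    funext b
    have := Finset.mem_range.1 hj
    rw [skip, if_neg (by omega)]
    congr 1
    omega
  have h2 : ∀ j ∈ Finset.range (q + 1),
      (-1 : ℤ) ^ (p + 1 + j) *
        val (cupRight A p φ) (fun a : Fin (p + q + 1) => s (skip (p + 1 + j) a)) z =
      (-1) ^ p * (val φ (fun a : Fin (p + 1) => s a) z * ((-1) ^ (j + 1) *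
        val A (fun b : Fin (q + 1) => s (p + skip (j + 1) b)) z)) := by
    intro j hj
    rw [val_cupRight_seq A φ fun a => h (skip (p + 1 + j) a)]
    have e1 : (fun a : Fin (p + 1) => s (skip (p + 1 + j) a)) = fun a : Fin (p + 1) => s a := by
      funext a
      rw [skip, if_pos (by omega)]
    have e2 : (fun b : Fin (q + 1) => s (skip (p + 1 + j) (p + b))) =
        fun b : Fin (q + 1) => s (p + skip (j + 1) b) := by
      funext b
      unfold skip
      congr 1
      split_ifs <;> omega
    rw [e1, e2]
    ring
  have e3 : (fun a : Fin (p + 1) => s (skip (p + 1) a)) = fun a : Fin (p + 1) => s a := by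
    funext a
    rw [skip, if_pos (by omega)]
  have e4 : (fun b : Fin (q + 1) => s (p + skip 0 b)) =
      fun b : Fin (q + 1) => s (p + 1 + b) := by
    funext b
    rw [skip, if_neg (by omega)]
    congr 1
    ring
  rw [Finset.sum_congr rfl h1, Finset.sum_congr rfl h2, ← Finset.sum_mul, ← Finset.mul_sum,
    ← Finset.mul_sum, e3, e4]
  ring

/-- The value of a 2-cochain at a triple of vertices. -/
def val₂ (A : Cech W 2) (z : Z) (i j k : ι) : ℤ := val A ![i, j, k] z

theorem val_eq_val₂ (A : Cech W 2) (σ : Fin 3 → ι) (z : Z) :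
    val A σ z = val₂ A z (σ 0) (σ 1) (σ 2) := by
  unfold val₂
  congr 1
  ext a
  fin_cases a <;> rfl

theorem val_commCochain (A B : Cech W 2) {σ : Fin 4 → ι} {z : Z} (h : ∀ a, z ∈ W (σ a)) :
    val (commCochain A B) σ z = val₂ A z (σ 0) (σ 1) (σ 2) * val₂ B z (σ 0) (σ 2) (σ 3) -
      val₂ A z (σ 1) (σ 2) (σ 3) * val₂ B z (σ 0) (σ 1) (σ 3) := by
  change valHom W σ z _ = _
  simp only [commCochain, map_sub, valHom_apply, val_mul _ _ h, val_face _ _ h, val_eq_val₂]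
  rfl

theorem val_corrCochain (A B : Cech W 2) {σ : Fin 4 → ι} {z : Z} (h : ∀ a, z ∈ W (σ a)) :
    val (corrCochain A B) σ z = val₂ A z (σ 0) (σ 1) (σ 2) * val₂ B z (σ 0) (σ 2) (σ 3) +
      val₂ A z (σ 1) (σ 2) (σ 0) * val₂ B z (σ 1) (σ 2) (σ 3) +
      val₂ A z (σ 2) (σ 1) (σ 3) * val₂ B z (σ 3) (σ 1) (σ 0) := by
  change valHom W σ z _ = _
  simp only [corrCochain, map_add, valHom_apply, val_mul _ _ h, val_face _ _ h, val_eq_val₂]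
  rfl

theorem val₂_cocycle {A : Cech W 2} (hA : cechD W 2 A = 0) {z : Z} {i j k l : ι} (hi : z ∈ W i)
    (hj : z ∈ W j) (hk : z ∈ W k) (hl : z ∈ W l) :
    val₂ A z j k l - val₂ A z i k l + val₂ A z i j l - val₂ A z i j k = 0 := by
  have hσ : ∀ a, z ∈ W ((![i, j, k, l] : Fin 4 → ι) a) := by
    intro a
    fin_cases a <;> assumption
  have h := val_cechD A hσ
  rw [hA, val_of_mem _ hσ] at h
  simp only [val_eq_val₂, Fin.sum_univ_succ, Fin.sum_univ_zero] at h
  have h' : (0 : ℤ) = (-1) ^ 0 * val₂ A z j k l + ((-1) ^ 1 * val₂ A z i k l +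
    ((-1) ^ 2 * val₂ A z i j l + ((-1) ^ 3 * val₂ A z i j k + 0))) := h
  linarith

/-- The cochain `C(A, B)` bounds the commutator of the cocycles `A` and `B`. -/
theorem val_cechD_commCochain {A B : Cech W 2} (hA : cechD W 2 A = 0) (hB : cechD W 2 B = 0)
    {s : ℕ → ι} {z : Z} (h : ∀ a, z ∈ W (s a)) :
    val (cechD W 3 (commCochain A B)) (fun a : Fin 5 => s a) z =
      val₂ A z (s 0) (s 1) (s 2) * val₂ B z (s 2) (s 3) (s 4) -
        val₂ B z (s 0) (s 1) (s 2) * val₂ A z (s 2) (s 3) (s 4) := by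
  rw [val_cechD_seq _ h]
  have hC : ∀ j, val (commCochain A B) (fun a : Fin 4 => s (skip j a)) z = _ := fun j =>
    val_commCochain A B fun a : Fin 4 => h (skip j a)
  simp only [hC, Finset.sum_range_succ, Finset.sum_range_zero]
  simp only [skip, Fin.val_zero, Fin.val_one, Fin.val_two, show ((3 : Fin 4) : ℕ) = 3 from rfl]
  norm_num
  linear_combination -val₂ A z (s 0) (s 1) (s 2) * val₂_cocycle hB (h 0) (h 2) (h 3) (h 4) -
    val₂ A z (s 2) (s 3) (s 4) * val₂_cocycle hB (h 0) (h 1) (h 2) (h 4) +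
    val₂ B z (s 0) (s 3) (s 4) * val₂_cocycle hA (h 0) (h 1) (h 2) (h 3) +
    val₂ B z (s 0) (s 1) (s 4) * val₂_cocycle hA (h 1) (h 2) (h 3) (h 4) +
    val₂ A z (s 1) (s 2) (s 3) * val₂_cocycle hB (h 0) (h 1) (h 3) (h 4)

theorem cechD_cupF {n : ℕ} {F : Fin n → Cech W 2} (hF : ∀ l, cechD W 2 (F l) = 0) (k : ℕ)
    (l : Fin n) (φ : Cech W k) :
    cechD W (k + 2) (cupF F k l φ) = cupF F (k + 1) l (cechD W k φ) := by
  refine cech_ext_seq fun s z h => ?_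
  refine (val_cechD_cupRight (F l) φ h).trans ?_
  rw [hF, show val (0 : Cech W 3) (fun b : Fin 4 => s (k + b)) z = 0 from
    map_zero (valHom W _ z)]
  refine Eq.trans ?_ (val_cupRight_seq (F l) (cechD W k φ) h).symm
  simp

theorem cechD_cupC {n : ℕ} {F : Fin n → Cech W 2} (hF : ∀ l, cechD W 2 (F l) = 0) (k : ℕ)
    (ij : Pairs n) (φ : Cech W k) :
    cechD W (k + 3) (cupC F k ij φ) = cupC F (k + 1) ij (cechD W k φ) +
      (-1 : ℤ) ^ k • (cupF F (k + 2) ij.1.2 (cupF F k ij.1.1 φ) -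
        cupF F (k + 2) ij.1.1 (cupF F k ij.1.2 φ)) := by
  refine cech_ext_seq fun s z h => ?_
  refine (val_cechD_cupRight _ φ h).trans ?_
  have hC := val_cechD_commCochain (hF ij.1.1) (hF ij.1.2) fun b => h (k + b)
  have hFF : ∀ i j, val (cupF F (k + 2) j (cupF F k i φ)) (fun a : Fin (k + 5) => s a) z =
      val φ (fun a : Fin (k + 1) => s a) z * val₂ (F i) z (s (k + 0)) (s (k + 1)) (s (k + 2)) *
        val₂ (F j) z (s (k + 2)) (s (k + 3)) (s (k + 4)) := by
    intro i j
    refine (val_cupRight_seq (F j) (cupF F k i φ) h).trans ?_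
    have := val_cupRight_seq (F i) φ h
    refine (congrArg (· * _) this).trans ?_
    rw [val_eq_val₂, val_eq_val₂]
    rfl
  rw [hC]
  change _ = valHom W (fun a : Fin (k + 5) => s a) z _
  rw [map_add, map_zsmul, map_sub]
  simp only [valHom_apply, hFF]
  have := val_cupRight_seq (commCochain (F ij.1.1) (F ij.1.2)) (cechD W k φ) h
  refine Eq.trans ?_ (congrArg (· + _) this.symm)
  simp only [smul_eq_mul]
  ring

/-- The integer twisting map is a cochain map. -/
theorem cechD_twist {n : ℕ} {F : Fin n → Cech W 2} (hF : ∀ l, cechD W 2 (F l) = 0) (k : ℕ)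
    (b : Bar (Cech W) n k) :
    cechD W (k + 1) (twist (A := Cech W) (cupF F) (cupC F) k b) =
      twist (A := Cech W) (cupF F) (cupC F) (k + 1) (barD (A := Cech W) (cechD W) (cupF F) k b) :=
  d_twist (A := Cech W) (cechD_cupF hF) (cechD_cupC hF) k b

end CechValues

/-! ### Alternating maps evaluated on concatenated tuples -/

section Append

variable {V M : Type*} [AddCommGroup V] [Module ℝ V] [AddCommGroup M] [Module ℝ M]

theorem append_update_right {α : Type*} {p q : ℕ} (v : Fin p → α) (w : Fin q → α) (i : Fin q)
    (x : α) : Fin.append v (Function.update w i x) =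
      Function.update (Fin.append v w) (Fin.natAdd p i) x := by
  ext a
  refine Fin.addCases (fun a => ?_) (fun a => ?_) a
  · rw [Fin.append_left, Function.update_of_ne, Fin.append_left]
    simp only [ne_eq, Fin.ext_iff, Fin.val_castAdd, Fin.val_natAdd]
    omega
  · rw [Fin.append_right]
    by_cases h : a = i
    · subst h
      simp
    · rw [Function.update_of_ne h, Function.update_of_ne, Fin.append_right]
      simpa [Fin.ext_iff] using h

theorem append_update_left {α : Type*} {p q : ℕ} (v : Fin p → α) (w : Fin q → α) (i : Fin p)
    (x : α) : Fin.append (Function.update v i x) w =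
      Function.update (Fin.append v w) (Fin.castAdd q i) x := by
  ext a
  refine Fin.addCases (fun a => ?_) (fun a => ?_) a
  · rw [Fin.append_left]
    by_cases h : a = i
    · subst h
      simp
    · rw [Function.update_of_ne h, Function.update_of_ne, Fin.append_left]
      simpa [Fin.ext_iff] using h
  · rw [Fin.append_right, Function.update_of_ne, Fin.append_right]
    simp only [ne_eq, Fin.ext_iff, Fin.val_castAdd, Fin.val_natAdd]
    omega

/-- The alternating map obtained from `f` by fixing its first `p` arguments. -/
def fixLeft {p q : ℕ} (f : V [⋀^Fin (p + q)]→ₗ[ℝ] M) (v : Fin p → V) : V [⋀^Fin q]→ₗ[ℝ] M where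
  toFun w := f (Fin.append v w)
  map_update_add' := by
    intro inst w i x y
    rw [Subsingleton.elim inst (instDecidableEqFin _)]
    simp only [append_update_right, AlternatingMap.map_update_add]
  map_update_smul' := by
    intro inst w i c x
    rw [Subsingleton.elim inst (instDecidableEqFin _)]
    simp only [append_update_right, AlternatingMap.map_update_smul]
  map_eq_zero_of_eq' w i j h hij :=
    f.map_eq_zero_of_eq _ (i := Fin.natAdd p i) (j := Fin.natAdd p j)
      (by simpa using h) (by simpa [Fin.ext_iff] using hij)

/-- The alternating map obtained from `f` by fixing its last `q` arguments. -/
def fixRight {p q : ℕ} (f : V [⋀^Fin (p + q)]→ₗ[ℝ] M) (w : Fin q → V) : V [⋀^Fin p]→ₗ[ℝ] M where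
  toFun v := f (Fin.append v w)
  map_update_add' := by
    intro inst v i x y
    rw [Subsingleton.elim inst (instDecidableEqFin _)]
    simp only [append_update_left, AlternatingMap.map_update_add]
  map_update_smul' := by
    intro inst v i c x
    rw [Subsingleton.elim inst (instDecidableEqFin _)]
    simp only [append_update_left, AlternatingMap.map_update_smul]
  map_eq_zero_of_eq' v i j h hij :=
    f.map_eq_zero_of_eq _ (i := Fin.castAdd q i) (j := Fin.castAdd q j)
      (by simpa using h) (by simpa [Fin.ext_iff] using hij)

theorem fixLeft_apply {p q : ℕ} (f : V [⋀^Fin (p + q)]→ₗ[ℝ] M) (v : Fin p → V) (w : Fin q → V) :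
    fixLeft f v w = f (Fin.append v w) := rfl

theorem fixRight_apply {p q : ℕ} (f : V [⋀^Fin (p + q)]→ₗ[ℝ] M) (v : Fin p → V) (w : Fin q → V) :
    fixRight f w v = f (Fin.append v w) := rfl

/-- Moving the first argument behind the next `p` arguments costs the sign `(-1)^p`. -/
theorem map_cons_append {p q : ℕ} (f : V [⋀^Fin (p + (q + 1))]→ₗ[ℝ] M) (x : V) (v : Fin p → V)
    (w : Fin q → V) :
    f (Fin.cons x (Fin.append v w) : Fin (p + q + 1) → V) =
      (-1 : ℝ) ^ p • f (Fin.append v (Fin.cons x w : Fin (q + 1) → V)) := by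
  have h : (Fin.append v (Fin.cons x w : Fin (q + 1) → V)) =
      Fin.insertNth (α := fun _ => V) (⟨p, by omega⟩ : Fin (p + q + 1)) x (Fin.append v w) := by
    refine Fin.eq_insertNth_iff.2 ⟨?_, ?_⟩
    · have : (⟨p, by omega⟩ : Fin (p + (q + 1))) = Fin.natAdd p 0 := rfl
      exact (congrArg _ this).trans (Fin.append_right v _ 0)
    · funext a
      refine Fin.addCases (fun a => ?_) (fun a => ?_) a
      · rw [Fin.append_left]
        have : (⟨p, by omega⟩ : Fin (p + q + 1)).succAbove (Fin.castAdd q a) =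
          (Fin.castAdd (q + 1) a : Fin (p + (q + 1))) := by
          apply Fin.ext
          rw [coe_succAbove, skip, if_pos (by simp)]
          rfl
        exact (congrArg _ this).trans (Fin.append_left v _ a)
      · rw [Fin.append_right]
        have : (⟨p, by omega⟩ : Fin (p + q + 1)).succAbove (Fin.natAdd p a) =
          (Fin.natAdd p a.succ : Fin (p + (q + 1))) := by
          apply Fin.ext
          rw [coe_succAbove, skip, if_neg (by simp)]
          simp [add_assoc]
        exact (congrArg _ this).trans (Fin.append_right v _ a.succ)
  rw [h]
  have := AlternatingMap.neg_one_pow_smul_map_insertNth (n := p + q) f ⟨p, by omega⟩ x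
    (Fin.append v w)
  refine (this.symm.trans ?_)
  rw [← Int.cast_smul_eq_zsmul ℝ]
  norm_cast

theorem map_cons_append' {p : ℕ} (f : V [⋀^Fin (p + 1 + 2)]→ₗ[ℝ] M) (x : V) (v : Fin p → V)
    (w : Fin 2 → V) :
    f (Fin.cons x (Fin.append v w) : Fin (p + 2 + 1) → V) =
      f (Fin.append (Fin.cons x v : Fin (p + 1) → V) w) := by
  rw [Fin.append_cons]
  rfl

end Append

/-! ### Simplicial cochains on a finite set and alternating maps -/

section Simplex

variable {τ : Type*} [Fintype τ] {V M : Type*} [AddCommGroup V] [Module ℝ V] [AddCommGroup M]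
  [Module ℝ M]

/-- Summation by parts for the simplicial differential. -/
theorem sum_delta_smul {p : ℕ} (c : (Fin p → τ) → ℝ) (Φ : (Fin (p + 1) → τ) → M) :
    ∑ ν, (∑ j : Fin (p + 1), (-1) ^ (j : ℕ) * c fun a => ν (j.succAbove a)) • Φ ν =
      ∑ j : Fin (p + 1), (-1 : ℝ) ^ (j : ℕ) • ∑ ν : Fin p → τ, c ν •
        ∑ t : τ, Φ (j.insertNth (α := fun _ => τ) t ν) := by
  simp only [Finset.sum_smul]
  rw [Finset.sum_comm]
  refine Finset.sum_congr rfl fun j _ => ?_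
  simp only [mul_smul]
  rw [← Finset.smul_sum]
  congr 1
  rw [← (j.insertNthEquiv fun _ => τ).sum_comp, Fintype.sum_prod_type, Finset.sum_comm]
  refine Finset.sum_congr rfl fun ν _ => ?_
  rw [Finset.smul_sum]
  refine Finset.sum_congr rfl fun t _ => ?_
  simp only [Fin.insertNthEquiv, Equiv.coe_fn_mk, Fin.insertNth_apply_succAbove]

variable {θ : τ → V} (hθ : ∑ t, θ t = 0)
include hθ

theorem sum_update_eq_zero {m : ℕ} (f : V [⋀^Fin m]→ₗ[ℝ] M) (v : Fin m → V) (j : Fin m) :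
    ∑ t, f (Function.update v j (θ t)) = 0 := by
  rw [← AlternatingMap.map_update_sum, hθ]
  exact f.map_coord_zero j (by simp)

theorem sum_tail_insertNth_succ {p : ℕ} (f : V [⋀^Fin (p + 1)]→ₗ[ℝ] M) (ν : Fin (p + 1) → τ)
    (i : Fin (p + 1)) :
    ∑ t, f (fun a => θ (i.succ.insertNth (α := fun _ => τ) t ν a.succ)) = 0 := by
  have h : ∀ t, (fun a : Fin (p + 1) => θ (i.succ.insertNth (α := fun _ => τ) t ν a.succ)) =
      Function.update (fun a : Fin (p + 1) =>
        θ (i.succ.insertNth (α := fun _ => τ) (ν 0) ν a.succ)) i (θ t) := by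
    intro t
    funext a
    by_cases ha : a = i
    · subst ha
      simp
    · rw [Function.update_of_ne ha]
      obtain ⟨b, hb⟩ := Fin.exists_succAbove_eq (x := a.succ) (y := i.succ)
        (fun h => ha (Fin.succ_injective _ h))
      rw [← hb, Fin.insertNth_apply_succAbove, Fin.insertNth_apply_succAbove]
  rw [Finset.sum_congr rfl fun t _ => congrArg f (h t)]
  exact sum_update_eq_zero hθ f _ i

variable {r : τ → ℝ} (hr : ∑ t, r t = 1)
include hr

/-- With weights `r` of total mass `1` and vectors `θ` of sum `0`, only the face omitting the first
vertex contributes to the collated differential of a cochain. -/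
theorem sum_delta_collate {p : ℕ} (c : (Fin p → τ) → ℝ) (f : V [⋀^Fin p]→ₗ[ℝ] M) :
    ∑ ν : Fin (p + 1) → τ, ((∑ j : Fin (p + 1), (-1) ^ (j : ℕ) * c fun a => ν (j.succAbove a)) *
        r (ν 0)) • f (fun a => θ (ν a.succ)) =
      ∑ ν : Fin p → τ, c ν • f (fun a => θ (ν a)) := by
  simp only [mul_smul]
  rw [sum_delta_smul, Fin.sum_univ_succ]
  simp only [Fin.val_zero, pow_zero, one_smul, Fin.insertNth_zero', Fin.cons_zero, Fin.cons_succ]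
  rw [Finset.sum_eq_zero (s := Finset.univ (α := Fin p)), add_zero]
  · refine Finset.sum_congr rfl fun ν _ => ?_
    rw [← Finset.sum_smul, hr, one_smul]
  · intro i _
    rw [Finset.sum_eq_zero, smul_zero]
    intro ν _
    cases p with
    | zero => exact i.elim0
    | succ p =>
      have h0 : ∀ t, i.succ.insertNth (α := fun _ => τ) t ν 0 = ν 0 := by
        intro t
        have := Fin.insertNth_apply_succAbove (α := fun _ => τ) i.succ t ν 0
        rwa [Fin.succ_succAbove_zero] at this
      simp only [h0]
      rw [← Finset.smul_sum, sum_tail_insertNth_succ hθ, smul_zero, smul_zero]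

end Simplex

/-! ### Comparison of the commutator and correction coefficients -/

section TripleSum

variable {τ : Type*} [Fintype τ] {V M : Type*} [AddCommGroup V] [Module ℝ V] [AddCommGroup M]
  [Module ℝ M]

/-- The sum `∑ X_{abc} G(θ_a, θ_b, θ_c)`, as a linear function of the coefficients `X`. -/
def tripleSum (θ : τ → V) (G : V [⋀^Fin 3]→ₗ[ℝ] M) : (τ → τ → τ → ℝ) →ₗ[ℝ] M where
  toFun X := ∑ a, ∑ b, ∑ c, X a b c • G ![θ a, θ b, θ c]
  map_add' X Y := by simp only [Pi.add_apply, add_smul, Finset.sum_add_distrib]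
  map_smul' s X := by simp only [Pi.smul_apply, smul_assoc, Finset.smul_sum, RingHom.id_apply]

variable (θ : τ → V) (G : V [⋀^Fin 3]→ₗ[ℝ] M)

theorem tripleSum_apply (X : τ → τ → τ → ℝ) :
    tripleSum θ G X = ∑ a, ∑ b, ∑ c, X a b c • G ![θ a, θ b, θ c] := rfl

theorem map_swap₁₂ (x y z : V) : G ![y, x, z] = -G ![x, y, z] := by
  rw [← G.map_swap ![x, y, z] (i := 0) (j := 1) (by decide)]
  congr 1
  ext a
  fin_cases a <;> rfl

theorem map_swap₂₃ (x y z : V) : G ![x, z, y] = -G ![x, y, z] := by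
  rw [← G.map_swap ![x, y, z] (i := 1) (j := 2) (by decide)]
  congr 1
  ext a
  fin_cases a <;> rfl

theorem tripleSum_swap₁₂ (X : τ → τ → τ → ℝ) :
    tripleSum θ G (fun a b c => X b a c) = -tripleSum θ G X := by
  rw [tripleSum_apply, Finset.sum_comm, tripleSum_apply, ← Finset.sum_neg_distrib]
  refine Finset.sum_congr rfl fun a _ => ?_
  rw [← Finset.sum_neg_distrib]
  refine Finset.sum_congr rfl fun b _ => ?_
  rw [← Finset.sum_neg_distrib]
  refine Finset.sum_congr rfl fun c _ => ?_
  rw [map_swap₁₂, smul_neg]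

theorem tripleSum_swap₂₃ (X : τ → τ → τ → ℝ) :
    tripleSum θ G (fun a b c => X a c b) = -tripleSum θ G X := by
  rw [tripleSum_apply, tripleSum_apply, ← Finset.sum_neg_distrib]
  refine Finset.sum_congr rfl fun a _ => ?_
  rw [Finset.sum_comm, ← Finset.sum_neg_distrib]
  refine Finset.sum_congr rfl fun b _ => ?_
  rw [← Finset.sum_neg_distrib]
  refine Finset.sum_congr rfl fun c _ => ?_
  rw [map_swap₂₃, smul_neg]

theorem tripleSum_cycle (X : τ → τ → τ → ℝ) :
    tripleSum θ G (fun a b c => X b c a) = tripleSum θ G X := by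
  rw [tripleSum_swap₁₂ θ G fun a b c => X a c b, tripleSum_swap₂₃, neg_neg]

theorem tripleSum_swap₁₃ (X : τ → τ → τ → ℝ) :
    tripleSum θ G (fun a b c => X c b a) = -tripleSum θ G X := by
  rw [tripleSum_swap₁₂ θ G fun a b c => X c a b, ← tripleSum_cycle θ G X,
    ← tripleSum_cycle θ G fun a b c => X b c a]

variable {θ} (hθ : ∑ t, θ t = 0)
include hθ

theorem tripleSum_const₃ (u : τ → τ → ℝ) : tripleSum θ G (fun a b _ => u a b) = 0 := by
  refine Finset.sum_eq_zero fun a _ => Finset.sum_eq_zero fun b _ => ?_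
  rw [← Finset.smul_sum]
  have := sum_update_eq_zero hθ G ![θ a, θ b, 0] 2
  have h : ∀ t, Function.update ![θ a, θ b, 0] 2 (θ t) = ![θ a, θ b, θ t] := by
    intro t
    ext i
    fin_cases i <;> rfl
  simp only [h] at this
  rw [this, smul_zero]

theorem tripleSum_const₂ (u : τ → τ → ℝ) : tripleSum θ G (fun a _ c => u a c) = 0 := by
  rw [tripleSum_swap₂₃ θ G fun a b _ => u a b, tripleSum_const₃ G hθ, neg_zero]

theorem tripleSum_const₁ (u : τ → τ → ℝ) : tripleSum θ G (fun _ b c => u b c) = 0 := by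
  rw [tripleSum_cycle θ G fun a b _ => u a b, tripleSum_const₃ G hθ]

/-- The coefficients of the correction cochain `E(A, B)`. -/
def corrCoeff (A B : τ → τ → τ → ℝ) (x a b c : τ) : ℝ :=
  A x a b * B x b c + A a b x * B a b c + A b a c * B c a x

/-- The coefficients of the commutator cochain `C(A, B)`. -/
def commCoeff (A B : τ → τ → τ → ℝ) (x a b c : τ) : ℝ :=
  A x a b * B x b c - A a b c * B x a c

variable {A B : τ → τ → τ → ℝ} (hA : ∀ x i j k, A i j k = A x j k - A x i k + A x i j)
  (hB : ∀ x i j k, B i j k = B x j k - B x i k + B x i j)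
include hA hB

/-- After alternation, `C(A, B)` and `E(A, B)` agree in their last three vertices. Writing the
cocycles as coboundaries of the cones over `x`, all terms of the difference either miss a vertex or
cancel in pairs. -/
theorem tripleSum_commCoeff (x : τ) :
    tripleSum θ G (commCoeff A B x) = tripleSum θ G (corrCoeff A B x) := by
  rw [← sub_eq_zero, ← map_sub]
  set g := A x with hg
  set h := B x with hh
  have key : commCoeff A B x - corrCoeff A B x =
      (fun _ b c => -(g b x * h b c + g b c * h c x)) +
      (fun a _ c => g a c * h a c - g a x * h a c - g a c * h a x + g a c * h c x -
        g a c * h c a) +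
      (fun a b _ => -(g b x * h a b) + g a x * h a b - g a b * h a b - g b a * h a x) +
      ((fun a b c => (fun a b c => -(g b a * h c a)) c b a) +
        fun a b c => -(g b a * h c a)) +
      ((fun a b c => (fun a b c => g a x * h b c) b a c) + fun a b c => g a x * h b c) +
      ((fun a b c => (fun a b c => g a b * h b c) b c a) - fun a b c => g a b * h b c) +
      ((fun a b c => (fun a b c => g b c * h a x) c b a) + fun a b c => g b c * h a x) := by
    funext a b c
    simp only [Pi.sub_apply, Pi.add_apply, commCoeff, corrCoeff]
    rw [hA x a b c, hA x a b x, hA x b a c, hB x a b c, hB x c a x]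
    simp only [← hg, ← hh]
    ring
  rw [key]
  simp only [map_add, map_sub]
  rw [tripleSum_const₁ G hθ, tripleSum_const₂ G hθ, tripleSum_const₃ G hθ,
    tripleSum_swap₁₃ θ G fun a b c => -(g b a * h c a),
    tripleSum_swap₁₂ θ G fun a b c => g a x * h b c,
    tripleSum_cycle θ G fun a b c => g a b * h b c,
    tripleSum_swap₁₃ θ G fun a b c => g b c * h a x]
  simp

/-- With its second vertex `a` fixed, `E(A, B)` vanishes after alternation in the other three. -/
theorem tripleSum_corrCoeff (a : τ) :
    tripleSum θ G (fun y b c => corrCoeff A B y a b c) = 0 := by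
  set g := A a with hg
  set h := B a with hh
  have ha : ∀ b, g a b = g a a := fun b => by
    have := hA a a a b
    rw [hg]
    linarith
  have hb : ∀ b, h a b = h a a := fun b => by
    have := hB a a a b
    rw [hh]
    linarith
  have key : (fun y b c => corrCoeff A B y a b c) =
      (fun _ b c => g a a * h b c + g a a * h a a + g a a * h c a - h a a * g b c -
        g b c * h c a + h a a * g b a + g b a * h c a) +
      (fun y _ c => -(g a a * h y c) - g y a * h y c - g a a * h c y) +
      (fun y b _ => g a a * h y b - g y b * h y b + g y a * h y b) +
      ((fun y b c => (fun y b c => g y b * h b c) b c y) - fun y b c => g y b * h b c) +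
      ((fun y b c => (fun y b c => g y b * h y c) b y c) + fun y b c => g y b * h y c) +
      ((fun y b c => g y a * h b c) - fun y b c => (fun y b c => g y a * h b c) b c y) := by
    funext y b c
    simp only [Pi.sub_apply, Pi.add_apply, corrCoeff]
    rw [hA a y a b, hA a b a c, hB a y b c, hB a c a y]
    simp only [← hg, ← hh, ha b, ha c, hb y]
    ring
  rw [key]
  simp only [map_add, map_sub]
  rw [tripleSum_const₁ G hθ, tripleSum_const₂ G hθ, tripleSum_const₃ G hθ,
    tripleSum_cycle θ G fun y b c => g y b * h b c,
    tripleSum_swap₁₂ θ G fun y b c => g y b * h y c,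
    tripleSum_cycle θ G fun y b c => g y a * h b c]
  simp

end TripleSum

/-! ### The homotopy identity on simplices -/

section CorrectionHomotopy

variable {τ : Type*} [Fintype τ] {V M : Type*} [AddCommGroup V] [Module ℝ V] [AddCommGroup M]
  [Module ℝ M]

/-- The form `∑ E_{xabc} r_{ν 0} r_a θ_{ν 1} ⋯ θ_{ν p} θ_b θ_c`, with `x = ν p`, paired with `f`. -/
def corrTerm (A B : τ → τ → τ → ℝ) (θ : τ → V) (r : τ → ℝ) {p : ℕ}
    (f : V [⋀^Fin (p + 2)]→ₗ[ℝ] M) (ν : Fin (p + 1) → τ) : M :=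
  ∑ a, ∑ b, ∑ c, (corrCoeff A B (ν (Fin.last p)) a b c * r (ν 0) * r a) •
    f (Fin.append (fun i : Fin p => θ (ν i.succ)) ![θ b, θ c])

variable {A B : τ → τ → τ → ℝ} {θ : τ → V} {r : τ → ℝ}

/-- The derivative of the correction term splits according to which of the two undifferentiated
functions is differentiated; the two parts are compared with the commutator cochain and with the
correction term of the differential. -/
theorem corr_derivative_split (hA : ∀ x i j k, A i j k = A x j k - A x i k + A x i j)
    (hB : ∀ x i j k, B i j k = B x j k - B x i k + B x i j) (hθ : ∑ t, θ t = 0) {p : ℕ}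
    (f : V [⋀^Fin (p + 3)]→ₗ[ℝ] M) (ν : Fin (p + 1) → τ) :
    ∑ a, ∑ b, ∑ c, corrCoeff A B (ν (Fin.last p)) a b c •
      f (Fin.cons (r (ν 0) • θ a + r a • θ (ν 0))
        (Fin.append (m := p) (n := 2) (fun i => θ (ν i.succ)) ![θ b, θ c]) : Fin (p + 2 + 1) → V) =
    (-1 : ℝ) ^ p • ∑ a, ∑ b, ∑ c, (commCoeff A B (ν (Fin.last p)) a b c * r (ν 0)) •
        f (Fin.append (m := p) (n := 3) (fun i => θ (ν i.succ)) ![θ a, θ b, θ c]) +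
      ∑ a, ∑ b, ∑ c, (corrCoeff A B (ν (Fin.last p)) a b c * r a) •
        f (Fin.append (m := p + 1) (n := 2) (fun i => θ (ν i)) ![θ b, θ c]) := by
  have h1 : ∀ a b c, f (Fin.cons (r (ν 0) • θ a + r a • θ (ν 0))
        (Fin.append (m := p) (n := 2) (fun i => θ (ν i.succ)) ![θ b, θ c]) : Fin (p + 2 + 1) → V) =
      (-1 : ℝ) ^ p • r (ν 0) •
        f (Fin.append (m := p) (n := 3) (fun i => θ (ν i.succ)) ![θ a, θ b, θ c]) +
      r a • f (Fin.append (m := p + 1) (n := 2) (fun i => θ (ν i)) ![θ b, θ c]) := by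
    intro a b c
    refine (f.toMultilinearMap.cons_add _ _ _).trans ?_
    refine congrArg₂ (· + ·) ?_ ?_
    · refine (f.toMultilinearMap.cons_smul _ _ _).trans ?_
      rw [smul_comm]
      exact congrArg (r (ν 0) • ·) (map_cons_append (q := 2) f (θ a) _ ![θ b, θ c])
    · refine (f.toMultilinearMap.cons_smul _ _ _).trans ?_
      refine congrArg (r a • ·) ((map_cons_append' (p := p) f (θ (ν 0)) _ ![θ b, θ c]).trans ?_)
      congr 2
      funext i
      refine Fin.cases rfl (fun i => rfl) i
  have h2 := tripleSum_commCoeff (fixLeft (q := 3) f fun i : Fin p => θ (ν i.succ)) hθ hA hB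
    (ν (Fin.last p))
  simp only [tripleSum_apply, fixLeft_apply] at h2
  have h3 : ∀ X : τ → τ → τ → ℝ, ∑ a, ∑ b, ∑ c, (X a b c * r (ν 0)) •
        f (Fin.append (m := p) (n := 3) (fun i => θ (ν i.succ)) ![θ a, θ b, θ c]) =
      r (ν 0) • ∑ a, ∑ b, ∑ c, X a b c •
        f (Fin.append (m := p) (n := 3) (fun i => θ (ν i.succ)) ![θ a, θ b, θ c]) := by
    intro X
    simp only [mul_comm _ (r (ν 0)), mul_smul, ← Finset.smul_sum]
  rw [h3, h2, ← h3]
  simp only [h1, smul_add, Finset.sum_add_distrib, Finset.smul_sum, smul_smul]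
  congr 1
  refine Finset.sum_congr rfl fun a _ => Finset.sum_congr rfl fun b _ =>
    Finset.sum_congr rfl fun c _ => ?_
  congr 1
  ring

variable (hA : ∀ x i j k, A i j k = A x j k - A x i k + A x i j)
  (hB : ∀ x i j k, B i j k = B x j k - B x i k + B x i j) (hθ : ∑ t, θ t = 0)
include hA hB hθ

/-- Only the face omitting the first vertex contributes to the correction term of a coboundary. -/
theorem sum_corrTerm_insertNth_succ {p : ℕ} (f : V [⋀^Fin (p + 1 + 2)]→ₗ[ℝ] M)
    (ν : Fin (p + 1) → τ) (i : Fin (p + 1)) :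
    ∑ t, corrTerm A B θ r f (i.succ.insertNth (α := fun _ => τ) t ν) = 0 := by
  have h0 : ∀ t, i.succ.insertNth (α := fun _ => τ) t ν 0 = ν 0 := by
    intro t
    have := Fin.insertNth_apply_succAbove (α := fun _ => τ) i.succ t ν 0
    rwa [Fin.succ_succAbove_zero] at this
  simp only [corrTerm, h0]
  refine Fin.lastCases ?_ (fun i => ?_) i
  · -- the omitted vertex is the last one: `E` is summed over three of its vertices
    have h : ∀ t b c, f (Fin.append (fun i : Fin (p + 1) =>
        θ ((Fin.last p).succ.insertNth (α := fun _ => τ) t ν i.succ)) ![θ b, θ c]) =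
        f (Fin.append (m := p) (n := 3) (fun i => θ (ν i.succ)) ![θ t, θ b, θ c]) := by
      intro t b c
      rw [Fin.succ_last]
      simp only [Fin.insertNth_last']
      congr 1
      have : (fun i : Fin (p + 1) => θ ((Fin.snoc ν t : Fin (p + 1 + 1) → τ) i.succ)) =
          Fin.snoc (fun i : Fin p => θ (ν i.succ)) (θ t) := by
        funext i
        refine Fin.lastCases ?_ (fun i => ?_) i
        · rw [Fin.succ_last, Fin.snoc_last, Fin.snoc_last]
        · rw [Fin.succ_castSucc, Fin.snoc_castSucc, Fin.snoc_castSucc]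
      rw [this, show ![θ t, θ b, θ c] = (Fin.cons (θ t) ![θ b, θ c] : Fin 3 → V) from rfl,
        Fin.append_right_cons]
      rfl
    have hl : ∀ t, (Fin.last p).succ.insertNth (α := fun _ => τ) t ν (Fin.last (p + 1)) = t :=
      fun t => by rw [Fin.succ_last, Fin.insertNth_apply_same]
    simp only [h, hl]
    rw [Finset.sum_comm]
    refine Finset.sum_eq_zero fun a _ => ?_
    have h2 := tripleSum_corrCoeff (fixLeft (q := 3) f fun i : Fin p => θ (ν i.succ)) hθ hA hB a
    simp only [tripleSum_apply, fixLeft_apply] at h2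
    have h3 : ∀ t b c, (corrCoeff A B t a b c * r (ν 0) * r a) •
        f (Fin.append (m := p) (n := 3) (fun i => θ (ν i.succ)) ![θ t, θ b, θ c]) =
        (r (ν 0) * r a) • corrCoeff A B t a b c •
          f (Fin.append (m := p) (n := 3) (fun i => θ (ν i.succ)) ![θ t, θ b, θ c]) := by
      intro t b c
      rw [smul_smul]
      congr 1
      ring
    simp only [h3, ← Finset.smul_sum]
    rw [h2, smul_zero]
  · have hl : ∀ t, i.castSucc.succ.insertNth (α := fun _ => τ) t ν (Fin.last (p + 1)) =
        ν (Fin.last p) := by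
      intro t
      have := Fin.insertNth_apply_succAbove (α := fun _ => τ) i.castSucc.succ t ν (Fin.last p)
      rwa [show i.castSucc.succ.succAbove (Fin.last p) = Fin.last (p + 1) from Fin.ext (by
        rw [coe_succAbove, skip, if_neg (by simp)]
        simp)] at this
    simp only [hl]
    rw [Finset.sum_comm]
    refine Finset.sum_eq_zero fun a _ => ?_
    rw [Finset.sum_comm]
    refine Finset.sum_eq_zero fun b _ => ?_
    rw [Finset.sum_comm]
    refine Finset.sum_eq_zero fun c _ => ?_
    rw [← Finset.smul_sum]
    have := sum_tail_insertNth_succ hθ (fixRight (q := 2) f ![θ b, θ c]) ν i.castSucc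
    simp only [fixRight_apply] at this
    rw [this, smul_zero]

variable (hr : ∑ t, r t = 1)
include hr

/-- The homotopy identity `d D(φ) + D(∂φ) = K(φ ∪ C(A, B))` on a simplex, paired with `f`. -/
theorem corr_homotopy {p : ℕ} (φ : (Fin (p + 1) → τ) → ℝ) (f : V [⋀^Fin (p + 3)]→ₗ[ℝ] M) :
    (-1 : ℝ) ^ p • ∑ ν : Fin (p + 1) → τ, φ ν • ∑ a, ∑ b, ∑ c,
        corrCoeff A B (ν (Fin.last p)) a b c •
          f (Fin.cons (r (ν 0) • θ a + r a • θ (ν 0))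
            (Fin.append (m := p) (n := 2) (fun i => θ (ν i.succ)) ![θ b, θ c]) : Fin (p + 2 + 1) → V) +
      (-1 : ℝ) ^ (p + 1) • ∑ ν : Fin (p + 2) → τ,
        (∑ j : Fin (p + 2), (-1) ^ (j : ℕ) * φ fun a => ν (j.succAbove a)) •
          corrTerm A B θ r (p := p + 1) f ν =
    ∑ ν : Fin (p + 1) → τ, φ ν • ∑ a, ∑ b, ∑ c,
      (commCoeff A B (ν (Fin.last p)) a b c * r (ν 0)) •
        f (Fin.append (m := p) (n := 3) (fun i => θ (ν i.succ)) ![θ a, θ b, θ c]) := by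
  rw [sum_delta_smul, Fin.sum_univ_succ]
  rw [Finset.sum_eq_zero (s := Finset.univ (α := Fin (p + 1))) fun i _ => by
    rw [Finset.sum_eq_zero fun ν _ => by
      rw [sum_corrTerm_insertNth_succ hA hB hθ (p := p) f ν i, smul_zero], smul_zero]]
  simp only [corr_derivative_split hA hB hθ f, Fin.val_zero, pow_zero, one_smul, add_zero,
    Fin.insertNth_zero', smul_add, Finset.sum_add_distrib, smul_comm _ ((-1 : ℝ) ^ p)]
  rw [← Finset.smul_sum, smul_smul, ← mul_pow, neg_one_mul, neg_neg, one_pow, one_smul,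
    add_assoc]
  refine add_eq_left.2 ?_
  rw [pow_succ, mul_neg_one, neg_smul, add_neg_eq_zero]
  congr 1
  refine Finset.sum_congr rfl fun ν _ => ?_
  congr 1
  have h : ∀ t, corrTerm A B θ r (p := p + 1) f (Fin.cons t ν : Fin (p + 2) → τ) =
      r t • ∑ a, ∑ b, ∑ c, (corrCoeff A B (ν (Fin.last p)) a b c * r a) •
        f (Fin.append (m := p + 1) (n := 2) (fun i => θ (ν i)) ![θ b, θ c]) := by
    intro t
    have hl : (Fin.cons t ν : Fin (p + 2) → τ) (Fin.last (p + 1)) = ν (Fin.last p) := by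
      rw [← Fin.succ_last, Fin.cons_succ]
    simp only [corrTerm, hl, Fin.cons_zero, Fin.cons_succ, Finset.smul_sum, smul_smul]
    refine Finset.sum_congr rfl fun a _ => Finset.sum_congr rfl fun b _ =>
      Finset.sum_congr rfl fun c _ => ?_
    congr 1
    ring
  simp only [h]
  rw [← Finset.sum_smul, hr, one_smul]

end CorrectionHomotopy

/-! ### Decomposable alternating forms -/

section Decomposable

open ContinuousAlternatingMap

variable {E : Type*} [NormedAddCommGroup E] [NormedSpace ℝ E]

variable (E) in
/-- The form `θ 0 ∧ ⋯ ∧ θ (p - 1)`, as an alternating function of the covectors. -/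
def detAlt (p : ℕ) : (E →L[ℝ] ℝ) [⋀^Fin p]→ₗ[ℝ] (E [⋀^Fin p]→L[ℝ] ℝ) :=
  have h : ∀ (θ : Fin p → E →L[ℝ] ℝ) (v : Fin p → E), detForm θ v =
      (Matrix.detRowAlternating (n := Fin p) (R := ℝ)) fun a b => θ a (v b) := fun θ v =>
    (Matrix.det_transpose _).symm
  have hu : ∀ (θ : Fin p → E →L[ℝ] ℝ) (v : Fin p → E) (i : Fin p) (x : E →L[ℝ] ℝ),
      (fun a b => Function.update θ i x a (v b)) =
        Function.update (fun a b => θ a (v b)) i fun b => x (v b) := by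
    intro θ v i x
    funext a
    by_cases ha : a = i
    · subst ha; simp
    · simp [ha]
  { toFun := detForm
    map_update_add' := by
      intro inst θ i x y
      rw [Subsingleton.elim inst (instDecidableEqFin _)]
      ext v
      rw [ContinuousAlternatingMap.add_apply, h, h, h, hu, hu, hu,
        ← AlternatingMap.map_update_add]
      rfl
    map_update_smul' := by
      intro inst θ i c x
      rw [Subsingleton.elim inst (instDecidableEqFin _)]
      ext v
      rw [ContinuousAlternatingMap.smul_apply, h, h, hu, hu, ← AlternatingMap.map_update_smul]
      rfl
    map_eq_zero_of_eq' := by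
      intro θ i j hij hne
      ext v
      rw [h]
      exact AlternatingMap.map_eq_zero_of_eq _ _ (by simp [hij]) hne }

/-- The multilinear form `v ↦ ∏ a, θ a (v a)`. -/
def prodForm {p : ℕ} (θ : Fin p → E →L[ℝ] ℝ) : MultilinearMap ℝ (fun _ : Fin p => E) ℝ :=
  (MultilinearMap.mkPiAlgebra ℝ (Fin p) ℝ).compLinearMap fun a => (θ a).toLinearMap

theorem prodForm_apply {p : ℕ} (θ : Fin p → E →L[ℝ] ℝ) (v : Fin p → E) :
    prodForm θ v = ∏ a, θ a (v a) := by
  simp [prodForm]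

theorem alternatization_prodForm {p : ℕ} (θ : Fin p → E →L[ℝ] ℝ) :
    MultilinearMap.alternatization (prodForm θ) = (detForm θ).toAlternatingMap := by
  ext v
  refine Eq.trans ?_ (detForm_apply θ v).symm
  rw [MultilinearMap.alternatization_apply, Matrix.det_apply]
  simp [prodForm_apply]

/-- Laplace expansion along the first covector. -/
theorem alternatizeUncurryFin_smulRight {p : ℕ} (θ₀ : E →L[ℝ] ℝ) (θ : Fin p → E →L[ℝ] ℝ) :
    alternatizeUncurryFin (θ₀.smulRight (detForm θ)) =
      detForm (Fin.cons θ₀ θ : Fin (p + 1) → E →L[ℝ] ℝ) := by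
  ext v
  rw [alternatizeUncurryFin_apply, detForm_apply, Matrix.det_succ_column_zero]
  refine Finset.sum_congr rfl fun i _ => ?_
  rw [ContinuousLinearMap.smulRight_apply, ContinuousAlternatingMap.smul_apply, detForm_apply,
    zsmul_eq_mul, smul_eq_mul, mul_assoc]
  push_cast
  rfl

variable [FiniteDimensional ℝ E]

theorem wedge_detForm {p q : ℕ} (θ : Fin p → E →L[ℝ] ℝ) (μ : Fin q → E →L[ℝ] ℝ) :
    wedge (detForm θ) (detForm μ) = detForm (Fin.append θ μ) := by
  ext v
  rw [wedge_apply, AlternatingMap.domCoprod'_apply, ← alternatization_prodForm,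
    ← alternatization_prodForm, ← MultilinearMap.domCoprod_alternization,
    MultilinearMap.alternatization_apply, _root_.map_sum, detForm_apply,
    ← Matrix.det_submatrix_equiv_self finSumFinEquiv, Matrix.det_apply]
  refine Finset.sum_congr rfl fun σ _ => ?_
  rw [Fintype.prod_sum_type]
  simp only [Units.smul_def, map_zsmul]
  congr 1
  simp only [MultilinearMap.domDomCongr_apply, MultilinearMap.domCoprod_apply,
    LinearMap.mul'_apply, prodForm_apply, Matrix.submatrix_apply, Matrix.of_apply,
    finSumFinEquiv_apply_left, finSumFinEquiv_apply_right, Fin.append_left, Fin.append_right]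

/-- The decomposable forms span the space of alternating forms: `p! • f` is the alternatization of `f`,
and the alternatization of a product of covectors is decomposable. -/
theorem span_range_detForm (p : ℕ) :
    Submodule.span ℝ (Set.range (detForm (E := E) (p := p))) = ⊤ := by
  refine Submodule.eq_top_iff'.2 fun f => ?_
  let b := Module.finBasis ℝ E
  let e : Fin (Module.finrank ℝ E) → E →L[ℝ] ℝ := fun i => (b.coord i).toContinuousLinearMap
  have hf : f.toMultilinearMap = ∑ s : Fin p → Fin (Module.finrank ℝ E),
      f (fun a => b (s a)) • prodForm fun a => e (s a) := by
    ext v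
    rw [_root_.sum_apply]
    conv_lhs => rw [show v = fun a => ∑ i, b.repr (v a) i • b i from
      funext fun a => (b.sum_repr (v a)).symm]
    have := f.toMultilinearMap.map_sum fun (a : Fin p) i => b.repr (v a) i • b i
    refine this.trans (Finset.sum_congr rfl fun s _ => ?_)
    refine (f.toMultilinearMap.map_smul_univ (fun a => b.repr (v a) (s a))
      fun a => b (s a)).trans ?_
    rw [_root_.smul_apply, prodForm_apply, smul_eq_mul, smul_eq_mul, mul_comm]
    rfl
  have h2 : ((p.factorial : ℕ) : ℝ) • f = ∑ s : Fin p → Fin (Module.finrank ℝ E),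
      f (fun a => b (s a)) • detForm fun a => e (s a) := by
    have h3 := AlternatingMap.coe_alternatization f.toAlternatingMap
    have h4 : (f.toAlternatingMap : MultilinearMap ℝ (fun _ : Fin p => E) ℝ) =
      f.toMultilinearMap := rfl
    rw [h4, hf, _root_.map_sum] at h3
    ext v
    let ev : (E [⋀^Fin p]→ₗ[ℝ] ℝ) →+ ℝ := AddMonoidHom.mk' (fun g => g v) fun _ _ => rfl
    have h5 := congrArg ev h3
    rw [_root_.map_sum, map_nsmul, Fintype.card_fin] at h5
    rw [ContinuousAlternatingMap.sum_apply, ContinuousAlternatingMap.smul_apply,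
      Nat.cast_smul_eq_nsmul]
    refine h5.symm.trans (Finset.sum_congr rfl fun s _ => ?_)
    rw [ContinuousAlternatingMap.smul_apply]
    have := congrArg (fun g : E [⋀^Fin p]→ₗ[ℝ] ℝ => g v)
      (alternatization_prodForm fun a => e (s a))
    refine Eq.trans ?_ (congrArg (f (fun a => b (s a)) • ·) this)
    change MultilinearMap.alternatization _ v = _
    simp only [MultilinearMap.alternatization_apply, Finset.smul_sum]
    exact Finset.sum_congr rfl fun σ _ => smul_comm (Equiv.Perm.sign σ) (f fun a => b (s a)) _
  have hp : ((p.factorial : ℕ) : ℝ) ≠ 0 := by positivity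
  rw [← inv_smul_smul₀ hp f, h2]
  exact Submodule.smul_mem _ _ (Submodule.sum_mem _ fun s _ =>
    Submodule.smul_mem _ _ (Submodule.subset_span ⟨_, rfl⟩))

theorem detForm_induction {p : ℕ} {P : E [⋀^Fin p]→L[ℝ] ℝ → Prop}
    (hdet : ∀ θ, P (detForm θ)) (hadd : ∀ a b, P a → P b → P (a + b))
    (hsmul : ∀ (c : ℝ) a, P a → P (c • a)) (a : E [⋀^Fin p]→L[ℝ] ℝ) : P a := by
  have ha : a ∈ Submodule.span ℝ (Set.range (detForm (E := E) (p := p))) :=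
    span_range_detForm (E := E) p ▸ Submodule.mem_top
  induction ha using Submodule.span_induction with
  | mem x hx => obtain ⟨θ, rfl⟩ := hx; exact hdet θ
  | zero => simpa using hsmul 0 0 (by simpa using hsmul 0 _ (hdet fun _ => 0))
  | add x y _ _ hx hy => exact hadd x y hx hy
  | smul c x _ hx => exact hsmul c x hx

theorem clm_detForm_induction {p : ℕ} {P : (E →L[ℝ] E [⋀^Fin p]→L[ℝ] ℝ) → Prop}
    (hdet : ∀ (θ₀ : E →L[ℝ] ℝ) θ, P (θ₀.smulRight (detForm θ)))
    (hadd : ∀ a b, P a → P b → P (a + b)) (hsmul : ∀ (c : ℝ) a, P a → P (c • a))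
    (M : E →L[ℝ] E [⋀^Fin p]→L[ℝ] ℝ) : P M := by
  let b := Module.finBasis ℝ E
  let e : Fin (Module.finrank ℝ E) → E →L[ℝ] ℝ := fun i => (b.coord i).toContinuousLinearMap
  have hM : M = ∑ i, (e i).smulRight (M (b i)) := by
    ext1 v
    rw [_root_.sum_apply]
    conv_lhs => rw [← b.sum_repr v, _root_.map_sum]
    exact Finset.sum_congr rfl fun i _ => map_smul M _ _
  have h1 : ∀ (θ₀ : E →L[ℝ] ℝ) a, P (θ₀.smulRight a) := fun θ₀ a => by
    refine detForm_induction (P := fun a => P (θ₀.smulRight a)) (hdet θ₀)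
      (fun a b ha hb => ?_) (fun c a ha => ?_) a
    · convert hadd _ _ ha hb using 1
      ext v : 1
      simp
    · convert hsmul c _ ha using 1
      ext v : 1
      simp [smul_comm c]
  have h0 : P 0 := by
    convert hsmul 0 _ (hdet 0 0) using 1
    ext v : 1
    simp
  rw [hM]
  exact Finset.sum_induction _ P hadd h0 fun i _ => h1 _ _

theorem wedge_add_left {p q : ℕ} (a a' : E [⋀^Fin p]→L[ℝ] ℝ) (b : E [⋀^Fin q]→L[ℝ] ℝ) :
    wedge (a + a') b = wedge a b + wedge a' b := (wedgeLin p q).map_add₂ a a' b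

theorem wedge_smul_left {p q : ℕ} (c : ℝ) (a : E [⋀^Fin p]→L[ℝ] ℝ) (b : E [⋀^Fin q]→L[ℝ] ℝ) :
    wedge (c • a) b = c • wedge a b := (wedgeLin p q).map_smul₂ c a b

theorem wedge_add_right {p q : ℕ} (a : E [⋀^Fin p]→L[ℝ] ℝ) (b b' : E [⋀^Fin q]→L[ℝ] ℝ) :
    wedge a (b + b') = wedge a b + wedge a b' := (wedgeLin p q a).map_add b b'

theorem wedge_smul_right {p q : ℕ} (c : ℝ) (a : E [⋀^Fin p]→L[ℝ] ℝ) (b : E [⋀^Fin q]→L[ℝ] ℝ) :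
    wedge a (c • b) = c • wedge a b := (wedgeLin p q a).map_smul c b

/-- Right multiplications by 2-forms commute. -/
theorem wedge_wedge_comm {p : ℕ} (a : E [⋀^Fin p]→L[ℝ] ℝ) (b c : E [⋀^Fin 2]→L[ℝ] ℝ) :
    wedge (wedge a b) c = wedge (wedge a c) b := by
  refine detForm_induction (P := fun a => wedge (wedge a b) c = wedge (wedge a c) b)
    (fun θ => ?_) (fun x y hx hy => ?_) (fun s x hx => ?_) a
  · refine detForm_induction
      (P := fun b => wedge (wedge (detForm θ) b) c = wedge (wedge (detForm θ) c) b)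
      (fun μ => ?_) (fun x y hx hy => ?_) (fun s x hx => ?_) b
    · refine detForm_induction
        (P := fun c => wedge (wedge (detForm θ) (detForm μ)) c =
          wedge (wedge (detForm θ) c) (detForm μ))
        (fun ν => ?_) (fun x y hx hy => ?_) (fun s x hx => ?_) c
      · simp only [wedge_detForm]
        have h : ∀ μ ν : Fin 2 → E →L[ℝ] ℝ, detForm (Fin.append (Fin.append θ μ) ν) =
            fixLeft (q := 4) (detAlt E (p + 4)) θ (Fin.append μ ν) := by
          intro μ ν
          rw [Fin.append_assoc]
          rfl
        rw [h, h]
        have h2 : Fin.append μ ν =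
            (Fin.append ν μ ∘ Equiv.swap (0 : Fin 4) 2) ∘ Equiv.swap (1 : Fin 4) 3 := by
          ext1 i
          fin_cases i <;> rfl
        rw [h2, AlternatingMap.map_swap _ _ (by decide), AlternatingMap.map_swap _ _ (by decide),
          neg_neg]
      · rw [wedge_add_right, hx, hy, wedge_add_right, wedge_add_left]
      · rw [wedge_smul_right, hx, wedge_smul_right, wedge_smul_left]
    · rw [wedge_add_right, wedge_add_left, hx, hy, wedge_add_right]
    · rw [wedge_smul_right, wedge_smul_left, hx, wedge_smul_right]
  · rw [wedge_add_left, wedge_add_left, hx, hy, wedge_add_left, wedge_add_left]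
  · rw [wedge_smul_left, wedge_smul_left, hx, wedge_smul_left, wedge_smul_left]

/-- The wedge product as a continuous bilinear map. -/
def wedgeCLM (E : Type*) [NormedAddCommGroup E] [NormedSpace ℝ E] [FiniteDimensional ℝ E]
    (p q : ℕ) : (E [⋀^Fin p]→L[ℝ] ℝ) →L[ℝ] (E [⋀^Fin q]→L[ℝ] ℝ) →L[ℝ] E [⋀^Fin (p + q)]→L[ℝ] ℝ :=
  (wedgeLin (E := E) p q).toContinuousBilinearMap

theorem wedgeCLM_apply {p q : ℕ} (a : E [⋀^Fin p]→L[ℝ] ℝ) (b : E [⋀^Fin q]→L[ℝ] ℝ) :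
    wedgeCLM E p q a b = wedge a b := rfl

/-- The pointwise form of `dα ∧ β`: for the derivative `M` of `α`, alternating the derivative of the
first factor of `α ∧ β`. -/
theorem alternatize_wedge_left {p : ℕ} (M : E →L[ℝ] E [⋀^Fin p]→L[ℝ] ℝ)
    (c : E [⋀^Fin 2]→L[ℝ] ℝ) :
    alternatizeUncurryFin (((wedgeCLM E p 2).flip c).comp M) = wedge (alternatizeUncurryFin M) c := by
  refine clm_detForm_induction (P := fun M => alternatizeUncurryFin
    (((wedgeCLM E p 2).flip c).comp M) = wedge (alternatizeUncurryFin M) c)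
    (fun θ₀ θ => ?_) (fun x y hx hy => ?_) (fun s x hx => ?_) M
  · refine detForm_induction (P := fun c => alternatizeUncurryFin
      (((wedgeCLM E p 2).flip c).comp (θ₀.smulRight (detForm θ))) =
        wedge (alternatizeUncurryFin (θ₀.smulRight (detForm θ))) c)
      (fun μ => ?_) (fun x y hx hy => ?_) (fun s x hx => ?_) c
    · have : ((wedgeCLM E p 2).flip (detForm μ)).comp (θ₀.smulRight (detForm θ)) =
          θ₀.smulRight (detForm (Fin.append θ μ)) := by
        ext1 v
        simp [wedgeCLM_apply, wedge_detForm]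
      rw [this, alternatizeUncurryFin_smulRight, alternatizeUncurryFin_smulRight, wedge_detForm]
      exact map_cons_append' (detAlt E (p + 1 + 2)) θ₀ θ μ
    · rw [wedge_add_right, ← hx, ← hy, map_add, ContinuousLinearMap.add_comp,
        alternatizeUncurryFin_add]
    · rw [wedge_smul_right, ← hx, map_smul, ContinuousLinearMap.smul_comp,
        alternatizeUncurryFin_smul]
  · rw [ContinuousLinearMap.comp_add, alternatizeUncurryFin_add, hx, hy, alternatizeUncurryFin_add,
      wedge_add_left]
  · rw [ContinuousLinearMap.comp_smul, alternatizeUncurryFin_smul, hx, alternatizeUncurryFin_smul,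
      wedge_smul_left]

/-- The pointwise form of `(-1)^p α ∧ dβ`, for the derivative `M` of `β`. -/
theorem alternatize_wedge_right {p : ℕ} (a : E [⋀^Fin p]→L[ℝ] ℝ)
    (M : E →L[ℝ] E [⋀^Fin 2]→L[ℝ] ℝ) :
    alternatizeUncurryFin ((wedgeCLM E p 2 a).comp M) =
      (-1 : ℝ) ^ p • wedge a (alternatizeUncurryFin M) := by
  refine clm_detForm_induction (P := fun M => alternatizeUncurryFin
    ((wedgeCLM E p 2 a).comp M) = (-1 : ℝ) ^ p • wedge a (alternatizeUncurryFin M))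
    (fun θ₀ μ => ?_) (fun x y hx hy => ?_) (fun s x hx => ?_) M
  · refine detForm_induction (P := fun a => alternatizeUncurryFin
      ((wedgeCLM E p 2 a).comp (θ₀.smulRight (detForm μ))) =
        (-1 : ℝ) ^ p • wedge a (alternatizeUncurryFin (θ₀.smulRight (detForm μ))))
      (fun θ => ?_) (fun x y hx hy => ?_) (fun s x hx => ?_) a
    · have : (wedgeCLM E p 2 (detForm θ)).comp (θ₀.smulRight (detForm μ)) =
          θ₀.smulRight (detForm (Fin.append θ μ)) := by
        ext1 v
        simp [wedgeCLM_apply, wedge_detForm]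
      rw [this, alternatizeUncurryFin_smulRight, alternatizeUncurryFin_smulRight, wedge_detForm]
      exact map_cons_append (detAlt E (p + 3)) θ₀ θ μ
    · rw [wedge_add_left, smul_add, ← hx, ← hy, map_add, ContinuousLinearMap.add_comp,
        alternatizeUncurryFin_add]
    · rw [wedge_smul_left, smul_comm, ← hx, map_smul, ContinuousLinearMap.smul_comp,
        alternatizeUncurryFin_smul]
  · rw [ContinuousLinearMap.comp_add, alternatizeUncurryFin_add, hx, hy, alternatizeUncurryFin_add,
      wedge_add_right, smul_add]
  · rw [ContinuousLinearMap.comp_smul, alternatizeUncurryFin_smul, hx, alternatizeUncurryFin_smul,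
      wedge_smul_right, smul_comm]

end Decomposable

/-! ### Calculus of differential forms on a manifold -/

section FormCalculus

open ContinuousAlternatingMap Topology

variable {E : Type*} [NormedAddCommGroup E] [NormedSpace ℝ E]
  {Z : Type*} [TopologicalSpace Z] [ChartedSpace E Z]

/-- The value of a form at a point, with the tangent space identified with the model space `E`. -/
abbrev RawForm.fiber {k : ℕ} (η : RawForm E Z k) (z : Z) : E [⋀^Fin k]→L[ℝ] ℝ := η z

theorem chartRep_eventuallyEq {k : ℕ} {η η' : RawForm E Z k} {e : OpenPartialHomeomorph Z E}
    {x : E} (hx : x ∈ e.target) (h : ∀ᶠ y in 𝓝 (e.symm x), η y = η' y) :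
    chartRep e η =ᶠ[𝓝 x] chartRep e η' := by
  filter_upwards [(e.continuousAt_symm hx).eventually h] with y hy
  simp only [chartRep, hy]

theorem mem_Form_of_eventually {k : ℕ} {η : RawForm E Z k}
    (h : ∀ z, ∃ η' ∈ Form E Z k, ∀ᶠ y in 𝓝 z, η y = η' y) : η ∈ Form E Z k := by
  intro e he x hx
  obtain ⟨η', hη', hev⟩ := h (e.symm x)
  exact (((hη' e he).contDiffAt (e.open_target.mem_nhds hx)).congr_of_eventuallyEq
    (chartRep_eventuallyEq hx hev)).contDiffWithinAt

theorem rawExtDeriv_congr {k : ℕ} {η η' : RawForm E Z k} {z : Z}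
    (h : ∀ᶠ y in 𝓝 z, η y = η' y) : rawExtDeriv η z = rawExtDeriv η' z := by
  have hx : chartAt E z z ∈ (chartAt E z).target := mem_chart_target E z
  rw [← (chartAt E z).left_inv (mem_chart_source E z)] at h
  unfold rawExtDeriv
  rw [(chartRep_eventuallyEq hx h).extDeriv_eq]

theorem differentiableAt_chartRep {k : ℕ} {η : RawForm E Z k} (hη : η ∈ Form E Z k) (z : Z) :
    DifferentiableAt ℝ (chartRep (chartAt E z) η) (chartAt E z z) :=
  ((hη _ (chart_mem_atlas E z)).contDiffAt ((chartAt E z).open_target.mem_nhds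
    (mem_chart_target E z))).differentiableAt (by simp)

variable [IsManifold 𝓘(ℝ, E) ∞ Z]

theorem mfderiv_chart_symm_comp (z : Z) :
    (mfderiv 𝓘(ℝ, E) 𝓘(ℝ, E) (chartAt E z).symm (chartAt E z z)).comp
      (mfderiv 𝓘(ℝ, E) 𝓘(ℝ, E) (chartAt E z) z) = ContinuousLinearMap.id ℝ E := by
  have h := mfderiv_comp (I := 𝓘(ℝ, E)) (I' := 𝓘(ℝ, E)) (I'' := 𝓘(ℝ, E)) z
    (mdiff_chart_symm (chart_mem_atlas E z) (mem_chart_target E z))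
    (mdiff_chart (chart_mem_atlas E z) (mem_chart_source E z))
  refine h.symm.trans ?_
  have hev : (chartAt E z).symm ∘ chartAt E z =ᶠ[𝓝 z] id := by
    filter_upwards [(chartAt E z).open_source.mem_nhds (mem_chart_source E z)] with y hy
    exact (chartAt E z).left_inv hy
  rw [hev.mfderiv_eq, mfderiv_id]
  rfl

/-- A form is recovered at `z` from its representation in the preferred chart at `z`. -/
theorem chartRep_comp_mfderiv {k : ℕ} (η : RawForm E Z k) (z : Z) :
    (chartRep (chartAt E z) η (chartAt E z z)).compContinuousLinearMap
      (mfderiv 𝓘(ℝ, E) 𝓘(ℝ, E) (chartAt E z) z) = η z := by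
  have h0 : ∀ z', z' = z → (η z' : E [⋀^Fin k]→L[ℝ] ℝ) = η z := by
    rintro _ rfl; rfl
  have h1 := h0 _ ((chartAt E z).left_inv (mem_chart_source E z))
  have h2 := mfderiv_chart_symm_comp (E := E) z
  ext v
  change (η ((chartAt E z).symm (chartAt E z z)) : E [⋀^Fin k]→L[ℝ] ℝ) (fun a =>
    ((mfderiv 𝓘(ℝ, E) 𝓘(ℝ, E) (chartAt E z).symm (chartAt E z z)).comp
      (mfderiv 𝓘(ℝ, E) 𝓘(ℝ, E) (chartAt E z) z)) (v a)) = _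
  rw [h1, h2]
  rfl

theorem dForm_dForm {k : ℕ} (η : Form E Z k) : dForm E Z (k + 1) (dForm E Z k η) = 0 := by
  apply Subtype.ext
  funext z
  change (extDeriv (chartRep (chartAt E z) (rawExtDeriv η.1)) (chartAt E z z)).compContinuousLinearMap
    _ = 0
  have hev : chartRep (chartAt E z) (rawExtDeriv η.1) =ᶠ[𝓝 (chartAt E z z)]
      extDeriv (chartRep (chartAt E z) η.1) := by
    filter_upwards [(chartAt E z).open_target.mem_nhds (mem_chart_target E z)] with x hx
    exact chartRep_rawExtDeriv η.2 (chart_mem_atlas E z) hx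
  rw [hev.extDeriv_eq, extDeriv_extDeriv_apply (r := ∞)
    ((η.2 _ (chart_mem_atlas E z)).contDiffAt ((chartAt E z).open_target.mem_nhds
      (mem_chart_target E z)))
    (by rw [minSmoothness_of_isRCLikeNormedField]; exact WithTop.coe_le_coe.2 (le_top : (2 : ℕ∞) ≤ ⊤))]
  rfl

/-- The differential of a smooth function, as a covector at `z`. -/
def covec (g : C^∞⟮𝓘(ℝ, E), Z; 𝓘(ℝ), ℝ⟯) (z : Z) : E →L[ℝ] ℝ :=
  mfderiv 𝓘(ℝ, E) 𝓘(ℝ, ℝ) g z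

omit [IsManifold 𝓘(ℝ, E) ∞ Z] in
theorem mdifferentiableAt_smooth (g : C^∞⟮𝓘(ℝ, E), Z; 𝓘(ℝ), ℝ⟯) (z : Z) :
    MDifferentiableAt 𝓘(ℝ, E) 𝓘(ℝ, ℝ) g z :=
  (g.contMDiff z).mdifferentiableAt (by simp)

theorem contDiffAt_comp_chart_symm (g : C^∞⟮𝓘(ℝ, E), Z; 𝓘(ℝ), ℝ⟯)
    {e : OpenPartialHomeomorph Z E} (he : e ∈ atlas E Z) {x : E} (hx : x ∈ e.target) :
    ContDiffAt ℝ ∞ (g ∘ e.symm) x := by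
  rw [← contMDiffAt_iff_contDiffAt]
  exact (g.contMDiff _).comp x (contMDiffAt_symm_of_mem_maximalAtlas (I := 𝓘(ℝ, E)) (n := ∞)
      (IsManifold.subset_maximalAtlas he) hx)

theorem fderiv_comp_chart_symm (g : C^∞⟮𝓘(ℝ, E), Z; 𝓘(ℝ), ℝ⟯)
    {e : OpenPartialHomeomorph Z E} (he : e ∈ atlas E Z) {x : E} (hx : x ∈ e.target) :
    fderiv ℝ (g ∘ e.symm) x =
      (covec g (e.symm x)).comp (mfderiv 𝓘(ℝ, E) 𝓘(ℝ, E) e.symm x) := by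
  rw [← mfderiv_eq_fderiv]
  exact mfderiv_comp (I := 𝓘(ℝ, E)) (I' := 𝓘(ℝ, E)) (I'' := 𝓘(ℝ, ℝ)) x
    (mdifferentiableAt_smooth g _) (mdiff_chart_symm he hx)

/-- The pointwise product of a smooth function and a form. -/
def rawSmul {k : ℕ} (g : C^∞⟮𝓘(ℝ, E), Z; 𝓘(ℝ), ℝ⟯) (η : RawForm E Z k) : RawForm E Z k :=
  fun z => g z • η z

theorem rawSmul_mem {k : ℕ} (g : C^∞⟮𝓘(ℝ, E), Z; 𝓘(ℝ), ℝ⟯) {η : RawForm E Z k}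
    (hη : η ∈ Form E Z k) : rawSmul g η ∈ Form E Z k := fun e he =>
  ContDiffOn.smul (f := g ∘ e.symm) (g := chartRep e η)
    (fun _ hx => (contDiffAt_comp_chart_symm g he hx).contDiffWithinAt) (hη e he)

/-- The Leibniz rule for the product of a function and a form. -/
theorem rawExtDeriv_rawSmul {k : ℕ} (g : C^∞⟮𝓘(ℝ, E), Z; 𝓘(ℝ), ℝ⟯) {η : RawForm E Z k}
    (hη : η ∈ Form E Z k) (z : Z) : RawForm.fiber (rawExtDeriv (rawSmul g η)) z =
      alternatizeUncurryFin ((covec g z).smulRight (RawForm.fiber η z)) +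
        g z • RawForm.fiber (rawExtDeriv η) z := by
  set c := chartAt E z with hc
  have hx : c z ∈ c.target := mem_chart_target E z
  have hrep : chartRep c (rawSmul g η) = fun x => (g ∘ c.symm) x • chartRep c η x := rfl
  have hg : DifferentiableAt ℝ (g ∘ c.symm) (c z) :=
    (contDiffAt_comp_chart_symm g (chart_mem_atlas E z) hx).differentiableAt (by simp)
  have hd := (hg.hasFDerivAt.smul (differentiableAt_chartRep hη z).hasFDerivAt).fderiv
  have hgz : (g ∘ c.symm) (c z) = g z := congrArg g (c.left_inv (mem_chart_source E z))
  have hext : extDeriv (chartRep c (rawSmul g η)) (c z) =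
      g z • extDeriv (chartRep c η) (c z) + alternatizeUncurryFin
        ((fderiv ℝ (g ∘ c.symm) (c z)).smulRight (chartRep c η (c z))) := by
    unfold extDeriv
    rw [hrep]
    refine (congrArg alternatizeUncurryFin hd).trans ?_
    rw [alternatizeUncurryFin_add, alternatizeUncurryFin_smul, hgz]
  have hL : (fderiv ℝ (g ∘ c.symm) (c z)).comp (mfderiv 𝓘(ℝ, E) 𝓘(ℝ, E) c z) = covec g z := by
    rw [fderiv_comp_chart_symm g (chart_mem_atlas E z) hx]
    refine (ContinuousLinearMap.comp_assoc _ _ _).trans ?_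
    have h0 : ∀ z', z' = z → covec g z' = covec g z := by rintro _ rfl; rfl
    have h1 := h0 _ (c.left_inv (mem_chart_source E z))
    have h2 := mfderiv_chart_symm_comp (E := E) z
    refine (congrArg₂ (fun (a : E →L[ℝ] ℝ) (b : E →L[ℝ] E) => a.comp b) h1 h2).trans ?_
    exact ContinuousLinearMap.comp_id _
  have hη' := chartRep_comp_mfderiv η z
  refine (congrArg (fun w : E [⋀^Fin (k + 1)]→L[ℝ] ℝ => w.compContinuousLinearMap
    (show E →L[ℝ] E from mfderiv 𝓘(ℝ, E) 𝓘(ℝ, E) c z)) (hext.trans (add_comm _ _))).trans ?_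
  refine Eq.trans (b := (alternatizeUncurryFin
    ((fderiv ℝ (g ∘ c.symm) (c z)).smulRight (chartRep c η (c z)))).compContinuousLinearMap
      (show E →L[ℝ] E from mfderiv 𝓘(ℝ, E) 𝓘(ℝ, E) c z) +
        g z • RawForm.fiber (rawExtDeriv η) z) rfl ?_
  refine congrArg (fun w : E [⋀^Fin (k + 1)]→L[ℝ] ℝ => w + g z • RawForm.fiber (rawExtDeriv η) z) ?_
  refine Eq.trans ?_ (congrArg₂ (fun (a : E →L[ℝ] ℝ) (b : E [⋀^Fin k]→L[ℝ] ℝ) =>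
    alternatizeUncurryFin (a.smulRight b)) hL hη')
  ext v
  change alternatizeUncurryFin _ _ = alternatizeUncurryFin _ _
  simp only [alternatizeUncurryFin_apply]
  rfl

/-- The form `dg_0 ∧ ⋯ ∧ dg_{p-1}`. -/
def rawD {p : ℕ} (G : Fin p → C^∞⟮𝓘(ℝ, E), Z; 𝓘(ℝ), ℝ⟯) : RawForm E Z p :=
  fun z => detForm (E := E) fun a => covec (G a) z

/-- A wedge product of differentials is smooth and closed: it is the differential of
`g_0 dg_1 ⋯ dg_{p-1}`. -/
theorem rawD_mem_closed {p : ℕ} (G : Fin p → C^∞⟮𝓘(ℝ, E), Z; 𝓘(ℝ), ℝ⟯) :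
    rawD G ∈ Form E Z p ∧ ∀ z, rawExtDeriv (rawD G) z = 0 := by
  induction p with
  | zero =>
    have h : ∀ e : OpenPartialHomeomorph Z E, chartRep e (rawD G) =
        fun _ => detForm (E := E) (Fin.elim0 : Fin 0 → E →L[ℝ] ℝ) := by
      intro e
      funext x
      ext v
      rfl
    refine ⟨fun e _ => by rw [h]; exact contDiffOn_const, fun z => ?_⟩
    unfold rawExtDeriv
    rw [h, extDeriv, fderiv_const_apply]
    ext v
    change alternatizeUncurryFin (0 : E →L[ℝ] E [⋀^Fin 0]→L[ℝ] ℝ) _ = 0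
    simp [alternatizeUncurryFin_apply]
  | succ p ih =>
    obtain ⟨h1, h2⟩ := ih (Fin.tail G)
    have h3 : rawExtDeriv (rawSmul (G 0) (rawD (Fin.tail G))) = rawD G := by
      funext z
      refine (rawExtDeriv_rawSmul (G 0) h1 z).trans ?_
      have h5 : RawForm.fiber (rawExtDeriv (rawD (Fin.tail G))) z = 0 := h2 z
      rw [h5, smul_zero, add_zero]
      refine (alternatizeUncurryFin_smulRight (E := E) _ _).trans ?_
      unfold rawD
      congr 1
      funext a
      refine Fin.cases rfl (fun a => rfl) a
    have h4 := rawSmul_mem (G 0) h1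
    refine ⟨h3 ▸ rawExtDeriv_mem h4, fun z => ?_⟩
    have := congrArg (fun η : Form E Z (p + 2) => η.1 z) (dForm_dForm ⟨_, h4⟩)
    rw [← h3]
    exact this

/-- The form `f dg_0 ∧ ⋯ ∧ dg_{p-1}`. -/
def monomial {p : ℕ} (f : C^∞⟮𝓘(ℝ, E), Z; 𝓘(ℝ), ℝ⟯) (G : Fin p → C^∞⟮𝓘(ℝ, E), Z; 𝓘(ℝ), ℝ⟯) :
    Form E Z p :=
  ⟨rawSmul f (rawD G), rawSmul_mem f (rawD_mem_closed G).1⟩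

theorem rawExtDeriv_monomial {p : ℕ} (f : C^∞⟮𝓘(ℝ, E), Z; 𝓘(ℝ), ℝ⟯)
    (G : Fin p → C^∞⟮𝓘(ℝ, E), Z; 𝓘(ℝ), ℝ⟯) (z : Z) :
    (dForm E Z p (monomial f G)).1 z = detForm (E := E)
      (Fin.cons (covec f z) fun a => covec (G a) z : Fin (p + 1) → E →L[ℝ] ℝ) := by
  refine (rawExtDeriv_rawSmul f (rawD_mem_closed G).1 z).trans ?_
  have h : RawForm.fiber (rawExtDeriv (rawD G)) z = 0 := (rawD_mem_closed G).2 z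
  rw [h, smul_zero, add_zero]
  exact alternatizeUncurryFin_smulRight (E := E) _ _

omit [IsManifold 𝓘(ℝ, E) ∞ Z] in
theorem covec_mul (f g : C^∞⟮𝓘(ℝ, E), Z; 𝓘(ℝ), ℝ⟯) (z : Z) :
    covec (f * g) z = f z • covec g z + g z • covec f z := by
  have h := ((mdifferentiableAt_smooth f z).hasMFDerivAt.mul
    (mdifferentiableAt_smooth g z).hasMFDerivAt).mfderiv
  exact h

variable [FiniteDimensional ℝ E]

/-- Right multiplication by a closed 2-form commutes with the exterior derivative. -/
theorem dForm_wedgeRight {k : ℕ} (β : Form E Z 2) (hβ : dForm E Z 2 β = 0) (α : Form E Z k) :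
    dForm E Z (k + 2) (wedgeRight β k α) = wedgeRight β (k + 1) (dForm E Z k α) := by
  apply Subtype.ext
  funext z
  set c := chartAt E z with hc
  have hα := differentiableAt_chartRep α.2 z
  have hβ' := differentiableAt_chartRep β.2 z
  have hrep : chartRep c (wedgeRight β k α).1 =
      fun x => wedgeCLM E k 2 (chartRep c α.1 x) (chartRep c β.1 x) := by
    funext x
    exact wedge_comp (E := E) (α.1 (c.symm x)) (β.1 (c.symm x)) _
  have hd := ((wedgeCLM E k 2).hasFDerivAt_of_bilinear hα.hasFDerivAt hβ'.hasFDerivAt).fderiv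
  have hβ0 : extDeriv (chartRep c β.1) (c z) = 0 := by
    rw [← chartRep_rawExtDeriv β.2 (chart_mem_atlas E z) (mem_chart_target E z)]
    have : rawExtDeriv β.1 = 0 := congrArg Subtype.val hβ
    rw [this]
    rfl
  have hext : extDeriv (chartRep c (wedgeRight β k α).1) (c z) =
      wedge (extDeriv (chartRep c α.1) (c z)) (chartRep c β.1 (c z)) := by
    rw [extDeriv, hrep]
    refine (congrArg alternatizeUncurryFin hd).trans ?_
    rw [alternatizeUncurryFin_add]
    refine (congrArg₂ (· + ·) (alternatize_wedge_right _ _) (alternatize_wedge_left _ _)).trans ?_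
    change _ • wedge _ (extDeriv (chartRep c β.1) (c z)) + _ = _
    rw [hβ0, ← wedgeCLM_apply, _root_.map_zero, smul_zero, zero_add]
    rfl
  change (extDeriv (chartRep c (wedgeRight β k α).1) (c z)).compContinuousLinearMap
    (mfderiv 𝓘(ℝ, E) 𝓘(ℝ, E) c z) = wedge (E := E) (rawExtDeriv α.1 z) (β.1 z)
  rw [hext]
  refine (wedge_comp (E := E) _ _ (mfderiv 𝓘(ℝ, E) 𝓘(ℝ, E) c z)).trans ?_
  exact congrArg (wedge (E := E) _) (chartRep_comp_mfderiv β.1 z)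

omit [IsManifold 𝓘(ℝ, E) ∞ Z] in
theorem wedgeRight_comm {k : ℕ} (β γ : Form E Z 2) (α : Form E Z k) :
    wedgeRight γ (k + 2) (wedgeRight β k α) = wedgeRight β (k + 2) (wedgeRight γ k α) :=
  Subtype.ext (funext fun z => wedge_wedge_comm (E := E) (α.1 z) (β.1 z) (γ.1 z))

/-- The de Rham twisting map is a cochain map. -/
theorem dForm_twist {n : ℕ} {F₂ : Fin n → Om E Z 2} (hF : ∀ l, dForm E Z 2 (F₂ l) = 0) (k : ℕ)
    (b : Bar (Om E Z) n k) :
    dForm E Z (k + 1) (twist (A := Om E Z) (wedgeF F₂) 0 k b) =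
      twist (A := Om E Z) (wedgeF F₂) 0 (k + 1)
        (barD (A := Om E Z) (dForm E Z) (wedgeF F₂) k b) := by
  refine d_twist (A := Om E Z) (d := dForm E Z) (m := wedgeF F₂) (u := 0)
    (fun k l x => dForm_wedgeRight (F₂ l) (hF l) x) (fun k ij x => ?_) k b
  have : wedgeF F₂ (k + 2) ij.1.2 (wedgeF F₂ k ij.1.1 x) =
    wedgeF F₂ (k + 2) ij.1.1 (wedgeF F₂ k ij.1.2 x) := wedgeRight_comm _ _ _
  rw [this, sub_self, smul_zero, add_zero]
  exact map_zero _

end FormCalculus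

/-! ### Locally finite sums of monomial forms -/

section LocalSums

open ContinuousAlternatingMap Topology

variable {E : Type*} [NormedAddCommGroup E] [NormedSpace ℝ E]
  {Z : Type*} [TopologicalSpace Z] [ChartedSpace E Z] {ι : Type*} {W : ι → Set Z}
  (ρ : SmoothPartitionOfUnity ι 𝓘(ℝ, E) Z)

/-- The finite set of indices `i` with `z` in the topological support of `ρ i`. -/
abbrev Near (z : Z) : Type _ := {i // i ∈ ρ.fintsupport z}

/-- The values of the functions of a partition of unity at a point. -/
def wt (z : Z) (i : Near ρ z) : ℝ := ρ i z

/-- The differentials of the functions of a partition of unity at a point. -/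
def dwt (z : Z) (i : Near ρ z) : E →L[ℝ] ℝ := covec (ρ i) z

variable {ρ}

theorem Near.mem (hρ : ρ.IsSubordinate W) {z : Z} (i : Near ρ z) : z ∈ W i :=
  hρ _ ((ρ.mem_fintsupport_iff z i).1 i.2)

theorem eq_zero_of_notMem_tsupport {i : ι} {z : Z} (h : z ∉ tsupport (ρ i)) : ρ i z = 0 :=
  image_eq_zero_of_notMem_tsupport h

theorem covec_eq_zero_of_notMem_tsupport {i : ι} {z : Z} (h : z ∉ tsupport (ρ i)) :
    covec (ρ i) z = 0 := by
  have h1 : (ρ i : Z → ℝ) =ᶠ[𝓝 z] fun _ => 0 := notMem_tsupport_iff_eventuallyEq.1 h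
  exact h1.mfderiv_eq.trans mfderiv_const

theorem sum_eq_one_of_subset {z : Z} {T : Finset ι} (hT : ρ.fintsupport z ⊆ T) :
    ∑ i ∈ T, ρ i z = 1 := by
  rw [← ρ.sum_eq_one (Set.mem_univ z)]
  refine (finsum_eq_sum_of_support_subset _ fun i hi => ?_).symm
  refine hT ((ρ.mem_fintsupport_iff z i).2 ?_)
  by_contra h
  exact hi (eq_zero_of_notMem_tsupport h)

theorem sum_wt (z : Z) : ∑ i, wt ρ z i = 1 :=
  (Finset.sum_coe_sort (ρ.fintsupport z) fun i => ρ i z).trans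
    (sum_eq_one_of_subset subset_rfl)

theorem hasMFDerivAt_sum (T : Finset ι) (z : Z) :
    HasMFDerivAt 𝓘(ℝ, E) 𝓘(ℝ, ℝ) (fun y => ∑ i ∈ T, ρ i y) z
      (show E →L[ℝ] ℝ from ∑ i ∈ T, covec (ρ i) z) := by
  classical
  induction T using Finset.induction_on with
  | empty =>
    simp only [Finset.sum_empty]
    exact hasMFDerivAt_const (I := 𝓘(ℝ, E)) (I' := 𝓘(ℝ, ℝ)) (0 : ℝ) z
  | insert i T hi ih =>
    have h : (fun y => ∑ i ∈ insert i T, ρ i y) = (ρ i : Z → ℝ) + fun y => ∑ i ∈ T, ρ i y :=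
      funext fun y => Finset.sum_insert hi
    rw [h, Finset.sum_insert hi]
    exact (mdifferentiableAt_smooth (ρ i) z).hasMFDerivAt.add ih

theorem sum_dwt (z : Z) : ∑ i, dwt ρ z i = 0 := by
  have h1 := (hasMFDerivAt_sum (ρ := ρ) (ρ.fintsupport z) z).mfderiv
  have h2 : (fun y => ∑ i ∈ ρ.fintsupport z, ρ i y) =ᶠ[𝓝 z] fun _ => (1 : ℝ) := by
    filter_upwards [ρ.eventually_fintsupport_subset z] with y hy
    exact sum_eq_one_of_subset hy
  exact (Finset.sum_coe_sort (ρ.fintsupport z) fun i => covec (ρ i) z).trans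
    (h1.symm.trans (h2.mfderiv_eq.trans mfderiv_const))

theorem finsum_eq_sum_tuples {M : Type*} [AddCommMonoid M] {m : ℕ} {T : Finset ι}
    {g : (Fin m → ι) → M} (h : ∀ ν a, ν a ∉ T → g ν = 0) :
    ∑ᶠ ν, g ν = ∑ ν : Fin m → {i // i ∈ T}, g fun a => ν a := by
  let e : (Fin m → {i // i ∈ T}) ↪ (Fin m → ι) :=
    ⟨fun ν a => ν a, fun ν ν' hν => funext fun a => Subtype.ext (congrFun hν a)⟩
  rw [finsum_eq_sum_of_support_subset (s := Finset.univ.map e), Finset.sum_map]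
  · rfl
  · intro ν hν
    have h' : ∀ a, ν a ∈ T := fun a => by
      by_contra ha
      exact hν (h ν a ha)
    simp only [Finset.coe_map, Finset.coe_univ, Set.image_univ, Set.mem_range]
    exact ⟨fun a => ⟨ν a, h' a⟩, rfl⟩

/-- The values of a cochain on the finitely many simplices active at `z` are locally constant. -/
theorem eventually_val_eq (hW : ∀ i, IsOpen (W i)) (hρ : ρ.IsSubordinate W) {q : ℕ} (φ : Cech W q)
    (z : Z) : ∀ᶠ y in 𝓝 z, ∀ ν : Fin (q + 1) → Near ρ z,
      val φ (fun a => (ν a : ι)) y = val φ (fun a => (ν a : ι)) z := by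
  rw [Filter.eventually_all]
  intro ν
  have hz : z ∈ inter W fun a => (ν a : ι) := mem_inter.2 fun a => (ν a).mem hρ
  have ho : IsOpen (inter W fun a => (ν a : ι)) := isOpen_iInter_of_finite fun a => hW _
  have h1 := (φ fun a => (ν a : ι)).isLocallyConstant.eventually_eq ⟨z, hz⟩
  rw [nhds_subtype_eq_comap, Filter.eventually_comap] at h1
  filter_upwards [h1, ho.mem_nhds hz] with y hy hy'
  rw [val_of_mem φ (mem_inter.1 hy'), val_of_mem φ (mem_inter.1 hz)]
  exact hy _ rfl

variable [IsManifold 𝓘(ℝ, E) ∞ Z]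

variable (E Z) in
/-- The value of a form at a point, as a homomorphism. -/
def evalForm (p : ℕ) (z : Z) : Form E Z p →+ E [⋀^Fin p]→L[ℝ] ℝ :=
  AddMonoidHom.mk' (fun η => RawForm.fiber η.1 z) fun _ _ => rfl

/-- The form `∑ φ_ν f_ν dG_{ν,0} ∧ ⋯ ∧ dG_{ν,p-1}`, summed over all `q`-simplices `ν`. At
each point only finitely many terms are nonzero once `Supported` holds; otherwise `∑ᶠ` may be the
junk value `0`. -/
def localSum {p q : ℕ} (φ : Cech W q) (f : (Fin (q + 1) → ι) → C^∞⟮𝓘(ℝ, E), Z; 𝓘(ℝ, ℝ), ℝ⟯)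
    (G : (Fin (q + 1) → ι) → Fin p → C^∞⟮𝓘(ℝ, E), Z; 𝓘(ℝ, ℝ), ℝ⟯) : RawForm E Z p :=
  fun z => (∑ᶠ ν, (val φ ν z : ℝ) • RawForm.fiber (monomial (f ν) (G ν)).1 z :
    E [⋀^Fin p]→L[ℝ] ℝ)

variable (ρ) in
/-- Each monomial of a local sum vanishes off the supports of the functions indexed by the vertices
of its simplex. -/
def Supported {p m : ℕ} (f : (Fin m → ι) → C^∞⟮𝓘(ℝ, E), Z; 𝓘(ℝ, ℝ), ℝ⟯)
    (G : (Fin m → ι) → Fin p → C^∞⟮𝓘(ℝ, E), Z; 𝓘(ℝ, ℝ), ℝ⟯) : Prop :=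
  ∀ ν a y, y ∉ tsupport (ρ (ν a)) → f ν y = 0 ∨ ∃ b, covec (G ν b) y = 0

section

variable {p q : ℕ} (φ : Cech W q) {f : (Fin (q + 1) → ι) → C^∞⟮𝓘(ℝ, E), Z; 𝓘(ℝ, ℝ), ℝ⟯}
  {G : (Fin (q + 1) → ι) → Fin p → C^∞⟮𝓘(ℝ, E), Z; 𝓘(ℝ, ℝ), ℝ⟯} (hS : Supported ρ f G)
include hS

theorem localSum_eq_sum {z : Z} {T : Finset ι} (hT : ρ.fintsupport z ⊆ T) :
    RawForm.fiber (localSum φ f G) z = ∑ ν : Fin (q + 1) → {i // i ∈ T},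
      (val φ (fun a => (ν a : ι)) z : ℝ) • RawForm.fiber (monomial (f fun a => ν a) (G fun a => ν a)).1 z := by
  refine finsum_eq_sum_tuples (M := E [⋀^Fin p]→L[ℝ] ℝ) fun ν a ha => ?_
  have ha' : z ∉ tsupport (ρ (ν a)) := fun h => ha (hT ((ρ.mem_fintsupport_iff z _).2 h))
  have : RawForm.fiber (monomial (f ν) (G ν)).1 z = 0 := by
    rcases hS ν a z ha' with h | ⟨b, hb⟩
    · exact (congrArg (· • detForm (E := E) fun a => covec (G ν a) z) h).trans (zero_smul _ _)
    · refine (congrArg (f ν z • ·) ?_).trans (smul_zero _)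
      exact (detAlt E p).map_coord_zero b hb
  exact (congrArg ((val φ ν z : ℝ) • ·) this).trans (smul_zero _)

variable (hW : ∀ i, IsOpen (W i)) (hρ : ρ.IsSubordinate W)
include hW hρ

/-- Near `z` a local sum is a finite combination of monomials with constant coefficients, the values
of the cochain at `z`. -/
theorem localSum_eventually_eq (z : Z) : ∀ᶠ y in 𝓝 z, localSum φ f G y =
    (∑ ν : Fin (q + 1) → Near ρ z, (val φ (fun a => (ν a : ι)) z : ℝ) •
      monomial (f fun a => ν a) (G fun a => ν a)).1 y := by
  filter_upwards [eventually_val_eq hW hρ φ z, ρ.eventually_fintsupport_subset z] with y hy hy'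
  refine (localSum_eq_sum φ hS hy').trans ?_
  refine Eq.trans ?_ (_root_.map_sum (evalForm E Z p y) _ Finset.univ).symm
  exact Finset.sum_congr rfl fun ν _ => congrArg
    (fun c : ℤ => (c : ℝ) • RawForm.fiber (monomial (f fun a => ν a) (G fun a => ν a)).1 y) (hy ν)

theorem localSum_mem : localSum φ f G ∈ Form E Z p :=
  mem_Form_of_eventually fun z => ⟨_, Subtype.property _, localSum_eventually_eq φ hS hW hρ z⟩

theorem rawExtDeriv_localSum (z : Z) : RawForm.fiber (rawExtDeriv (localSum φ f G)) z =
    ∑ ν : Fin (q + 1) → Near ρ z, (val φ (fun a => (ν a : ι)) z : ℝ) • detForm (E := E)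
      (Fin.cons (covec (f fun a => ν a) z) fun b => covec (G (fun a => ν a) b) z :
        Fin (p + 1) → E →L[ℝ] ℝ) := by
  have hsm : ∀ (c : ℤ) (η : Form E Z p), dForm E Z p ((c : ℝ) • η) = (c : ℝ) • dForm E Z p η := by
    intro c η
    rw [Int.cast_smul_eq_zsmul, Int.cast_smul_eq_zsmul, map_zsmul]
  refine (rawExtDeriv_congr (localSum_eventually_eq φ hS hW hρ z)).trans ?_
  refine (_root_.map_sum ((evalForm E Z (p + 1) z).comp (dForm E Z p)) _
    (Finset.univ : Finset (Fin (q + 1) → Near ρ z))).trans ?_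
  refine Finset.sum_congr rfl fun ν _ => ?_
  refine (congrArg (evalForm E Z (p + 1) z) (hsm _ _)).trans ?_
  exact congrArg ((val φ (fun a => (ν a : ι)) z : ℝ) • ·) (rawExtDeriv_monomial _ _ z)

end

end LocalSums

/-! ### The collation homomorphism -/

section Collation

open ContinuousAlternatingMap Topology

variable {E : Type*} [NormedAddCommGroup E] [NormedSpace ℝ E]
  {Z : Type*} [TopologicalSpace Z] [ChartedSpace E Z] [IsManifold 𝓘(ℝ, E) ∞ Z]
  {ι : Type*} {W : ι → Set Z} {ρ : SmoothPartitionOfUnity ι 𝓘(ℝ, E) Z}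

omit [IsManifold 𝓘(ℝ, E) ∞ Z] in
theorem supported_collation (p : ℕ) :
    Supported ρ (fun ν : Fin (p + 1) → ι => ρ (ν 0)) fun ν (a : Fin p) => ρ (ν a.succ) := by
  intro ν a y h
  induction a using Fin.cases with
  | zero => exact Or.inl (eq_zero_of_notMem_tsupport h)
  | succ a => exact Or.inr ⟨a, covec_eq_zero_of_notMem_tsupport h⟩

theorem localSum_add {p q : ℕ} (φ ψ : Cech W q)
    {f : (Fin (q + 1) → ι) → C^∞⟮𝓘(ℝ, E), Z; 𝓘(ℝ, ℝ), ℝ⟯}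
    {G : (Fin (q + 1) → ι) → Fin p → C^∞⟮𝓘(ℝ, E), Z; 𝓘(ℝ, ℝ), ℝ⟯} (hS : Supported ρ f G) :
    localSum (φ + ψ) f G = localSum φ f G + localSum ψ f G := by
  funext z
  refine (localSum_eq_sum (φ + ψ) hS subset_rfl).trans ?_
  refine Eq.trans ?_ (congrArg₂ (fun v w : E [⋀^Fin p]→L[ℝ] ℝ => v + w)
    (localSum_eq_sum φ hS subset_rfl) (localSum_eq_sum ψ hS subset_rfl)).symm
  simp only [← Finset.sum_add_distrib, val_add, Int.cast_add, add_smul]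

/-- The collation homomorphism: it sends a cochain `φ` to the form
`∑ φ_{λ₀ … λ_p} ρ_{λ₀} dρ_{λ₁} ⋯ dρ_{λ_p}`. -/
def collation (hW : ∀ i, IsOpen (W i)) (hρ : ρ.IsSubordinate W) (p : ℕ) : Cech W p →+ Om E Z p :=
  AddMonoidHom.mk' (fun φ => ⟨localSum φ (fun ν => ρ (ν 0)) fun ν a => ρ (ν a.succ),
    localSum_mem φ (supported_collation p) hW hρ⟩)
    fun φ ψ => Subtype.ext (localSum_add φ ψ (supported_collation p))

variable (hW : ∀ i, IsOpen (W i)) (hρ : ρ.IsSubordinate W)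

theorem collation_apply {p : ℕ} (φ : Cech W p) (z : Z) :
    RawForm.fiber (collation hW hρ p φ).1 z = ∑ ν : Fin (p + 1) → Near ρ z,
      ((val φ (fun a => (ν a : ι)) z : ℝ) * wt ρ z (ν 0)) •
        detAlt E p fun a => dwt ρ z (ν a.succ) := by
  refine (localSum_eq_sum φ (supported_collation p) subset_rfl).trans ?_
  exact Finset.sum_congr rfl fun ν _ => (mul_smul _ _ _).symm

theorem dForm_collation_apply {p : ℕ} (φ : Cech W p) (z : Z) :
    RawForm.fiber (dForm E Z p (collation hW hρ p φ)).1 z = ∑ ν : Fin (p + 1) → Near ρ z,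
      (val φ (fun a => (ν a : ι)) z : ℝ) • detAlt E (p + 1) fun a => dwt ρ z (ν a) := by
  refine (rawExtDeriv_localSum φ (supported_collation p) hW hρ z).trans ?_
  refine Finset.sum_congr rfl fun ν _ => ?_
  refine congrArg (fun v : Fin (p + 1) → E →L[ℝ] ℝ =>
    (val φ (fun a => (ν a : ι)) z : ℝ) • detAlt E (p + 1) v) ?_
  funext a
  refine Fin.cases rfl (fun a => rfl) a

include hρ in
omit [IsManifold 𝓘(ℝ, E) ∞ Z] in
theorem val_cechD_near {p : ℕ} (φ : Cech W p) (z : Z) (ν : Fin (p + 2) → Near ρ z) :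
    (val (cechD W p φ) (fun a => (ν a : ι)) z : ℝ) = ∑ j : Fin (p + 2), (-1 : ℝ) ^ (j : ℕ) *
      (val φ (fun a => (ν (j.succAbove a) : ι)) z : ℝ) := by
  rw [val_cechD φ fun a => (ν a).mem hρ]
  push_cast
  rfl

theorem dForm_collation {p : ℕ} (φ : Cech W p) :
    dForm E Z p (collation hW hρ p φ) = collation hW hρ (p + 1) (cechD W p φ) := by
  apply Subtype.ext
  funext z
  refine (dForm_collation_apply hW hρ φ z).trans ?_
  refine Eq.trans ?_ (collation_apply hW hρ (cechD W p φ) z).symm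
  have h := sum_delta_collate (sum_dwt (E := E) (ρ := ρ) z) (sum_wt z)
    (fun ν : Fin (p + 1) → Near ρ z => (val φ (fun a => (ν a : ι)) z : ℝ)) (detAlt E (p + 1))
  refine h.symm.trans (Finset.sum_congr rfl fun ν _ => ?_)
  rw [val_cechD_near hρ]

omit [IsManifold 𝓘(ℝ, E) ∞ Z] in
theorem dRho_eq_zero {p : ℕ} {ν : Fin p → ι} {z : Z} {a : Fin p} (h : ν a ∉ ρ.fintsupport z) :
    RawForm.fiber (dRho ρ ν) z = 0 :=
  (detAlt E p).map_coord_zero a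
    (covec_eq_zero_of_notMem_tsupport fun h' => h ((ρ.mem_fintsupport_iff z _).2 h'))

omit [IsManifold 𝓘(ℝ, E) ∞ Z] in
theorem collateCocycle_eq_sum {p : ℕ} (φ : Cech W p) (i₀ : ι) (z : Z) :
    RawForm.fiber (collateCocycle ρ φ i₀) z = ∑ ν : Fin p → Near ρ z,
      (val φ (Fin.cons i₀ fun a => (ν a : ι)) z : ℝ) • detAlt E p fun a => dwt ρ z (ν a) := by
  refine finsum_eq_sum_tuples (M := E [⋀^Fin p]→L[ℝ] ℝ) fun ν a ha => ?_
  exact (congrArg ((val φ (Fin.cons i₀ ν) z : ℝ) • ·) (dRho_eq_zero ha)).trans (smul_zero _)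

omit [IsManifold 𝓘(ℝ, E) ∞ Z] in
theorem collate_eq_sum {p : ℕ} (φ : Cech W p) (i₀ : ι) (z : Z) :
    RawForm.fiber (collate ρ φ i₀) z = RawForm.fiber (collateCocycle ρ φ i₀) z +
      ∑ ν : Fin (p + 1) → Near ρ z,
        ((val (cechD W p φ) (Fin.cons i₀ fun a => (ν a : ι)) z : ℝ) * wt ρ z (ν 0)) •
          detAlt E p fun a => dwt ρ z (ν a.succ) := by
  refine congrArg (fun v : E [⋀^Fin p]→L[ℝ] ℝ => RawForm.fiber (collateCocycle ρ φ i₀) z + v) ?_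
  refine finsum_eq_sum_tuples (M := E [⋀^Fin p]→L[ℝ] ℝ) fun ν a ha => ?_
  induction a using Fin.cases with
  | zero =>
    have : ρ (ν 0) z = 0 := eq_zero_of_notMem_tsupport fun h => ha ((ρ.mem_fintsupport_iff z _).2 h)
    refine Eq.trans (b := ((val (cechD W p φ) (Fin.cons i₀ ν) z : ℝ) * 0) •
      RawForm.fiber (dRho ρ (Fin.tail ν)) z) ?_ (by rw [mul_zero, zero_smul])
    rw [this]
    rfl
  | succ a =>
    exact (congrArg (((val (cechD W p φ) (Fin.cons i₀ ν) z : ℝ) * ρ (ν 0) z) • ·)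
      (dRho_eq_zero (ν := Fin.tail ν) ha)).trans (smul_zero _)

/-- The collating formula does not depend on the vertex `λ₀`: it gives the form
`∑ φ_{λ₀ … λ_p} ρ_{λ₀} dρ_{λ₁} ⋯ dρ_{λ_p}`. -/
theorem collation_eq_collate {p : ℕ} (φ : Cech W p) {i₀ : ι} {z : Z} (hz : z ∈ W i₀) :
    (collation hW hρ p φ).1 z = collate ρ φ i₀ z := by
  refine (collation_apply hW hρ φ z).trans (Eq.trans ?_ ((collate_eq_sum φ i₀ z).trans
    (congrArg₂ (fun v w : E [⋀^Fin p]→L[ℝ] ℝ => v + w) (collateCocycle_eq_sum φ i₀ z) rfl)).symm)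
  have h1 := sum_delta_collate (sum_dwt z) (sum_wt z)
    (fun ν : Fin p → Near ρ z => (val φ (Fin.cons i₀ fun a => (ν a : ι)) z : ℝ)) (detAlt E p)
  have h2 : ∀ ν : Fin (p + 1) → Near ρ z,
      (val (cechD W p φ) (Fin.cons i₀ fun a => (ν a : ι)) z : ℝ) =
        (val φ (fun a => (ν a : ι)) z : ℝ) - ∑ j : Fin (p + 1), (-1 : ℝ) ^ (j : ℕ) *
          (val φ (Fin.cons i₀ fun a => (ν (j.succAbove a) : ι)) z : ℝ) := by
    intro ν
    have hm : ∀ a : Fin (p + 2), z ∈ W ((Fin.cons i₀ fun a => (ν a : ι) : Fin (p + 2) → ι) a) :=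
      fun a => Fin.cases hz (fun a => (ν a).mem hρ) a
    rw [val_cechD φ hm, Fin.sum_univ_succ]
    push_cast
    have h3 : ∀ j : Fin (p + 1), (fun a : Fin (p + 1) =>
        (Fin.cons i₀ fun a => (ν a : ι) : Fin (p + 2) → ι) (j.succ.succAbove a)) =
        Fin.cons i₀ fun a => (ν (j.succAbove a) : ι) := by
      intro j
      funext a
      refine Fin.cases ?_ (fun a => ?_) a
      · rw [Fin.succ_succAbove_zero]; rfl
      · rw [Fin.succ_succAbove_succ]; rfl
    simp only [h3, Fin.val_zero, pow_zero, one_mul, Fin.succAbove_zero, Fin.cons_succ, Fin.val_succ,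
      pow_succ, mul_neg, mul_one, neg_mul, Finset.sum_neg_distrib]
    exact sub_eq_add_neg _ _ |>.symm
  refine Eq.trans ?_ (congrArg₂ (fun v w : E [⋀^Fin p]→L[ℝ] ℝ => v + w) h1 rfl)
  refine Eq.trans (Finset.sum_congr rfl fun ν _ => ?_) Finset.sum_add_distrib
  rw [← add_smul, h2]
  congr 1
  ring

theorem collation_eq_collateCocycle {p : ℕ} {φ : Cech W p} (hφ : cechD W p φ = 0) {i₀ : ι} {z : Z}
    (hz : z ∈ W i₀) : (collation hW hρ p φ).1 z = collateCocycle ρ φ i₀ z := by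
  refine (collation_eq_collate hW hρ φ hz).trans ((collate_eq_sum φ i₀ z).trans ?_)
  refine (congrArg (RawForm.fiber (collateCocycle ρ φ i₀) z + ·)
    (Finset.sum_eq_zero fun ν _ => ?_)).trans (add_zero _)
  have : val (0 : Cech W (p + 1)) (Fin.cons i₀ fun a => (ν a : ι)) z = 0 := map_zero (valHom W _ z)
  rw [hφ, this, Int.cast_zero, zero_mul, zero_smul]

theorem isCollatedCocycle_collation {p : ℕ} {φ : Cech W p} (hφ : cechD W p φ = 0) :
    IsCollatedCocycle ρ φ (collation hW hρ p φ) :=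
  fun _ _ hz => collation_eq_collateCocycle hW hρ hφ hz

variable [FiniteDimensional ℝ E]

/-- Collation is multiplicative when the right factor is a cocycle: the sum over the vertices of
the right factor collates it at the last vertex of the left factor. -/
theorem collation_cupRight {q : ℕ} {A : Cech W q} (hA : cechD W q A = 0) {p : ℕ} (φ : Cech W p) :
    collation hW hρ (p + q) (cupRight A p φ) =
      wedgeRight (collation hW hρ q A) p (collation hW hρ p φ) := by
  apply Subtype.ext
  funext z
  refine (collation_apply hW hρ _ z).trans ?_
  change _ = wedge (RawForm.fiber (collation hW hρ p φ).1 z)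
    (RawForm.fiber (collation hW hρ q A).1 z)
  rw [collation_apply hW hρ φ z]
  have hAz : ∀ i : Near ρ z, RawForm.fiber (collation hW hρ q A).1 z = ∑ μ : Fin q → Near ρ z,
      (val A (Fin.cons (i : ι) fun a => (μ a : ι)) z : ℝ) • detAlt E q fun a => dwt ρ z (μ a) :=
    fun i => (collation_eq_collateCocycle hW hρ hA (i.mem hρ)).trans (collateCocycle_eq_sum A i z)
  have hw : wedge (∑ ν : Fin (p + 1) → Near ρ z, ((val φ (fun a => (ν a : ι)) z : ℝ) *
        wt ρ z (ν 0)) • detAlt E p fun a => dwt ρ z (ν a.succ))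
        (RawForm.fiber (collation hW hρ q A).1 z) =
      ∑ ν : Fin (p + 1) → Near ρ z, ∑ μ : Fin q → Near ρ z,
        ((val φ (fun a => (ν a : ι)) z : ℝ) * wt ρ z (ν 0) *
          (val A (Fin.cons (ν (Fin.last p) : ι) fun a => (μ a : ι)) z : ℝ)) •
          detAlt E (p + q) (Fin.append (fun a => dwt ρ z (ν a.succ)) fun a => dwt ρ z (μ a)) := by
    rw [← wedgeCLM_apply, _root_.map_sum, _root_.sum_apply]
    refine Finset.sum_congr rfl fun ν _ => ?_
    rw [hAz (ν (Fin.last p)), _root_.map_sum]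
    refine Finset.sum_congr rfl fun μ _ => ?_
    rw [map_smul, map_smul, _root_.smul_apply, smul_smul, wedgeCLM_apply, mul_comm]
    exact congrArg _ (wedge_detForm _ _)
  refine Eq.trans ?_ hw.symm
  rw [← Fintype.sum_prod_type']
  refine (Fintype.sum_equiv ((Fin.appendEquiv (p + 1) q).trans
    ((finCongr (by omega : p + 1 + q = p + q + 1)).arrowCongr (Equiv.refl (Near ρ z)))) _ _
      fun νμ => ?_).symm
  obtain ⟨ν, μ⟩ := νμ
  generalize hσ : ((Fin.appendEquiv (p + 1) q).trans ((finCongr (by omega :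
    p + 1 + q = p + q + 1)).arrowCongr (Equiv.refl (Near ρ z)))) (ν, μ) = σ
  have hL : ∀ a (h : a < p + 1), σ ⟨a, by omega⟩ = ν ⟨a, h⟩ := fun a h => by
    rw [← hσ]
    exact Fin.append_left ν μ ⟨a, h⟩
  have hR : ∀ b (h : b < q), σ ⟨p + 1 + b, by omega⟩ = μ ⟨b, h⟩ := fun b h => by
    rw [← hσ]
    exact Fin.append_right ν μ ⟨b, h⟩
  have h1 : (fun a : Fin (p + 1) => (σ ⟨a, by omega⟩ : ι)) = fun a => (ν a : ι) :=
    funext fun a => congrArg Subtype.val (hL a a.2)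
  have h2 : (fun b : Fin (q + 1) => (σ ⟨p + b, by omega⟩ : ι)) =
      Fin.cons (ν (Fin.last p) : ι) fun a => (μ a : ι) := by
    funext b
    refine Fin.cases ?_ (fun b => ?_) b
    · exact congrArg Subtype.val (hL p (by omega))
    · refine Eq.trans ?_ (congrArg Subtype.val (hR b b.2))
      congr 3
      simp only [Fin.val_succ]
      omega
  have h3 : σ 0 = ν 0 := hL 0 (by omega)
  have h4 : (fun a : Fin (p + q) => dwt ρ z (σ a.succ)) =
      Fin.append (fun a => dwt ρ z (ν a.succ)) fun a => dwt ρ z (μ a) := by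
    funext a
    refine Fin.addCases (fun a => ?_) (fun b => ?_) a
    · rw [Fin.append_left]
      exact congrArg (dwt ρ z) (hL (a + 1) (by omega))
    · rw [Fin.append_right]
      refine congrArg (dwt ρ z) (Eq.trans ?_ (hR b b.2))
      congr 1
      exact Fin.ext (by simp only [Fin.val_succ, Fin.val_natAdd]; omega)
  rw [h3, h4, val_cupRight A φ fun a => (σ a).mem hρ, h1, h2]
  push_cast
  congr 1
  ring

end Collation

/-! ### The correction term as a homotopy -/

section Correction

open ContinuousAlternatingMap Topology

/-- The vertices of `ν` other than the first one and the one in position `p + 1`. -/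
def omitTwo {α : Type*} {p : ℕ} (ν : Fin (p + 4) → α) (a : Fin (p + 2)) : α :=
  if (a : ℕ) < p then ν ⟨a + 1, by omega⟩ else ν ⟨a + 2, by omega⟩

section Append

variable {α : Type*} {p : ℕ} (ν : Fin (p + 1) → α) (a b c : α)

/-- The tuple `(ν 0, …, ν p, a, b, c)`. -/
def append₃ : Fin (p + 3 + 1) → α := Fin.append (m := p + 1) (n := 3) ν ![a, b, c]

theorem append₃_left {i : ℕ} (h : i < p + 1) : append₃ ν a b c ⟨i, by omega⟩ = ν ⟨i, h⟩ :=
  Fin.append_left ν ![a, b, c] ⟨i, h⟩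

theorem append₃_right (i : Fin 3) : append₃ ν a b c ⟨p + 1 + i, by omega⟩ = ![a, b, c] i :=
  Fin.append_right ν ![a, b, c] i

theorem append₃_zero : append₃ ν a b c 0 = ν 0 := append₃_left ν a b c (Nat.succ_pos p)

theorem map_append₃_succ {β : Type*} (g : α → β) :
    (fun i : Fin (p + 3) => g (append₃ ν a b c i.succ)) =
    Fin.append (m := p) (n := 3) (fun i => g (ν i.succ)) ![g a, g b, g c] := by
  funext i
  refine Fin.addCases (m := p) (n := 3) (fun i => ?_) (fun i => ?_) i
  · rw [Fin.append_left]
    exact congrArg g (append₃_left ν a b c (i := i + 1) (by omega))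
  · rw [Fin.append_right]
    have h : (Fin.natAdd p i).succ = ⟨p + 1 + i, by omega⟩ :=
      Fin.ext (by simp only [Fin.val_succ, Fin.val_natAdd]; omega)
    rw [h, append₃_right]
    fin_cases i <;> rfl

theorem map_omitTwo_append₃ {β : Type*} (g : α → β) :
    (fun i : Fin (p + 2) => g (omitTwo (append₃ ν a b c) i)) =
      Fin.append (m := p) (n := 2) (fun i => g (ν i.succ)) ![g b, g c] := by
  funext i
  refine Fin.addCases (m := p) (n := 2) (fun i => ?_) (fun i => ?_) i
  · rw [Fin.append_left, omitTwo, if_pos (by simp)]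
    exact congrArg g (append₃_left ν a b c (i := i + 1) (by omega))
  · rw [Fin.append_right, omitTwo, if_neg (by simp)]
    have h : ∀ h', (⟨(Fin.natAdd p i : Fin (p + 2)) + 2, h'⟩ : Fin (p + 3 + 1)) =
        ⟨p + 1 + (i.succ : Fin 3), by omega⟩ := fun _ =>
      Fin.ext (by simp only [Fin.val_succ, Fin.val_natAdd]; omega)
    rw [h, append₃_right]
    fin_cases i <;> rfl

theorem sum_append₃ [Fintype α] {M : Type*} [AddCommMonoid M] (g : (Fin (p + 3 + 1) → α) → M) :
    ∑ ν, g ν = ∑ ν : Fin (p + 1) → α, ∑ a, ∑ b, ∑ c, g (append₃ ν a b c) := by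
  have h := Fintype.sum_equiv (Fin.appendEquiv (α := α) (p + 1) 3)
    (fun νμ => g (Fin.append (m := p + 1) (n := 3) νμ.1 νμ.2)) g fun _ => rfl
  rw [← h, Fintype.sum_prod_type]
  refine Finset.sum_congr rfl fun ν _ => ?_
  let e : α × α × α ≃ (Fin 3 → α) :=
    { toFun := fun x => ![x.1, x.2.1, x.2.2]
      invFun := fun v => (v 0, v 1, v 2)
      left_inv := fun _ => rfl
      right_inv := fun v => by ext i; fin_cases i <;> rfl }
  rw [← Fintype.sum_equiv e (fun x => g (append₃ ν x.1 x.2.1 x.2.2)) _ fun _ => rfl]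
  simp only [Fintype.sum_prod_type]

end Append

variable {E : Type*} [NormedAddCommGroup E] [NormedSpace ℝ E]
  {Z : Type*} [TopologicalSpace Z] [ChartedSpace E Z]
  {ι : Type*} {W : ι → Set Z} {ρ : SmoothPartitionOfUnity ι 𝓘(ℝ, E) Z}

variable (ρ) in
/-- The values of a 2-cochain at `z` on the simplices active at `z`. -/
def nearVal (A : Cech W 2) (z : Z) (i j k : Near ρ z) : ℝ := val₂ A z i j k

theorem nearVal_cocycle (hρ : ρ.IsSubordinate W) {A : Cech W 2} (hA : cechD W 2 A = 0) (z : Z)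
    (x i j k : Near ρ z) :
    nearVal ρ A z i j k = nearVal ρ A z x j k - nearVal ρ A z x i k + nearVal ρ A z x i j := by
  have h := val₂_cocycle hA (x.mem hρ) (i.mem hρ) (j.mem hρ) (k.mem hρ)
  have h' : val₂ A z i j k = val₂ A z x j k - val₂ A z x i k + val₂ A z x i j := by linarith
  unfold nearVal
  exact_mod_cast h'

theorem val_cupRight_append₃ (hρ : ρ.IsSubordinate W) (C : Cech W 3) {p : ℕ} (φ : Cech W p) {z : Z}
    (ν : Fin (p + 1) → Near ρ z) (a b c : Near ρ z) :
    val (cupRight C p φ) (fun i => ((append₃ ν a b c i : Near ρ z) : ι)) z =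
      val φ (fun i => (ν i : ι)) z * val C ![(ν (Fin.last p) : ι), a, b, c] z := by
  rw [val_cupRight C φ fun i => (append₃ ν a b c i).mem hρ]
  congr 2
  · funext i
    exact congrArg Subtype.val (append₃_left ν a b c i.2)
  · funext i
    refine Fin.cases ?_ (fun i => ?_) i
    · exact congrArg Subtype.val (append₃_left ν a b c (i := p) (by omega))
    · have h : ∀ h', (⟨p + (i.succ : Fin 4), h'⟩ : Fin (p + 3 + 1)) = ⟨p + 1 + i, by omega⟩ :=
        fun _ => Fin.ext (by simp only [Fin.val_succ]; omega)
      rw [h, append₃_right]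
      fin_cases i <;> rfl

theorem val_commCochain_near (hρ : ρ.IsSubordinate W) (A B : Cech W 2) {z : Z}
    (x a b c : Near ρ z) : (val (commCochain A B) ![(x : ι), a, b, c] z : ℝ) =
      commCoeff (nearVal ρ A z) (nearVal ρ B z) x a b c := by
  rw [val_commCochain A B (σ := ![(x : ι), a, b, c]) fun i => by
    fin_cases i
    exacts [x.mem hρ, a.mem hρ, b.mem hρ, c.mem hρ]]
  push_cast
  rfl

theorem val_corrCochain_near (hρ : ρ.IsSubordinate W) (A B : Cech W 2) {z : Z}
    (x a b c : Near ρ z) : (val (corrCochain A B) ![(x : ι), a, b, c] z : ℝ) =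
      corrCoeff (nearVal ρ A z) (nearVal ρ B z) x a b c := by
  rw [val_corrCochain A B (σ := ![(x : ι), a, b, c]) fun i => by
    fin_cases i
    exacts [x.mem hρ, a.mem hρ, b.mem hρ, c.mem hρ]]
  push_cast
  rfl

variable [IsManifold 𝓘(ℝ, E) ∞ Z]

omit [IsManifold 𝓘(ℝ, E) ∞ Z] in
theorem supported_correction (p : ℕ) :
    Supported ρ (fun ν : Fin (p + 3 + 1) → ι => ρ (ν 0) * ρ (ν ⟨p + 1, by omega⟩))
      fun ν (a : Fin (p + 2)) => ρ (omitTwo ν a) := by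
  intro ν a y h
  have h0 : ∀ i, i = a → ρ (ν i) y = 0 := fun i hi => hi ▸ eq_zero_of_notMem_tsupport h
  have h1 : ∀ i, i = a → covec (ρ (ν i)) y = 0 := fun i hi => hi ▸ covec_eq_zero_of_notMem_tsupport h
  by_cases ha0 : (a : ℕ) = 0
  · refine Or.inl ?_
    change ρ (ν 0) y * _ = 0
    rw [h0 0 (Fin.ext ha0.symm), zero_mul]
  by_cases ha1 : (a : ℕ) = p + 1
  · refine Or.inl ?_
    change _ * ρ (ν ⟨p + 1, _⟩) y = 0
    rw [h0 ⟨p + 1, by omega⟩ (Fin.ext ha1.symm), mul_zero]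
  refine Or.inr ?_
  by_cases ha2 : (a : ℕ) ≤ p
  · refine ⟨⟨a - 1, by omega⟩, ?_⟩
    change covec (ρ (omitTwo ν _)) y = 0
    rw [omitTwo, if_pos (by simp only; omega)]
    exact h1 _ (Fin.ext (by simp only; omega))
  · refine ⟨⟨a - 2, by omega⟩, ?_⟩
    change covec (ρ (omitTwo ν _)) y = 0
    rw [omitTwo, if_neg (by simp only; omega)]
    exact h1 _ (Fin.ext (by simp only; omega))

variable (hW : ∀ i, IsOpen (W i)) (hρ : ρ.IsSubordinate W)

/-- The form `∑ φ_{λ₁ … λ_{p+4}} ρ_{λ₁} ρ_{λ_{p+2}} dρ_{λ₂} ⋯ dρ_{λ_{p+1}} dρ_{λ_{p+3}} dρ_{λ_{p+4}}`. -/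
def corrHom (p : ℕ) : Cech W (p + 3) →+ Om E Z (p + 2) :=
  AddMonoidHom.mk' (fun φ => ⟨localSum φ (fun ν => ρ (ν 0) * ρ (ν ⟨p + 1, by omega⟩))
    fun ν a => ρ (omitTwo ν a), localSum_mem φ (supported_correction p) hW hρ⟩)
    fun φ ψ => Subtype.ext (localSum_add φ ψ (supported_correction p))

theorem corrHom_apply (A B : Cech W 2) {p : ℕ} (φ : Cech W p) (z : Z) :
    RawForm.fiber (corrHom hW hρ p (cupRight (corrCochain A B) p φ)).1 z =
      ∑ ν : Fin (p + 1) → Near ρ z, (val φ (fun a => (ν a : ι)) z : ℝ) •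
        corrTerm (nearVal ρ A z) (nearVal ρ B z) (dwt ρ z) (wt ρ z) (detAlt E (p + 2)) ν := by
  refine (localSum_eq_sum _ (supported_correction p) subset_rfl).trans ?_
  refine (sum_append₃ _).trans (Finset.sum_congr rfl fun ν _ => ?_)
  rw [corrTerm, Finset.smul_sum]
  refine Finset.sum_congr rfl fun a _ => ?_
  rw [Finset.smul_sum]
  refine Finset.sum_congr rfl fun b _ => ?_
  rw [Finset.smul_sum]
  refine Finset.sum_congr rfl fun c _ => ?_
  rw [val_cupRight_append₃ hρ, Int.cast_mul, val_corrCochain_near hρ, mul_smul, mul_assoc, mul_smul]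
  refine congrArg (fun v : E [⋀^Fin (p + 2)]→L[ℝ] ℝ => (val φ (fun a => (ν a : ι)) z : ℝ) •
    corrCoeff (nearVal ρ A z) (nearVal ρ B z) (ν (Fin.last p)) a b c • v) ?_
  change (wt ρ z (append₃ ν a b c 0) * wt ρ z (append₃ ν a b c ⟨p + 1 + (0 : Fin 3), _⟩)) •
    detAlt E (p + 2) _ = _
  rw [append₃_right, append₃_zero]
  refine congrArg (fun v : Fin (p + 2) → E →L[ℝ] ℝ => (wt ρ z (ν 0) * wt ρ z a) •
    detAlt E (p + 2) v) ?_
  refine Eq.trans ?_ (map_omitTwo_append₃ ν a b c (dwt ρ z))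
  funext i
  simp only [omitTwo]
  split_ifs <;> rfl

theorem dForm_corrHom_apply (A B : Cech W 2) {p : ℕ} (φ : Cech W p) (z : Z) :
    RawForm.fiber (dForm E Z (p + 2) (corrHom hW hρ p (cupRight (corrCochain A B) p φ))).1 z =
      ∑ ν : Fin (p + 1) → Near ρ z, (val φ (fun a => (ν a : ι)) z : ℝ) • ∑ a, ∑ b, ∑ c,
        corrCoeff (nearVal ρ A z) (nearVal ρ B z) (ν (Fin.last p)) a b c •
          detAlt E (p + 3) (Fin.cons (wt ρ z (ν 0) • dwt ρ z a + wt ρ z a • dwt ρ z (ν 0))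
            (Fin.append (m := p) (n := 2) (fun i => dwt ρ z (ν i.succ)) ![dwt ρ z b, dwt ρ z c]) :
              Fin (p + 2 + 1) → E →L[ℝ] ℝ) := by
  refine (rawExtDeriv_localSum _ (supported_correction p) hW hρ z).trans ?_
  refine (sum_append₃ _).trans (Finset.sum_congr rfl fun ν _ => ?_)
  rw [Finset.smul_sum]
  refine Finset.sum_congr rfl fun a _ => ?_
  rw [Finset.smul_sum]
  refine Finset.sum_congr rfl fun b _ => ?_
  rw [Finset.smul_sum]
  refine Finset.sum_congr rfl fun c _ => ?_
  rw [val_cupRight_append₃ hρ, Int.cast_mul, val_corrCochain_near hρ, mul_smul]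
  refine congrArg (fun v : Fin (p + 2 + 1) → E →L[ℝ] ℝ => (val φ (fun a => (ν a : ι)) z : ℝ) •
    corrCoeff (nearVal ρ A z) (nearVal ρ B z) (ν (Fin.last p)) a b c • detAlt E (p + 3) v) ?_
  refine congrArg₂ (fun (v : E →L[ℝ] ℝ) (w : Fin (p + 2) → E →L[ℝ] ℝ) =>
    (Fin.cons v w : Fin (p + 2 + 1) → E →L[ℝ] ℝ)) ?_ ?_
  · refine (covec_mul _ _ z).trans ?_
    change wt ρ z (append₃ ν a b c 0) • dwt ρ z (append₃ ν a b c ⟨p + 1 + (0 : Fin 3), _⟩) +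
      wt ρ z (append₃ ν a b c ⟨p + 1 + (0 : Fin 3), _⟩) • dwt ρ z (append₃ ν a b c 0) = _
    rw [append₃_right, append₃_zero]
    rfl
  · refine Eq.trans ?_ (map_omitTwo_append₃ ν a b c (dwt ρ z))
    funext i
    simp only [omitTwo]
    split_ifs <;> rfl

theorem collation_commCochain_apply (A B : Cech W 2) {p : ℕ} (φ : Cech W p) (z : Z) :
    RawForm.fiber (collation hW hρ (p + 3) (cupRight (commCochain A B) p φ)).1 z =
      ∑ ν : Fin (p + 1) → Near ρ z, (val φ (fun a => (ν a : ι)) z : ℝ) • ∑ a, ∑ b, ∑ c,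
        (commCoeff (nearVal ρ A z) (nearVal ρ B z) (ν (Fin.last p)) a b c * wt ρ z (ν 0)) •
          detAlt E (p + 3) (Fin.append (m := p) (n := 3) (fun i => dwt ρ z (ν i.succ))
            ![dwt ρ z a, dwt ρ z b, dwt ρ z c]) := by
  refine (collation_apply hW hρ _ z).trans ?_
  refine (sum_append₃ _).trans (Finset.sum_congr rfl fun ν _ => ?_)
  rw [Finset.smul_sum]
  refine Finset.sum_congr rfl fun a _ => ?_
  rw [Finset.smul_sum]
  refine Finset.sum_congr rfl fun b _ => ?_
  rw [Finset.smul_sum]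
  refine Finset.sum_congr rfl fun c _ => ?_
  rw [val_cupRight_append₃ hρ, Int.cast_mul, val_commCochain_near hρ, append₃_zero,
    map_append₃_succ ν a b c (dwt ρ z), smul_smul, mul_assoc]

/-- The correction term is a homotopy between collation of `φ ∪ C(A, B)` and zero. -/
theorem dForm_corrHom {A B : Cech W 2} (hA : cechD W 2 A = 0) (hB : cechD W 2 B = 0) {p : ℕ}
    (φ : Cech W p) :
    (-1 : ℤ) ^ p • dForm E Z (p + 2) (corrHom hW hρ p (cupRight (corrCochain A B) p φ)) +
      (-1 : ℤ) ^ (p + 1) •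
        corrHom hW hρ (p + 1) (cupRight (corrCochain A B) (p + 1) (cechD W p φ)) =
      collation hW hρ (p + 3) (cupRight (commCochain A B) p φ) := by
  apply Subtype.ext
  funext z
  refine Eq.trans ?_ (collation_commCochain_apply hW hρ A B φ z).symm
  have hsm : ∀ (m : ℕ) (x : E [⋀^Fin (p + 3)]→L[ℝ] ℝ), (-1 : ℤ) ^ m • x = (-1 : ℝ) ^ m • x := by
    intro m x
    rw [← Int.cast_smul_eq_zsmul ℝ]
    push_cast
    rfl
  have h := corr_homotopy (nearVal_cocycle hρ hA z) (nearVal_cocycle hρ hB z) (sum_dwt z)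
    (sum_wt z) (fun ν : Fin (p + 1) → Near ρ z => (val φ (fun a => (ν a : ι)) z : ℝ))
    (detAlt E (p + 3))
  refine Eq.trans ?_ h
  refine congrArg₂ (fun v w : E [⋀^Fin (p + 3)]→L[ℝ] ℝ => v + w) ?_ ?_
  · exact (hsm p _).trans (congrArg ((-1 : ℝ) ^ p • ·) (dForm_corrHom_apply hW hρ A B φ z))
  · refine (hsm (p + 1) _).trans (congrArg ((-1 : ℝ) ^ (p + 1) • ·)
      ((corrHom_apply hW hρ A B (cechD W p φ) z).trans (Finset.sum_congr rfl fun ν _ => ?_)))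
    rw [val_cechD_near hρ]

variable {n : ℕ} (F : Fin n → Cech W 2)

/-- The correction term of a family of cochains indexed by `i < j`. -/
def correction (p : ℕ) : (Pairs n → Cech W p) →+ Om E Z (p + 2) :=
  (-1 : ℤ) ^ p • (corrHom hW hρ p).comp
    (contractPairs fun ij => cupRight (corrCochain (F ij.1.1) (F ij.1.2)) p)

theorem correction_eq_sum {p : ℕ} (φ : Pairs n → Cech W p) : correction hW hρ F p φ =
    ∑ ij : Pairs n, (-1 : ℤ) ^ p •
      corrHom hW hρ p (cupRight (corrCochain (F ij.1.1) (F ij.1.2)) p (φ ij)) := by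
  rw [← Finset.smul_sum, ← _root_.map_sum]
  rfl

theorem correction_apply {p : ℕ} (φ : Pairs n → Cech W p) (z : Z) :
    (correction hW hρ F p φ).1 z = corr ρ F p φ z := by
  refine congrArg (fun v : E [⋀^Fin (p + 2)]→L[ℝ] ℝ => (-1 : ℤ) ^ p • v) ?_
  refine finsum_congr (M := E [⋀^Fin (p + 2)]→L[ℝ] ℝ) fun ν => ?_
  have h : val (∑ ij : Pairs n, cupRight (corrCochain (F ij.1.1) (F ij.1.2)) p (φ ij)) ν z =
      ∑ ij : Pairs n, val (cupRight (corrCochain (F ij.1.1) (F ij.1.2)) p (φ ij)) ν z :=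
    _root_.map_sum (valHom W ν z) _ _
  refine Eq.trans (b := ((val (∑ ij : Pairs n,
      cupRight (corrCochain (F ij.1.1) (F ij.1.2)) p (φ ij)) ν z : ℤ) : ℝ) •
    (ρ (ν 0) z * ρ (ν ⟨p + 1, by omega⟩) z) • detForm (E := E) fun a => covec (ρ (omitTwo ν a)) z)
    rfl ?_
  rw [h, smul_smul, ← mul_assoc]
  rfl

/-- The homotopy identity for the correction term. -/
theorem dForm_correction {F : Fin n → Cech W 2} (hF : ∀ l, cechD W 2 (F l) = 0) {p : ℕ}
    (φ : Pairs n → Cech W p) :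
    collation hW hρ (p + 3) (contractPairs (cupC F p) φ) =
      dForm E Z (p + 2) (correction hW hρ F p φ) +
        correction hW hρ F (p + 1) fun ij => cechD W p (φ ij) := by
  rw [correction_eq_sum, correction_eq_sum, _root_.map_sum, ← Finset.sum_add_distrib]
  refine (_root_.map_sum (collation hW hρ (p + 3)) _ _).trans (Finset.sum_congr rfl fun ij _ => ?_)
  rw [map_zsmul]
  exact (dForm_corrHom hW hρ (hF ij.1.1) (hF ij.1.2) (φ ij)).symm

end Correction

/-! ### The map of cones defined by collation -/

section BarMap

universe u v

/-- The map of shifted graded groups induced by a map of graded groups. -/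
def shiftMap {X : ℕ → Type u} [∀ k, AddCommGroup (X k)] {Y : ℕ → Type v} [∀ k, AddCommGroup (Y k)]
    (f : ∀ k, X k →+ Y k) : ∀ k, Shift X k →+ Shift Y k
  | 0 => 0
  | k + 1 => f k

theorem contract₁_compLeft {n : ℕ} {A B A' B' : Type*} [AddCommGroup A] [AddCommGroup B]
    [AddCommGroup A'] [AddCommGroup B'] {f : A →+ A'} {g : B →+ B'} {m : Fin n → A →+ B}
    {m' : Fin n → A' →+ B'} (h : ∀ l x, g (m l x) = m' l (f x)) (b : Fin n → A) :
    g (contract₁ m b) = contract₁ m' (f.compLeft (Fin n) b) := by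
  change g (∑ l, m l (b l)) = ∑ l, m' l (f (b l))
  simp only [map_sum, h]

theorem contract₂_compLeft {n : ℕ} {A B A' B' : Type*} [AddCommGroup A] [AddCommGroup B]
    [AddCommGroup A'] [AddCommGroup B'] {f : A →+ A'} {g : B →+ B'} {m : Fin n → A →+ B}
    {m' : Fin n → A' →+ B'} (h : ∀ l x, g (m l x) = m' l (f x)) (c : Pairs n → A) :
    g.compLeft (Fin n) (contract₂ m c) = contract₂ m' (f.compLeft (Pairs n) c) := by
  funext l
  change g (∑ ij : Pairs n, _) = ∑ ij : Pairs n, _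
  simp only [map_sum, map_sub, apply_ite g, h, map_zero]
  rfl

variable {A : ℕ → Type u} [∀ k, AddCommGroup (A k)] {A' : ℕ → Type v} [∀ k, AddCommGroup (A' k)]

/-- The map on pairs `(x^{(k-1)1}, x^{(k-2)2})` which applies `f` to each entry. -/
def barMap (n : ℕ) (f : ∀ k, A k →+ A' k) (k : ℕ) : Bar A n k →+ Bar A' n k :=
  (shiftMap (fun p => (f p).compLeft (Fin n)) k).prodMap
    (shiftMap (shiftMap fun p => (f p).compLeft (Pairs n)) k)

theorem barMap_barD {n : ℕ} {f : ∀ k, A k →+ A' k} {d : ∀ k, A k →+ A (k + 1)}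
    {d' : ∀ k, A' k →+ A' (k + 1)} {m : ∀ k, Fin n → A k →+ A (k + 2)}
    {m' : ∀ k, Fin n → A' k →+ A' (k + 2)} (hf : ∀ k x, f (k + 1) (d k x) = d' k (f k x))
    (hm : ∀ k l x, f (k + 2) (m k l x) = m' k l (f k x)) (k : ℕ) (b : Bar A n k) :
    barMap n f (k + 1) (barD d m k b) = barD d' m' k (barMap n f k b) := by
  have h1 : ∀ (I : Type) k (x : I → A k), (f (k + 1)).compLeft I ((d k).compLeft I x) =
      (d' k).compLeft I ((f k).compLeft I x) := fun I k x => funext fun i => hf k (x i)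
  obtain ⟨b₁, b₂⟩ := b
  refine Prod.ext ?_ ?_
  · refine (map_add (shiftMap (fun p => (f p).compLeft (Fin n)) (k + 1)) _ _).trans
      (congrArg₂ (· + ·) ?_ ?_)
    · cases k with
      | zero => exact map_zero _
      | succ k => exact h1 _ k b₁
    · refine (map_zsmul (shiftMap (fun p => (f p).compLeft (Fin n)) (k + 1)) _ _).trans
        (congrArg ((-1 : ℤ) ^ k • ·) ?_)
      match k, b₂ with
      | 0, _ => exact map_zero _
      | 1, _ => exact map_zero _
      | k + 2, b₂ => exact contract₂_compLeft (hm k) b₂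
  · match k, b₂ with
    | 0, _ => rfl
    | 1, _ => exact map_zero (shiftMap (fun p => (f p).compLeft (Pairs n)) 1)
    | k + 2, b₂ => exact h1 _ k b₂

end BarMap

section CollationCone

variable {E : Type*} [NormedAddCommGroup E] [NormedSpace ℝ E]
  {Z : Type*} [TopologicalSpace Z] [ChartedSpace E Z] [IsManifold 𝓘(ℝ, E) ∞ Z]
  {ι : Type*} {W : ι → Set Z} {ρ : SmoothPartitionOfUnity ι 𝓘(ℝ, E) Z} {n : ℕ}
  (hW : ∀ i, IsOpen (W i)) (hρ : ρ.IsSubordinate W)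

/-- The correction term in all degrees, as a map on the second entries of pairs. -/
def correctionTot (F : Fin n → Cech W 2) : ∀ k, Bar (Cech W) n k →+ Om E Z k
  | 0 => 0
  | 1 => 0
  | p + 2 => (correction hW hρ F p).comp (AddMonoidHom.snd (Fin n → Cech W (p + 1)) _)

theorem correctionTot_apply (F : Fin n → Cech W 2) (k : ℕ) (b : Bar (Cech W) n k) (z : Z) :
    (correctionTot hW hρ F k b).1 z = corrTot ρ F k b.2 z := by
  match k, b with
  | 0, _ => rfl
  | 1, _ => rfl
  | p + 2, b => exact correction_apply hW hρ F b.2 z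

theorem isCollatedBar_barMap {F : Fin n → Cech W 2} (k : ℕ) (b : Bar (Cech W) n k)
    (hb : DFbar F k b = 0) :
    IsCollatedBar ρ k b (barMap (A := Cech W) (A' := Om E Z) n (collation hW hρ) k b) := by
  match k, b with
  | 0, _ => exact ⟨trivial, trivial⟩
  | 1, b => exact ⟨fun l i₀ z hz => collation_eq_collate hW hρ (b.1 l) hz, trivial⟩
  | k + 2, b =>
    have hb2 : ∀ ij, cechD W k (b.2 ij) = 0 := fun ij => congrFun (Prod.ext_iff.1 hb).2 ij
    exact ⟨fun l i₀ z hz => collation_eq_collate hW hρ (b.1 l) hz,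
      fun ij => isCollatedCocycle_collation hW hρ (hb2 ij)⟩

variable [FiniteDimensional ℝ E]

theorem collation_cupF {F : Fin n → Cech W 2} (hF : ∀ l, cechD W 2 (F l) = 0) (k : ℕ) (l : Fin n)
    (φ : Cech W k) : collation hW hρ (k + 2) (cupF F k l φ) =
      wedgeF (fun l => collation hW hρ 2 (F l)) k l (collation hW hρ k φ) :=
  collation_cupRight hW hρ (hF l) φ

/-- Collation commutes with the twisting maps up to the homotopy given by the correction term. -/
theorem collation_twist {F : Fin n → Cech W 2} (hF : ∀ l, cechD W 2 (F l) = 0) (k : ℕ)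
    (b : Bar (Cech W) n k) :
    collation hW hρ (k + 1) (twist (A := Cech W) (cupF F) (cupC F) k b) =
      twist (A := Om E Z) (wedgeF fun l => collation hW hρ 2 (F l)) 0 k
          (barMap (A := Cech W) (A' := Om E Z) n (collation hW hρ) k b) +
        dForm E Z k (correctionTot hW hρ F k b) +
        correctionTot hW hρ F (k + 1) (barD (A := Cech W) (cechD W) (cupF F) k b) := by
  have h1 : ∀ k (x : Fin n → Cech W k), collation hW hρ (k + 2) (contract₁ (cupF F k) x) =
      contract₁ (wedgeF (fun l => collation hW hρ 2 (F l)) k)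
        ((collation hW hρ k).compLeft (Fin n) x) :=
    fun k x => contract₁_compLeft (collation_cupF hW hρ hF k) x
  have h0 : ∀ k (x : Pairs n → Om E Z k),
      contractPairs ((0 : ∀ k, Pairs n → Om E Z k →+ Om E Z (k + 3)) k) x = 0 :=
    fun k x => Finset.sum_eq_zero fun _ _ => rfl
  have case1 : ∀ x : Fin n → Cech W 0, collation hW hρ 2 (contract₁ (cupF F 0) x + 0) =
      (contract₁ (wedgeF (fun l => collation hW hρ 2 (F l)) 0)
        ((collation hW hρ 0).compLeft (Fin n) x) + 0) + dForm E Z 1 0 + correction hW hρ F 0 0 := by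
    intro x
    rw [add_zero, add_zero, h1, map_zero, map_zero, add_zero, add_zero]
  have case2 : ∀ (k : ℕ) (x : Fin n → Cech W (k + 1)) (y : Pairs n → Cech W k)
      (w : Pairs n → Om E Z k),
      collation hW hρ (k + 3) (contract₁ (cupF F (k + 1)) x + contractPairs (cupC F k) y) =
        (contract₁ (wedgeF (fun l => collation hW hρ 2 (F l)) (k + 1))
          ((collation hW hρ (k + 1)).compLeft (Fin n) x) +
            contractPairs ((0 : ∀ k, Pairs n → Om E Z k →+ Om E Z (k + 3)) k) w) +
          dForm E Z (k + 2) (correction hW hρ F k y) +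
          correction hW hρ F (k + 1) fun ij => cechD W k (y ij) := by
    intro k x y w
    rw [map_add, h1, dForm_correction hW hρ hF, h0, add_zero]
    exact (add_assoc _ _ _).symm
  obtain ⟨b₁, b₂⟩ := b
  match k, b₁, b₂ with
  | 0, b₁, b₂ =>
    change collation hW hρ 1 (0 + 0) = (0 + 0) + dForm E Z 0 0 + 0
    simp
  | 1, b₁, b₂ => exact case1 b₁
  | k + 2, b₁, b₂ => exact case2 k b₁ b₂ _

omit [FiniteDimensional ℝ E] in
theorem isCollatedTot_coneMap {F : Fin n → Cech W 2} (k : ℕ) (x : Tot (Cech W) n k)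
    (hx : DF F k x = 0) :
    IsCollatedTot ρ F k x (coneMap (A := Cech W) (A' := Om E Z) (collation hW hρ)
      (barMap (A := Cech W) (A' := Om E Z) n (collation hW hρ)) (correctionTot hW hρ F) k x) := by
  refine ⟨fun i₀ z hz => ?_, isCollatedBar_barMap hW hρ k x.2 (Prod.ext_iff.1 hx).2⟩
  exact congrArg₂ (fun v w : E [⋀^Fin k]→L[ℝ] ℝ => v + (-1 : ℤ) ^ (k + 1) • w)
    (collation_eq_collate hW hρ x.1 hz) (correctionTot_apply hW hρ F k x.2 z)

end CollationCone

end GysinLadder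

end

open GysinLadder in
theorem mainTheorem2 {E : Type*} [NormedAddCommGroup E] [NormedSpace ℝ E] [FiniteDimensional ℝ E]
    {Z : Type*} [TopologicalSpace Z] [T2Space Z] [ParacompactSpace Z] [ChartedSpace E Z]
    [IsManifold 𝓘(ℝ, E) ∞ Z] {ι : Type*} (W : ι → Set Z) (hW : IsGoodCover W) {n : ℕ}
    (F : Fin n → Cech W 2) (hF : ∀ l, cechD W 2 (F l) = 0) :
    (∃ ρ : SmoothPartitionOfUnity ι 𝓘(ℝ, E) Z, ρ.IsSubordinate W) ∧
    ∀ ρ : SmoothPartitionOfUnity ι 𝓘(ℝ, E) Z, ρ.IsSubordinate W →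
      ∃ F₂ : Fin n → Om E Z 2,
        (∀ l, IsCollatedCocycle ρ (F l) (F₂ l)) ∧ (∀ l, dForm E Z 2 (F₂ l) = 0) ∧
        ∃ (a₁ : ∀ k, HCech W k →+ HF F k)
          (a₂ : ∀ k, HF F k →+ HFbar F k)
          (a₃ : ∀ k, HFbar F k →+ HCech W (k + 1))
          (b₁ : ∀ k, HdR E Z k →+ H02 F₂ k)
          (b₂ : ∀ k, H02 F₂ k →+ H12 F₂ k)
          (b₃ : ∀ k, H12 F₂ k →+ HdR E Z (k + 1))
          (v₁ : ∀ k, HCech W k →+ HdR E Z k)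
          (v₂ : ∀ k, HF F k →+ H02 F₂ k)
          (v₃ : ∀ k, HFbar F k →+ H12 F₂ k),
          -- the horizontal maps on representatives
          (∀ k, GivenBy (X := Cech W) (Y := Tot (Cech W) n) (cechD W) (DF F)
              (fun φ y => y = (φ, 0)) (a₁ k)) ∧
          (∀ k, GivenBy (X := Tot (Cech W) n) (Y := Bar (Cech W) n) (DF F) (DFbar F)
              (fun φ y => y = φ.2) (a₂ k)) ∧
          (∀ k, GivenBy (X := Bar (Cech W) n) (Y := Cech W) (DFbar F) (cechD W)
              (fun φ y => y = gysinCup F k φ) (a₃ k)) ∧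
          (∀ k, GivenBy (X := Om E Z) (Y := Tot (Om E Z) n) (dForm E Z) (DF₂ F₂)
              (fun H y => y = (H, 0)) (b₁ k)) ∧
          (∀ k, GivenBy (X := Tot (Om E Z) n) (Y := Bar (Om E Z) n) (DF₂ F₂) (DF₂bar F₂)
              (fun H y => y = H.2) (b₂ k)) ∧
          (∀ k, GivenBy (X := Bar (Om E Z) n) (Y := Om E Z) (DF₂bar F₂) (dForm E Z)
              (fun H y => y = gysinWedge F₂ k H) (b₃ k)) ∧
          -- the vertical maps on representatives
          (∀ k, GivenBy (X := Cech W) (Y := Om E Z) (cechD W) (dForm E Z)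
              (IsCollatedCocycle ρ) (v₁ k)) ∧
          (∀ k, GivenBy (X := Tot (Cech W) n) (Y := Tot (Om E Z) n) (DF F) (DF₂ F₂)
              (IsCollatedTot ρ F k) (v₂ k)) ∧
          (∀ k, GivenBy (X := Bar (Cech W) n) (Y := Bar (Om E Z) n) (DFbar F) (DF₂bar F₂)
              (IsCollatedBar ρ k) (v₃ k)) ∧
          -- exactness of the rows
          Function.Injective (a₁ 0) ∧
          (∀ k, Function.Exact (a₁ k) (a₂ k)) ∧
          (∀ k, Function.Exact (a₂ k) (a₃ k)) ∧
          (∀ k, Function.Exact (a₃ k) (a₁ (k + 1))) ∧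
          Function.Injective (b₁ 0) ∧
          (∀ k, Function.Exact (b₁ k) (b₂ k)) ∧
          (∀ k, Function.Exact (b₂ k) (b₃ k)) ∧
          (∀ k, Function.Exact (b₃ k) (b₁ (k + 1))) ∧
          -- commutativity of the squares
          (∀ k x, b₁ k (v₁ k x) = v₂ k (a₁ k x)) ∧
          (∀ k x, b₂ k (v₂ k x) = v₃ k (a₂ k x)) ∧
          (∀ k x, b₃ k (v₃ k x) = v₁ (k + 1) (a₃ k x)) := by
  have hWo := hW.isOpen
  refine ⟨exists_smoothPartitionOfUnity E W hWo hW.cover, fun ρ hρ => ?_⟩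
  have hF₂ : ∀ l, dForm E Z 2 (collation hWo hρ 2 (F l)) = 0 := fun l => by
    rw [dForm_collation, hF, map_zero]
  have ht := cechD_twist hF
  have ht' := dForm_twist (n := n) hF₂
  have hf : ∀ k (x : Cech W k), collation hWo hρ (k + 1) (cechD W k x) =
      dForm E Z k (collation hWo hρ k x) := fun k x => (dForm_collation hWo hρ x).symm
  have hg := barMap_barD (A := Cech W) (A' := Om E Z) hf (collation_cupF hWo hρ hF)
  have hh := collation_twist hWo hρ hF
  refine ⟨fun l => collation hWo hρ 2 (F l),
    fun l => isCollatedCocycle_collation hWo hρ (hF l), hF₂,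
    coneIncl (A := Cech W) (cechD W) (cupF F) (cupC F),
    coneProj (A := Cech W) (cechD W) (cupF F) (cupC F),
    connecting (A := Cech W) (cechD W) (cupF F) (cupC F) ht,
    coneIncl (A := Om E Z) (dForm E Z) (wedgeF _) 0,
    coneProj (A := Om E Z) (dForm E Z) (wedgeF _) 0,
    connecting (A := Om E Z) (dForm E Z) (wedgeF _) 0 ht',
    cohMapOfCochain (X := Cech W) (Y := Om E Z) (cechD W) (dForm E Z) (collation hWo hρ) hf,
    cohMapOfCochain (X := Tot (Cech W) n) (Y := Tot (Om E Z) n) (DF F) (DF₂ _)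
      (coneMap (A := Cech W) (A' := Om E Z) (collation hWo hρ)
        (barMap (A := Cech W) (A' := Om E Z) n (collation hWo hρ)) (correctionTot hWo hρ F))
      (coneMap_totD (A := Cech W) (A' := Om E Z) hf hg hh),
    cohMapOfCochain (X := Bar (Cech W) n) (Y := Bar (Om E Z) n) (DFbar F) (DF₂bar _)
      (barMap (A := Cech W) (A' := Om E Z) n (collation hWo hρ)) hg,
    givenBy_coneIncl (A := Cech W) _ _ _, givenBy_coneProj (A := Cech W) _ _ _,
    givenBy_connecting (A := Cech W) _ _ _ ht, givenBy_coneIncl (A := Om E Z) _ _ _,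
    givenBy_coneProj (A := Om E Z) _ _ _, givenBy_connecting (A := Om E Z) _ _ _ ht',
    fun k => givenBy_cohMapOfCochain (X := Cech W) (Y := Om E Z)
      fun _ hx => isCollatedCocycle_collation hWo hρ hx,
    fun k => givenBy_cohMapOfCochain (X := Tot (Cech W) n) (Y := Tot (Om E Z) n)
      fun x hx => isCollatedTot_coneMap hWo hρ k x hx,
    fun k => givenBy_cohMapOfCochain (X := Bar (Cech W) n) (Y := Bar (Om E Z) n)
      fun b hb => isCollatedBar_barMap hWo hρ k b hb,
    coneIncl_zero_injective (A := Cech W) _ _ _,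
    exact_coneIncl_coneProj (A := Cech W) _ _ _ ht,
    exact_coneProj_connecting (A := Cech W) _ _ _ ht,
    exact_connecting_coneIncl (A := Cech W) _ _ _ ht,
    coneIncl_zero_injective (A := Om E Z) _ _ _,
    exact_coneIncl_coneProj (A := Om E Z) _ _ _ ht',
    exact_coneProj_connecting (A := Om E Z) _ _ _ ht',
    exact_connecting_coneIncl (A := Om E Z) _ _ _ ht', fun k c => ?_, fun k c => ?_,
    fun k c => connecting_comm (A := Cech W) (A' := Om E Z) ht ht' hf hg hh k c⟩
  · -- the correction term vanishes on cochains with zero second and third entry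
    obtain ⟨x, hx, rfl⟩ := cls_surjective (X := Cech W) _ c
    have h : (collation hWo hρ k x, (0 : Bar (Om E Z) n k)) =
        coneMap (A := Cech W) (A' := Om E Z) (collation hWo hρ)
          (barMap (A := Cech W) (A' := Om E Z) n (collation hWo hρ)) (correctionTot hWo hρ F) k
          (x, 0) := by
      refine Prod.ext ?_ (map_zero _).symm
      change _ = _ + (-1 : ℤ) ^ (k + 1) • correctionTot hWo hρ F k 0
      rw [map_zero, smul_zero, add_zero]
    refine (cls_eq_iff (X := Tot (Om E Z) n)).2 ⟨0, ?_⟩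
    rw [map_zero]
    exact (sub_eq_zero.2 h).symm
  · obtain ⟨x, hx, rfl⟩ := cls_surjective (X := Tot (Cech W) n) _ c
    rfl
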